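/- Let $n \ge 3$ be an odd integer and $m = 2^{(n-1)/2}$. Let $\Omega \subset \mathbb{R}^n$ be a compact domain with smooth boundary $\Sigma = \partial\Omega$ (not necessarily connected), let $g$ be a smooth Riemannian metric on an open set $U \supseteq \Omega$, and let $N : \Sigma \to S^{n-1}$ be a smooth map. Denote by $R$ the scalar curvature of $g$, by $\nu$ the outward unit normal of $\Sigma$ with respect to $g$, by $H = \sum_{k=1}^{n-1} g(\nabla_{e_k}\nu, e_k)$ the mean curvature of $\Sigma$ ($e_1,\dots,e_{n-1}$ a $g$-orthonormal basis of the tangent space of $\Sigma$), and by $d\mathrm{vol}_g$, $d\sigma_g$ the Riemannian volume and surface measures. Let $\hat\rho : \mathrm{Cl}(n,\mathbb{C}) \to \mathrm{End}(\Delta)$ be a spin representation, i.e. a surjective algebra homomorphism with $\dim_{\mathbb{C}} \Delta = m$, where $\Delta$ carries a Hermitian inner product $\langle\cdot,\cdot\rangle$ (linear in the first argument) such that each $\hat\rho(E_a)$ is skew-adjoint, $\hat\rho(E_a)\hat\rho(E_b)+\hat\rho(E_b)\hat\rho(E_a) = -2\delta_{ab}\,\mathrm{id}$, and $i^{(n+1)/2}\hat\rho(E_1)\cdots\hat\rho(E_n)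 = \mathrm{id}$; here $E_1,\dots,E_n$ is the standard basis of $\mathbb{R}^n$. Let $\hat s_1,\dots,\hat s_m$ be an orthonormal basis of $\Delta$ and $\omega_{a\alpha\beta} = \langle \hat\rho(E_a)\hat s_\alpha, \hat s_\beta\rangle$. Let $b_1,\dots,b_n$ be a smooth positively oriented $g$-orthonormal frame on $U$, and use it to identify the spinor bundle of $g$ with the trivial bundle with fibre $\Delta$: Clifford multiplication is $\xi\cdot u = \sum_a g(\xi,b_a)\,\hat\rho(E_a)u$, and the spin connection is $$\nabla_X s = X(s) + \tfrac14 \sum_{j,k=1}^n g(\nabla_X b_j, b_k)\, b_j\cdot b_k\cdot s .$$ The Dirac operator is $\mathcal{D}s = \sum_{k=1}^n b_k\cdot\nabla_{b_k}s$, and the boundary Dirac operator, acting on spinors along $\Sigma$, is $$\mathcal{D}^\Sigma s = \sum_{k=1}^{n-1}\nu\cdot e_k\cdot\nabla_{e_k}s + \tfrac12 H s .$$ For an $m$-tuple of spinors $s=(s_1,\dots,s_m)$ along $\Sigma$ put $$(\chi s)_\alpha = -\sum_{a=1}^n\sum_{\beta=1}^m \langle N,E_a\rangle\,\omega_{a\alpha\beta}\,\nu\cdot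 s_\beta .$$ At each point $x\in\Sigma$ let $\|dN\|_{\mathrm{tr}} = \sup_Q \mathrm{tr}(Q\circ dN)$ be the trace norm of $dN : T_x\Sigma\to T_{N(x)}S^{n-1}$, the supremum being over all linear isometries $Q : T_{N(x)}S^{n-1}\to T_x\Sigma$, where $T_x\Sigma$ carries $g$ and $T_{N(x)}S^{n-1}$ the standard inner product. Then, for every $m$-tuple $s=(s_1,\dots,s_m)$ of spinors that are smooth on $\Omega$ (up to the boundary), $$\begin{aligned} &-\int_\Omega \sum_{\alpha=1}^m |\mathcal{D}s_\alpha|^2\,d\mathrm{vol}_g + \int_\Omega\sum_{\alpha=1}^m|\nabla s_\alpha|^2\,d\mathrm{vol}_g + \frac14\int_\Omega\sum_{\alpha=1}^m R\,|s_\alpha|^2\,d\mathrm{vol}_g\\ &\le \frac12\int_\Sigma\sum_{\alpha=1}^m\langle\mathcal{D}^\Sigma s_\alpha, s_\alpha-(\chi s)_\alpha\rangle\,d\sigma_g + \frac12\int_\Sigma\sum_{\alpha=1}^m\langle s_\alpha-(\chi s)_\alpha,\mathcal{D}^\Sigma s_\alpha\rangle\,d\sigma_g\\ &\quad-\frac12\int_\Sigma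 (H-\|dN\|_{\mathrm{tr}})\Big(\sum_{\alpha=1}^m|s_\alpha|^2\Big)\,d\sigma_g . \end{aligned}$$ -/

import Mathlib

open Filter MeasureTheory
open scoped Topology ContDiff ComplexOrder

noncomputable section

namespace SpinDomain

/-- Euclidean space `ℝⁿ`. -/
abbrev Eu (n : ℕ) := EuclideanSpace ℝ (Fin n)

/-- The standard basis vector `E_a` of `ℝⁿ`. -/
def stdVec {n : ℕ} (a : Fin n) : Eu n := EuclideanSpace.single a 1

/-! ## Compact domains with smooth boundary -/

/-- `Ω` is a compact domain with smooth boundary: near each boundary point, `Ω` is a sublevel set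
`{f ≤ 0}` of a smooth function without critical points. -/
def IsSmoothCompactDomain {n : ℕ} (Ω : Set (Eu n)) : Prop :=
  IsCompact Ω ∧ ∀ x ∈ frontier Ω, ∃ V : Set (Eu n), IsOpen V ∧ x ∈ V ∧
    ∃ f : Eu n → ℝ, ContDiffOn ℝ ∞ f V ∧ (∀ y ∈ V, fderiv ℝ f y ≠ 0) ∧
      Ω ∩ V = {y | y ∈ V ∧ f y ≤ 0}

/-- The tangent space at `x` of a smooth hypersurface `S ⊆ ℝⁿ`, as a linear subspace of `ℝⁿ`. -/
def tangentSpace {n : ℕ} (S : Set (Eu n)) (x : Eu n) : Submodule ℝ (Eu n) :=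
  Submodule.span ℝ (tangentConeAt ℝ S x)

/-! ## Riemannian geometry in the global coordinates of `ℝⁿ`

A metric is given by its matrix `G x i j = g_x(E_i, E_j)`. -/

section Metric

variable {n : ℕ} (G : Eu n → Matrix (Fin n) (Fin n) ℝ)

/-- `G` is a smooth Riemannian metric on the set `U` (used for open `U`). -/
def IsRiemannianMetricOn (U : Set (Eu n)) : Prop :=
  (∀ i j, ContDiffOn ℝ ∞ (fun x => G x i j) U) ∧ ∀ x ∈ U, (G x).PosDef

/-- The inner product `g_x(u, v)`. -/
def metricInner (x u v : Eu n) : ℝ := ∑ i, ∑ j, G x i j * u i * v j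

/-- The partial derivative `∂_i f` at `x`. -/
def partialDeriv (i : Fin n) (f : Eu n → ℝ) (x : Eu n) : ℝ := fderiv ℝ f x (stdVec i)

/-- The Christoffel symbol `Γ^k_{ij}` of the Levi-Civita connection at `x`. -/
def christoffel (k i j : Fin n) (x : Eu n) : ℝ :=
  (1 / 2) * ∑ l, (G x)⁻¹ k l *
    (partialDeriv i (fun y => G y j l) x + partialDeriv j (fun y => G y i l) x
      - partialDeriv l (fun y => G y i j) x)

/-- The Ricci tensor `Ric_{jk}` at `x` (positive on round spheres). -/
def ricci (j k : Fin n) (x : Eu n) : ℝ :=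
  ∑ i, (partialDeriv i (christoffel G i j k) x - partialDeriv j (christoffel G i i k) x
    + ∑ m, (christoffel G i i m x * christoffel G m j k x
      - christoffel G i j m x * christoffel G m i k x))

/-- The scalar curvature `R` at `x`. -/
def scalarCurvature (x : Eu n) : ℝ := ∑ j, ∑ k, (G x)⁻¹ j k * ricci G j k x

/-- The Levi-Civita covariant derivative `∇_X Y` at `x` of a vector field `Y` defined on the
set `A`. If `A` is a hypersurface, this is meaningful for `X` tangent to `A` at `x`. -/
def covDeriv (A : Set (Eu n)) (Y : Eu n → Eu n) (x X : Eu n) : Eu n :=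
  fderivWithin ℝ Y A x X +
    WithLp.toLp 2 (fun k => ∑ i, ∑ j, christoffel G k i j x * X i * Y x j)

/-- `b` is a smooth positively oriented `g`-orthonormal frame on `U` (used for open `U`). -/
def IsOrientedOrthonormalFrame (U : Set (Eu n)) (b : Fin n → Eu n → Eu n) : Prop :=
  (∀ j, ContDiffOn ℝ ∞ (b j) U) ∧
  (∀ x ∈ U, ∀ j k, metricInner G x (b j x) (b k x) = if j = k then 1 else 0) ∧
  ∀ x ∈ U, 0 < (Matrix.of fun i j => b j x i).det

/-- The integral `∫_Ω f dvol_g`. -/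
def volIntegral (Ω : Set (Eu n)) (f : Eu n → ℝ) : ℝ :=
  ∫ x in Ω, f x * √(G x).det

/-! ### Geometry of the boundary -/

/-- `v` is the outward-pointing unit normal vector, with respect to `g`, to the boundary of `Ω`
at the boundary point `x`. -/
def IsOutwardUnitNormal (Ω : Set (Eu n)) (x v : Eu n) : Prop :=
  metricInner G x v v = 1 ∧
  (∀ ξ ∈ tangentSpace (frontier Ω) x, metricInner G x v ξ = 0) ∧
  ∀ᶠ t : ℝ in 𝓝[>] 0, x + t • v ∉ Ω

/-- The outward-pointing unit normal vector field `ν` along the boundary of `Ω`. -/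
def outwardNormal (Ω : Set (Eu n)) (x : Eu n) : Eu n :=
  Classical.epsilon (IsOutwardUnitNormal G Ω x)

/-- `e` is a `g`-orthonormal basis `e_1, …, e_{n-1}` of the tangent space at `x` of the
hypersurface `S`. -/
def IsTangentFrame (S : Set (Eu n)) (x : Eu n) (e : Fin (n - 1) → Eu n) : Prop :=
  (∀ k, e k ∈ tangentSpace S x) ∧
  ∀ k l, metricInner G x (e k) (e l) = if k = l then 1 else 0

/-- A choice of `g`-orthonormal basis of `T_x S`. The quantities defined with it below do not
depend on the choice. -/
def tangentFrame (S : Set (Eu n)) (x : Eu n) : Fin (n - 1) → Eu n :=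
  Classical.epsilon (IsTangentFrame G S x)

/-- The second fundamental form `g(∇_X ν, Y)` of the boundary of `Ω`. -/
def secondFundamentalForm (Ω : Set (Eu n)) (x X Y : Eu n) : ℝ :=
  metricInner G x (covDeriv G (frontier Ω) (outwardNormal G Ω) x X) Y

/-- The mean curvature `H` of the boundary of `Ω`: the trace of the second fundamental form. -/
def meanCurvature (Ω : Set (Eu n)) (x : Eu n) : ℝ :=
  ∑ k, secondFundamentalForm G Ω x (tangentFrame G (frontier Ω) x k)
    (tangentFrame G (frontier Ω) x k)

/-- The density at `x` of the Riemannian surface measure of a hypersurface `S` with respect to its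
Euclidean surface measure: the square root of the Gram determinant of `g` on a Euclidean
orthonormal basis of `T_x S`. -/
def surfaceDensity (S : Set (Eu n)) (x : Eu n) : ℝ :=
  √(Matrix.of fun i j => metricInner G x
      (stdOrthonormalBasis ℝ (tangentSpace S x) i : Eu n)
      (stdOrthonormalBasis ℝ (tangentSpace S x) j : Eu n)).det

/-- The integral `∫_S f dσ_g` over the hypersurface `S`; here `μHE[n - 1]` is the
`(n-1)`-dimensional Hausdorff measure, normalized to be the Euclidean surface measure. -/
def surfaceIntegral {F : Type*} [NormedAddCommGroup F] [NormedSpace ℝ F]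
    (S : Set (Eu n)) (f : Eu n → F) : F :=
  ∫ x in S, surfaceDensity G S x • f x ∂(μHE[n - 1] : Measure (Eu n))

end Metric

/-! ## The trace norm -/

/-- The trace norm of a linear map `L : V → W`, where `V` and `W` carry the inner products `β`
and `γ`: the supremum of `tr (Q L)` over all linear isometries `Q : W → V`. -/
def traceNorm {V W : Type*} [AddCommGroup V] [Module ℝ V] [AddCommGroup W] [Module ℝ W]
    (β : V → V → ℝ) (γ : W → W → ℝ) (L : V →ₗ[ℝ] W) : ℝ :=
  sSup {t | ∃ Q : W →ₗ[ℝ] V, (∀ w w', β (Q w) (Q w') = γ w w') ∧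
    t = LinearMap.trace ℝ V (Q ∘ₗ L)}

/-- The differential `dN : T_x S → T_{N(x)} S^{n-1}` of a map `N` from `S` to the unit sphere,
where `T_{N(x)} S^{n-1}` is the orthogonal complement of `N(x)`. (The values of the derivative of
`N` on `T_x S` lie in that complement, so that the projection does not change them.) -/
def sphereDifferential {n : ℕ} (S : Set (Eu n)) (N : Eu n → Eu n) (x : Eu n) :
    tangentSpace S x →ₗ[ℝ] ((ℝ ∙ N x)ᗮ : Submodule ℝ (Eu n)) :=
  ((ℝ ∙ N x)ᗮ).orthogonalProjectionOnto.toLinearMap ∘ₗ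
    (fderivWithin ℝ N S x).toLinearMap ∘ₗ (tangentSpace S x).subtype

/-- The trace norm `‖dN‖_tr` at `x`, with respect to `g` on `T_x S` and the standard inner product
on `T_{N(x)} S^{n-1}`. -/
def traceNormDifferential {n : ℕ} (G : Eu n → Matrix (Fin n) (Fin n) ℝ)
    (S : Set (Eu n)) (N : Eu n → Eu n) (x : Eu n) : ℝ :=
  traceNorm (fun u v : tangentSpace S x => metricInner G x u v)
    (fun w w' : ((ℝ ∙ N x)ᗮ : Submodule ℝ (Eu n)) => inner ℝ w w')
    (sphereDifferential S N x)

/-! ## Spinors -/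

/-- The quadratic form `z ↦ -∑ z_a ^ 2` on `ℂⁿ`, whose Clifford algebra is `Cl(n, ℂ)`. -/
def cliffordForm (n : ℕ) : QuadraticForm ℂ (Fin n → ℂ) :=
  QuadraticMap.weightedSumSquares ℂ (fun _ : Fin n => (-1 : ℂ))

/-- The spin representation of `Cl(n, ℂ)`, for odd `n`, on the Hermitian vector space `Δ`, with
the normalization `i ^ ((n + 1) / 2) ρ(E_1) ⋯ ρ(E_n) = id`. -/
structure SpinRep (n : ℕ) (Δ : Type*) [NormedAddCommGroup Δ] [InnerProductSpace ℂ Δ] where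
  toAlgHom : CliffordAlgebra (cliffordForm n) →ₐ[ℂ] Module.End ℂ Δ
  surjective : Function.Surjective toAlgHom
  finrank_eq : Module.finrank ℂ Δ = 2 ^ (n / 2)
  skewAdjoint : ∀ (a : Fin n) (u v : Δ),
    inner ℂ (toAlgHom (CliffordAlgebra.ι (cliffordForm n) (Pi.single a 1)) u) v =
      -inner ℂ u (toAlgHom (CliffordAlgebra.ι (cliffordForm n) (Pi.single a 1)) v)
  volumeElement : Complex.I ^ ((n + 1) / 2) •
    (List.ofFn fun a : Fin n =>
      toAlgHom (CliffordAlgebra.ι (cliffordForm n) (Pi.single a 1))).prod = 1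

section Spinors

variable {n : ℕ} {Δ : Type*} [NormedAddCommGroup Δ] [InnerProductSpace ℂ Δ]

/-- The endomorphism `ρ(E_a)` of `Δ`. -/
def SpinRep.gen (ρ : SpinRep n Δ) (a : Fin n) : Module.End ℂ Δ :=
  ρ.toAlgHom (CliffordAlgebra.ι (cliffordForm n) (Pi.single a 1))

/-- The Hermitian inner product `⟨u, v⟩` of `Δ`, linear in the first argument. -/
def herm (u v : Δ) : ℂ := inner ℂ v u

/-- The coefficients `ω_{aαβ} = ⟨ρ(E_a) ŝ_α, ŝ_β⟩`. -/
def omega {m : ℕ} (ρ : SpinRep n Δ) (sHat : OrthonormalBasis (Fin m) ℂ Δ)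
    (a : Fin n) (α β : Fin m) : ℂ :=
  herm (ρ.gen a (sHat α)) (sHat β)

/-! The `g`-orthonormal frame `b` identifies the spinor bundle with the trivial bundle with
fibre `Δ`, in such a way that the Clifford action of `b_a` is `ρ(E_a)`. -/

variable (ρ : SpinRep n Δ) (G : Eu n → Matrix (Fin n) (Fin n) ℝ) (b : Fin n → Eu n → Eu n)

/-- Clifford multiplication `ξ · u` by a tangent vector `ξ` at `x`. -/
def cliffordMul (x ξ : Eu n) (u : Δ) : Δ :=
  ∑ a, (metricInner G x ξ (b a x) : ℂ) • ρ.gen a u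

/-- The spin connection: the covariant derivative `∇_X s` at `x` of a spinor field `s` defined on
the set `A`, namely `X(s) + (1/4) ∑_{j,k} g(∇_X b_j, b_k) b_j · b_k · s`. If `A` is a
hypersurface, this is meaningful for `X` tangent to `A` at `x`. -/
def spinDeriv (A : Set (Eu n)) (s : Eu n → Δ) (x X : Eu n) : Δ :=
  fderivWithin ℝ s A x X + (1 / 4 : ℂ) • ∑ j, ∑ k,
    (metricInner G x (covDeriv G Set.univ (b j) x X) (b k x) : ℂ) •
      ρ.gen j (ρ.gen k (s x))

/-- The Dirac operator `𝒟 s = ∑_k e_k · ∇_{e_k} s` on `Ω`. -/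
def dirac (Ω : Set (Eu n)) (s : Eu n → Δ) (x : Eu n) : Δ :=
  ∑ k, cliffordMul ρ G b x (b k x) (spinDeriv ρ G b Ω s x (b k x))

/-- `|∇s|²` at `x`. -/
def gradNormSq (Ω : Set (Eu n)) (s : Eu n → Δ) (x : Eu n) : ℝ :=
  ∑ k, ‖spinDeriv ρ G b Ω s x (b k x)‖ ^ 2

/-- The boundary Dirac operator `𝒟^Σ s = ∑_{k=1}^{n-1} ν · e_k · ∇_{e_k} s + (1/2) H s` for a
spinor field `s` along the boundary `Σ` of `Ω`. -/
def boundaryDirac (Ω : Set (Eu n)) (s : Eu n → Δ) (x : Eu n) : Δ :=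
  (∑ k, cliffordMul ρ G b x (outwardNormal G Ω x)
    (cliffordMul ρ G b x (tangentFrame G (frontier Ω) x k)
      (spinDeriv ρ G b (frontier Ω) s x (tangentFrame G (frontier Ω) x k))))
  + ((1 / 2 * meanCurvature G Ω x : ℝ) : ℂ) • s x

/-- The boundary operator
`(χ s)_α = -∑_{a, β} ⟨N, E_a⟩ ω_{aαβ} ν · s_β` on `m`-tuples of spinors. -/
def chi {m : ℕ} (sHat : OrthonormalBasis (Fin m) ℂ Δ) (Ω : Set (Eu n)) (N : Eu n → Eu n)
    (s : Fin m → Eu n → Δ) (α : Fin m) (x : Eu n) : Δ :=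
  -∑ a, ∑ β, ((inner ℝ (N x) (stdVec a) : ℝ) * omega ρ sHat a α β : ℂ) •
    cliffordMul ρ G b x (outwardNormal G Ω x) (s β x)

end Spinors

end SpinDomain

end

open SpinDomain

/-!
The spinors of a tuple are treated as one spinor field `s` with values in `S = Δ ⊕ ⋯ ⊕ Δ`, regarded
as a real inner product space. Two families of skew endomorphisms act on `S` and commute: the
Clifford generators `γ_a`, acting on each member of the tuple, and the matrices `τ_a = ω_a`, acting
on the index. Both satisfy the Clifford relations (`isClifford_tupleEnd`, `isClifford_tupleMatrix`).
With `τ(N) = ∑ ⟨N, E_a⟩ τ_a`, the boundary operator is `χ s = -ν · τ(N) s`, and nothing else about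
the spin representation is needed.

**The volume terms.** The field `∑_a ⟨∑_c (γ_a γ_c + δ_{ac}) ∇_c s, s⟩ b_a` has divergence `|∇s|² -
|𝒟s|² + R |s|² / 4` (`divergence_lichnerowiczField`): its connection terms cancel, and by the first
Bianchi identity the only surviving contraction of the curvature is the scalar curvature. Its normal
component along the boundary is `⟨𝒟^Σ s, s⟩ - H |s|² / 2`. By the divergence theorem, the left hand
side is therefore the integral of this expression over the boundary (`volIntegral_lichnerowicz`).

**The boundary term with `χ`.** Since the form `⟨ξ · u, τ(N) v⟩` is symmetric in `u` and `v`, `2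
⟨𝒟^Σ s, χ s⟩ = -div_Σ P + ∑_k ⟨e_k · s, τ(dN e_k) s⟩`, where `P` is the field dual to `ξ ↦ ⟨ξ · s,
τ(N) s⟩` (`two_mul_inner_boundaryDiracOn_boundaryChi`). The divergence of the tangential part of `P`
integrates to zero (`surfaceIntegral_boundaryDiv`), and the sum over `k` is at most `‖dN‖_tr |s|²`:
it does not depend on the tangent frame, and in a frame of singular vectors of `dN` each term is a
singular value times a pairing of two spinors of length `|s|`
(`sum_inner_le_traceNormDifferential`). Together these give the inequality for the real parts. The
two Hermitian boundary integrals are complex conjugates of each other, so half their sum is the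
integral of the real part.

**The divergence theorem** for a compact domain with smooth boundary and the Hausdorff measure on
the boundary is proved from graph charts (`IsGraphChart`): the boundary is locally the zero set of a
function `f` with `f (x + t v) = f x + t`, the coordinates `(y, t) ↦ γ y + t v` based on the graph
`γ` are a shear and preserve volume, the area formula for `γ` computes the surface measure, and a
partition of unity globalizes (`IsSmoothCompactDomain.integral_divergence`). The theorem on the
closed hypersurface follows from it: `div_Σ` of a tangential field is the flux of the divergence of
the bivector `ν ∧ W`, which is itself divergence free.

The trace norm of `dN` is shown to be continuous by writing it as the maximum of a continuous
function over the compact set of orthonormal frames of `ℝⁿ`, so that all integrands are integrable.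
-/

noncomputable section

namespace SpinDomain

set_option linter.unusedSectionVars false

/-! ### The area formula -/

open Measure in
/-- Comparison of the Hausdorff measures of two images of one set `B`, when distances in the first
are at most `K` times the distances in the second: the map from the second to the first is well
defined and `K`-Lipschitz. -/
theorem euclideanHausdorffMeasure_image_le {X Y Z : Type*} [MetricSpace X] [MetricSpace Y]
    [MeasurableSpace X] [BorelSpace X] [MeasurableSpace Y] [BorelSpace Y]
    (d : ℕ) {f : Z → X} {g : Z → Y} {K : NNReal} {B : Set Z}
    (h : ∀ a ∈ B, ∀ b ∈ B, dist (f a) (f b) ≤ K * dist (g a) (g b)) :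
    (μHE[d] : Measure X) (f '' B) ≤ (K : ENNReal) ^ d * (μHE[d] : Measure Y) (g '' B) := by
  rcases B.eq_empty_or_nonempty with rfl | ⟨z0, hz0⟩
  · simp
  have : Nonempty Z := ⟨z0⟩
  have key : f '' B = (fun y => f (Function.invFunOn g B y)) '' (g '' B) := by
    rw [Set.image_image]
    refine Set.image_congr fun a ha => ?_
    have h1 := Function.invFunOn_mem (f := g) (s := B) (b := g a) ⟨a, ha, rfl⟩
    have h2 := Function.invFunOn_eq (f := g) (s := B) (b := g a) ⟨a, ha, rfl⟩
    have := h a ha _ h1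
    rw [h2, dist_self, mul_zero] at this
    exact dist_le_zero.1 this
  have hL : LipschitzOnWith K (fun y => f (Function.invFunOn g B y)) (g '' B) := by
    refine LipschitzOnWith.of_dist_le_mul fun y hy z hz => ?_
    have h1 := h _ (Function.invFunOn_mem hy) _ (Function.invFunOn_mem hz)
    rwa [Function.invFunOn_eq hy, Function.invFunOn_eq hz] at h1
  have := hL.hausdorffMeasure_image_le (d := (d : ℝ)) (by positivity)
  rw [← key, ENNReal.rpow_natCast] at this
  rw [euclideanHausdorffMeasure_def, euclideanHausdorffMeasure_def]
  simp only [Measure.smul_apply, ENNReal.smul_def, smul_eq_mul]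
  calc _ ≤ _ := mul_le_mul_right this _
    _ = _ := by ring

section Area

variable {F E : Type*} [NormedAddCommGroup F] [InnerProductSpace ℝ F] [FiniteDimensional ℝ F]
  [MeasurableSpace F] [BorelSpace F] [NormedAddCommGroup E] [InnerProductSpace ℝ E]
  [MeasurableSpace E] [BorelSpace E]

/-- Near a point, a map with injective strict derivative `L` distorts the Hausdorff measure as `L`
does, up to a factor close to one. -/
theorem eventually_measure_image_le {γ : F → E} {L : F →L[ℝ] E} {x : F} {c : ℝ} (hc : 0 < c)
    (hL : ∀ v, c * ‖v‖ ≤ ‖L v‖) (hγ : HasStrictFDerivAt γ L x) {ε : NNReal} (hε : 0 < ε) :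
    ∃ s ∈ 𝓝 x, ∀ B ⊆ s,
      (μHE[Module.finrank ℝ F] : Measure E) (γ '' B) ≤
        (1 + ε : ENNReal) ^ Module.finrank ℝ F *
          (ENNReal.ofReal L.toLinearMap.normDet * volume B) ∧
      ENNReal.ofReal L.toLinearMap.normDet * volume B ≤
        (1 + ε : ENNReal) ^ Module.finrank ℝ F *
          (μHE[Module.finrank ℝ F] : Measure E) (γ '' B) := by
  -- the admissible error `δ` of the linear approximation, chosen so that both `1 + δ / c` and
  -- `(1 - δ / c)⁻¹` are at most `1 + ε`
  set δ : ℝ := c * ε / (1 + ε) with hδ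
  have hε' : (0 : ℝ) < ε := hε
  have hδ0 : 0 < δ := by positivity
  obtain ⟨s, hs, hA⟩ := hγ.approximates_deriv_on_nhds (c := ⟨δ, hδ0.le⟩) (Or.inr hδ0)
  have hδc : δ ≤ c * ε := by
    rw [hδ]; exact div_le_self (by positivity) (by linarith)
  have hδ2 : δ * (1 + ε) = c * ε := by rw [hδ]; field_simp
  refine ⟨s, hs, fun B hB => ?_⟩
  have hdist : ∀ a ∈ B, ∀ b ∈ B, ‖γ a - γ b - L (a - b)‖ ≤ δ * ‖a - b‖ := fun a ha b hb => by
    exact hA a (hB ha) b (hB hb)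
  have h1 : ∀ a ∈ B, ∀ b ∈ B, dist (γ a) (γ b) ≤ ((1 + ε : NNReal) : ℝ) * dist (L a) (L b) := by
    intro a ha b hb
    rw [dist_eq_norm, dist_eq_norm, ← map_sub]
    have h1 := hdist a ha b hb
    have h2 := hL (a - b)
    have h3 : ‖γ a - γ b‖ ≤ ‖γ a - γ b - L (a - b)‖ + ‖L (a - b)‖ := by
      simpa using norm_add_le (γ a - γ b - L (a - b)) (L (a - b))
    push_cast
    nlinarith [norm_nonneg (a - b), mul_le_mul_of_nonneg_right hδc (norm_nonneg (a - b))]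
  have h2 : ∀ a ∈ B, ∀ b ∈ B, dist (L a) (L b) ≤ ((1 + ε : NNReal) : ℝ) * dist (γ a) (γ b) := by
    intro a ha b hb
    rw [dist_eq_norm, dist_eq_norm, ← map_sub]
    have h1 := hdist a ha b hb
    have h2 := hL (a - b)
    have h3 : ‖L (a - b)‖ ≤ ‖γ a - γ b - L (a - b)‖ + ‖γ a - γ b‖ := by
      simpa using norm_sub_le (γ a - γ b) (γ a - γ b - L (a - b)) |>.trans (add_comm _ _).le
    push_cast
    nlinarith [norm_nonneg (a - b), mul_le_mul_of_nonneg_left h3 (show (0:ℝ) ≤ 1 + ε by positivity)]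
  have hvol := L.toLinearMap.euclideanHausdorffMeasure_image_eq_normDet_mul_volume B
  rw [← hvol]
  exact ⟨by simpa using euclideanHausdorffMeasure_image_le (Module.finrank ℝ F) h1,
    by simpa using euclideanHausdorffMeasure_image_le (Module.finrank ℝ F) h2⟩

/-- The **area formula** for a `C¹` embedding that does not decrease distances infinitesimally. The
measure `B ↦ μHE (γ B)` on the source is absolutely continuous, and its density is computed on small
balls by `eventually_measure_image_le` and the Besicovitch differentiation theorem. -/
theorem euclideanHausdorffMeasure_image_eq_lintegral {γ : F → E} {γ' : F → F →L[ℝ] E}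
    (hemb : MeasurableEmbedding γ)
    (hexp : ∀ y v, ‖v‖ ≤ ‖γ' y v‖) (hγ : ∀ y, HasStrictFDerivAt γ (γ' y) y)
    {B : Set F} (hB : MeasurableSet B) :
    (μHE[Module.finrank ℝ F] : Measure E) (γ '' B) =
      ∫⁻ y in B, ENNReal.ofReal (γ' y).toLinearMap.normDet := by
  set d := Module.finrank ℝ F
  set ν : Measure F := (μHE[d] : Measure E).comap γ with hν
  have hνa : ∀ s, ν s = (μHE[d] : Measure E) (γ '' s) := fun s => hemb.comap_apply _ s
  have hex : ∀ y, ∀ ε : NNReal, 0 < ε → _ := fun y ε hε =>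
    eventually_measure_image_le (L := γ' y) one_pos (by simpa using hexp y) (hγ y) hε
  have : IsLocallyFiniteMeasure ν := by
    refine ⟨fun y => ?_⟩
    obtain ⟨s, hs, h⟩ := hex y 1 one_pos
    obtain ⟨r, hr, hrs⟩ := Metric.nhds_basis_closedBall.mem_iff.1 hs
    refine ⟨Metric.closedBall y r, Metric.closedBall_mem_nhds y hr, ?_⟩
    rw [hνa]
    refine (h _ hrs).1.trans_lt ?_
    refine ENNReal.mul_lt_top (ENNReal.pow_lt_top (by simp)) (ENNReal.mul_lt_top (by simp)
      measure_closedBall_lt_top)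
  have hac : ν ≪ volume := by
    refine Measure.AbsolutelyContinuous.mk fun s _ hs => ?_
    refine measure_null_of_locally_null s fun y _ => ?_
    obtain ⟨t, ht, h⟩ := hex y 1 one_pos
    refine ⟨s ∩ t, Filter.inter_mem self_mem_nhdsWithin (mem_nhdsWithin_of_mem_nhds ht), ?_⟩
    rw [hνa]
    refine le_antisymm ((h _ Set.inter_subset_right).1.trans ?_) bot_le
    rw [measure_mono_null Set.inter_subset_left hs]
    simp
  -- the density of `ν` at `y` is squeezed between `(1 + ε) ^ (-d) * J` and `(1 + ε) ^ d * J`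
  have hlim : ∀ y, Tendsto (fun r => ν (Metric.closedBall y r) / volume (Metric.closedBall y r))
      (𝓝[>] 0) (𝓝 (ENNReal.ofReal (γ' y).toLinearMap.normDet)) := by
    intro y
    set J := ENNReal.ofReal (γ' y).toLinearMap.normDet with hJ
    have hJt : J ≠ ⊤ := by simp [hJ]
    have hc : ∀ a : ENNReal, a ≠ ⊤ → Tendsto (fun ε : NNReal => (1 + ε : ENNReal) ^ d * a)
        (𝓝[>] 0) (𝓝 a) := by
      intro a ha
      have h1 : ContinuousAt (fun ε : NNReal => (1 + ε : ENNReal) ^ d) 0 := by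
        refine Continuous.continuousAt ?_
        exact (ENNReal.continuous_pow d).comp (continuous_const.add ENNReal.continuous_coe)
      have h2 := ENNReal.Tendsto.mul_const (b := a) (h1.tendsto.mono_left nhdsWithin_le_nhds)
        (Or.inr ha) (f := 𝓝[>] 0)
      simpa using h2
    have hev : ∀ ε : NNReal, 0 < ε → ∀ᶠ r in 𝓝[>] (0 : ℝ),
        ν (Metric.closedBall y r) / volume (Metric.closedBall y r) ≤ (1 + ε : ENNReal) ^ d * J ∧
        J ≤ (1 + ε : ENNReal) ^ d *
          (ν (Metric.closedBall y r) / volume (Metric.closedBall y r)) := by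
      intro ε hε
      obtain ⟨s, hs, h⟩ := hex y ε hε
      obtain ⟨r0, hr0, hrs⟩ := Metric.nhds_basis_closedBall.mem_iff.1 hs
      filter_upwards [Ioc_mem_nhdsGT hr0] with r hr
      have hsub := (Metric.closedBall_subset_closedBall (x := y) hr.2).trans hrs
      have hv0 : volume (Metric.closedBall y r) ≠ 0 := (Metric.measure_closedBall_pos _ _ hr.1).ne'
      have hvt : volume (Metric.closedBall y r) ≠ ⊤ := measure_closedBall_lt_top.ne
      obtain ⟨h1, h2⟩ := h _ hsub
      rw [← hνa] at h1 h2
      constructor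
      · refine ENNReal.div_le_of_le_mul ?_
        rw [mul_assoc]; exact h1
      · rw [← mul_div_assoc]
        rw [ENNReal.le_div_iff_mul_le (Or.inl hv0) (Or.inl hvt)]
        exact h2
    refine tendsto_of_le_liminf_of_limsup_le ?_ ?_
    -- the case `l = ⊤` is apart because multiplication is not continuous at `⊤`
    · set l := liminf (fun r => ν (Metric.closedBall y r) / volume (Metric.closedBall y r))
        (𝓝[>] (0 : ℝ)) with hl
      by_cases hlt : l = ⊤
      · rw [hlt]; exact le_top
      refine ge_of_tendsto (hc l hlt) ?_
      filter_upwards [self_mem_nhdsWithin] with ε hε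
      have hp0 : ((1 + ε : ENNReal) ^ d) ≠ 0 := by positivity
      have hpt : ((1 + ε : ENNReal) ^ d) ≠ ⊤ := ENNReal.pow_ne_top (by simp)
      rw [← ENNReal.div_le_iff' hp0 hpt]
      refine le_liminf_of_le (by isBoundedDefault) ?_
      filter_upwards [hev ε hε] with r hr
      rw [ENNReal.div_le_iff' hp0 hpt]
      exact hr.2
    · refine ge_of_tendsto (hc J hJt) ?_
      filter_upwards [self_mem_nhdsWithin] with ε hε
      refine limsup_le_of_le (by isBoundedDefault) ?_
      filter_upwards [hev ε hε] with r hr using hr.1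
  have hrn : ν.rnDeriv volume =ᵐ[volume] fun y => ENNReal.ofReal (γ' y).toLinearMap.normDet := by
    filter_upwards [Besicovitch.ae_tendsto_rnDeriv ν (volume : Measure F)] with y hy
    exact tendsto_nhds_unique hy (hlim y)
  rw [← hνa, ← Measure.withDensity_rnDeriv_eq ν volume hac, withDensity_apply _ hB]
  exact lintegral_congr_ae (ae_restrict_of_ae hrn)

end Area

/-! ### Graph charts of a smooth domain -/

/-- On the open set `V`, the set `Ω` is the part below the graph of a function over the hyperplane
orthogonal to the unit vector `v`. The graph is encoded by the height `f` above it, in the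
direction `v`, which is a function on the whole space. -/
structure IsGraphChart {E : Type*} [NormedAddCommGroup E] [NormedSpace ℝ E] (Ω : Set E) (v : E)
    (f : E → ℝ) (V : Set E) : Prop where
  norm_eq : ‖v‖ = 1
  contDiff : ContDiff ℝ 4 f
  shift : ∀ x t, f (x + t • v) = f x + t
  isOpen : IsOpen V
  mem_iff : ∀ x ∈ V, x ∈ Ω ↔ f x ≤ 0

/-- The implicit function theorem: a regular sublevel set is, near a boundary point, the region
below a graph in any direction in which the defining function increases. -/
theorem exists_isGraphChart_of_fderiv_pos {E : Type*} [NormedAddCommGroup E]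
    [InnerProductSpace ℝ E] [FiniteDimensional ℝ E] {Ω V₀ : Set E} {f₀ : E → ℝ} {x₀ v : E}
    (hV₀ : IsOpen V₀) (hx₀ : x₀ ∈ V₀) (hf₀ : ContDiffOn ℝ ∞ f₀ V₀) (hΩ : ∀ x ∈ V₀, x ∈ Ω ↔ f₀ x ≤ 0)
    (h0 : f₀ x₀ = 0) (hv : ‖v‖ = 1) (hpos : 0 < fderiv ℝ f₀ x₀ v) :
    ∃ f V, IsGraphChart Ω v f V ∧ x₀ ∈ V := by
  have hf4 : ∀ x ∈ V₀, ContDiffAt ℝ 4 f₀ x := fun x hx =>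
    (hf₀.contDiffAt (hV₀.mem_nhds hx)).of_le ENat.LEInfty.out
  -- the height `τ x` of the boundary above `x`, from the implicit function theorem
  set Φ : E × ℝ → ℝ := fun p => f₀ (p.1 + p.2 • v) with hΦ
  have hΦd : ContDiffAt ℝ 4 Φ (x₀, 0) := by
    refine ContDiffAt.comp (x₀, (0 : ℝ)) (g := f₀) (f := fun p : E × ℝ => p.1 + p.2 • v)
      (by simpa using hf4 x₀ hx₀) ?_
    fun_prop
  have hinv : (fderiv ℝ Φ (x₀, 0) ∘L ContinuousLinearMap.inr ℝ E ℝ).IsInvertible := by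
    have hd : HasFDerivAt Φ ((fderiv ℝ f₀ x₀) ∘L (ContinuousLinearMap.fst ℝ E ℝ +
        (ContinuousLinearMap.snd ℝ E ℝ).smulRight v)) (x₀, 0) := by
      have h1 : HasFDerivAt f₀ (fderiv ℝ f₀ x₀) ((x₀, (0:ℝ)).1 + (x₀, (0:ℝ)).2 • v) := by
        simpa using ((hf4 x₀ hx₀).differentiableAt (by norm_num)).hasFDerivAt
      refine h1.comp (x₀, (0 : ℝ)) ?_
      exact (hasFDerivAt_fst).add (hasFDerivAt_snd.smul_const v)
    rw [hd.fderiv]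
    refine ⟨ContinuousLinearEquiv.unitsEquivAut ℝ (Units.mk0 _ hpos.ne'), ?_⟩
    ext
    simp
  set τ := hΦd.implicitFunction (by norm_num) hinv with hτ
  have hτ0 : τ x₀ = 0 := hΦd.implicitFunction_apply_self _ hinv
  have hτd : ContDiffAt ℝ 4 τ x₀ := hΦd.contDiffAt_implicitFunction _ hinv
  have hτΦ : ∀ᶠ x in 𝓝 x₀, f₀ (x + τ x • v) = 0 := by
    have := hΦd.eventually_apply_implicitFunction (by norm_num) hinv
    filter_upwards [this] with x hx
    simpa [Φ, h0] using hx
  -- a ball on which `f₀` increases in the direction `v`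
  have hfc : ContinuousAt (fun x => fderiv ℝ f₀ x v) x₀ :=
    ((hf4 x₀ hx₀).fderiv_right (m := 3) (by norm_num)).continuousAt.clm_apply continuousAt_const
  obtain ⟨r, hr, hrV⟩ := Metric.mem_nhds_iff.1
    (Filter.inter_mem (hV₀.mem_nhds hx₀) (hfc.eventually (lt_mem_nhds hpos)))
  have hmono : ∀ y, StrictMonoOn (fun t : ℝ => f₀ (y + t • v)) {t | y + t • v ∈ Metric.ball x₀ r} := by
    intro y
    have hder : ∀ t, y + t • v ∈ Metric.ball x₀ r →
        HasDerivAt (fun t : ℝ => f₀ (y + t • v)) (fderiv ℝ f₀ (y + t • v) v) t := by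
      intro t ht
      have h1 := ((hf4 _ (hrV ht).1).differentiableAt (by norm_num)).hasFDerivAt
      have h2 : HasDerivAt (fun t : ℝ => y + t • v) v t := by
        simpa using ((hasDerivAt_id t).smul_const v).const_add y
      exact h1.comp_hasDerivAt t h2
    refine strictMonoOn_of_deriv_pos ?_ (fun t ht => (hder t ht).continuousAt.continuousWithinAt)
      fun t ht => ?_
    · have : {t : ℝ | y + t • v ∈ Metric.ball x₀ r} =
          (AffineMap.lineMap y (y + v) : ℝ →ᵃ[ℝ] E) ⁻¹' Metric.ball x₀ r := by
        ext t; simp [AffineMap.lineMap_apply, add_comm]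
      rw [this]
      exact (convex_ball x₀ r).affine_preimage _
    · have ht' := interior_subset ht
      rw [(hder t ht').deriv]
      exact (hrV ht').2
  -- the cut-off makes the height a global function
  obtain ⟨ρ, hρ, hρd⟩ : ∃ ρ > 0, ∀ x ∈ Metric.ball x₀ ρ, ContDiffAt ℝ 4 τ x := by
    obtain ⟨ρ, hρ, h⟩ := Metric.mem_nhds_iff.1 (hτd.eventually (by simp))
    exact ⟨ρ, hρ, h⟩
  let χ : ContDiffBump x₀ := ⟨ρ / 4, ρ / 2, by positivity, by linarith⟩
  set k : E → ℝ := fun x => χ x * τ x with hk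
  have hkd : ContDiff ℝ 4 k := by
    rw [contDiff_iff_contDiffAt]
    intro x
    by_cases hx : x ∈ Metric.ball x₀ ρ
    · exact (χ.contDiff.contDiffAt).mul (hρd x hx)
    · have : k =ᶠ[𝓝 x] fun _ => 0 := by
        have hx' : x ∉ tsupport χ := by
          rw [χ.tsupport_eq]
          simp only [Metric.mem_ball, not_lt, Metric.mem_closedBall, not_le] at hx ⊢
          show ρ / 2 < _
          linarith
        filter_upwards [(isClosed_tsupport χ).isOpen_compl.mem_nhds hx'] with z hz
        simp [hk, image_eq_zero_of_notMem_tsupport hz]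
      exact contDiffAt_const.congr_of_eventuallyEq this
  -- `P` is the projection along `v` to the hyperplane through `x₀`
  set P : E → E := fun x => x - inner ℝ v (x - x₀) • v with hP
  have hin : ContDiff ℝ 4 fun x : E => inner ℝ v (x - x₀) :=
    contDiff_const.inner ℝ (contDiff_id.sub contDiff_const)
  have hPc : ContDiff ℝ 4 P := contDiff_id.sub (hin.smul contDiff_const)
  have hP0 : P x₀ = x₀ := by simp [hP]
  have hPc' : Tendsto P (𝓝 x₀) (𝓝 x₀) := by
    have := hPc.continuous.tendsto x₀; rwa [hP0] at this
  have hPτ : Tendsto (fun x => P x + τ (P x) • v) (𝓝 x₀) (𝓝 x₀) := by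
    have h1 : Tendsto (fun y => y + τ y • v) (𝓝 x₀) (𝓝 (x₀ + τ x₀ • v)) :=
      tendsto_id.add (hτd.continuousAt.tendsto.smul_const v)
    rw [hτ0, zero_smul, add_zero] at h1
    exact h1.comp hPc'
  have hball : Metric.ball x₀ r ∈ 𝓝 x₀ := Metric.ball_mem_nhds _ hr
  have hev : ∀ᶠ x in 𝓝 x₀, x ∈ Metric.ball x₀ r ∧ P x + τ (P x) • v ∈ Metric.ball x₀ r ∧
      f₀ (P x + τ (P x) • v) = 0 ∧ χ (P x) = 1 := by
    filter_upwards [hball, hPτ.eventually hball, hPc'.eventually hτΦ,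
      hPc'.eventually χ.eventuallyEq_one] with x h1 h2 h3 h4
    exact ⟨h1, h2, h3, h4⟩
  obtain ⟨V, hV, hVo, hxV⟩ := mem_nhds_iff.1 hev
  refine ⟨fun x => inner ℝ v (x - x₀) - k (P x), V, ⟨hv, ?_, ?_, hVo, ?_⟩, hxV⟩
  · exact hin.sub (hkd.comp hPc)
  · intro x t
    have h1 : P (x + t • v) = P x := by
      simp only [hP, add_sub_right_comm, inner_add_right, inner_smul_right,
        real_inner_self_eq_norm_sq, hv]
      module
    have h2 : inner ℝ v (x + t • v - x₀) = inner ℝ v (x - x₀) + t := by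
      rw [add_sub_right_comm, inner_add_right, inner_smul_right, real_inner_self_eq_norm_sq, hv]
      ring
    simp only [h1, h2]
    ring
  · intro x hx
    obtain ⟨h1, h2, h3, h4⟩ := hV hx
    rw [hΩ x (hrV h1).1]
    have hxP : x = P x + inner ℝ v (x - x₀) • v := by simp [hP]
    have := (hmono (P x)).le_iff_le (a := inner ℝ v (x - x₀)) (b := τ (P x))
      (by simpa only [Set.mem_ofPred_eq, ← hxP] using h1) h2
    simp only [← hxP, h3] at this
    rw [this]
    simp [hk, h4]

theorem IsSmoothCompactDomain.exists_isGraphChart {n : ℕ} {Ω : Set (Eu n)}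
    (hΩ : IsSmoothCompactDomain Ω) {x₀ : Eu n} (hx₀ : x₀ ∈ frontier Ω) :
    ∃ v f V, IsGraphChart Ω v f V ∧ x₀ ∈ V := by
  obtain ⟨hK, hloc⟩ := hΩ
  obtain ⟨V, hV, hxV, f, hf, hdf, hΩV⟩ := hloc x₀ hx₀
  have hmem : ∀ x ∈ V, x ∈ Ω ↔ f x ≤ 0 := fun x hx => by
    have : x ∈ Ω ∩ V ↔ x ∈ {y | y ∈ V ∧ f y ≤ 0} := by rw [hΩV]
    simpa [hx] using this
  have hx₀Ω : x₀ ∈ Ω := hK.isClosed.frontier_subset hx₀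
  have h0 : f x₀ = 0 := by
    refine le_antisymm ((hmem _ hxV).1 hx₀Ω) (not_lt.1 fun hlt => ?_)
    refine hx₀.2 (mem_interior_iff_mem_nhds.2 ?_)
    have hc : ContinuousAt f x₀ := hf.continuousOn.continuousAt (hV.mem_nhds hxV)
    filter_upwards [hV.mem_nhds hxV, hc.eventually (gt_mem_nhds hlt)] with y hy hfy
    exact (hmem y hy).2 hfy.le
  obtain ⟨w, hw⟩ : ∃ w, 0 < fderiv ℝ f x₀ w := by
    obtain ⟨w, hw⟩ := DFunLike.ne_iff.1 (hdf x₀ hxV)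
    rcases lt_or_gt_of_ne hw with h | h
    · exact ⟨-w, by simpa using h⟩
    · exact ⟨w, h⟩
  have hw0 : 0 < ‖w‖ := norm_pos_iff.2 (by rintro rfl; simp at hw)
  obtain ⟨g, V', h⟩ := exists_isGraphChart_of_fderiv_pos (v := ‖w‖⁻¹ • w) hV hxV hf hmem h0
    (by rw [norm_smul, norm_inv, norm_norm, inv_mul_cancel₀ hw0.ne'])
    (by rw [map_smul, smul_eq_mul]; positivity)
  exact ⟨_, g, V', h⟩

namespace IsGraphChart

section
variable {E : Type*} [NormedAddCommGroup E] [NormedSpace ℝ E] {Ω : Set E} {v : E}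
    {f : E → ℝ} {V : Set E} (hc : IsGraphChart Ω v f V)
include hc

theorem differentiable : Differentiable ℝ f := hc.contDiff.differentiable (by norm_num)

theorem hasFDerivAt (x : E) : HasFDerivAt f (fderiv ℝ f x) x := (hc.differentiable x).hasFDerivAt

theorem fderiv_self (x : E) : fderiv ℝ f x v = 1 := by
  have h1 : HasDerivAt (fun t : ℝ => f (x + t • v)) (fderiv ℝ f x v) 0 := by
    have h2 : HasDerivAt (fun t : ℝ => x + t • v) v 0 := by
      simpa using ((hasDerivAt_id (0 : ℝ)).smul_const v).const_add x
    have h3 : HasFDerivAt f (fderiv ℝ f x) (x + (0 : ℝ) • v) := by simpa using hc.hasFDerivAt x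
    exact h3.comp_hasDerivAt 0 h2
  have h4 : HasDerivAt (fun t : ℝ => f (x + t • v)) 1 0 := by
    simp only [hc.shift]
    exact (hasDerivAt_id 0).const_add _
  exact h1.unique h4

theorem tendsto_slope (x w : E) :
    Tendsto (fun t : ℝ => t⁻¹ * (f (x + t • w) - f x)) (𝓝[≠] 0) (𝓝 (fderiv ℝ f x w)) := by
  have h2 : HasDerivAt (fun t : ℝ => x + t • w) w 0 := by
    simpa using ((hasDerivAt_id (0 : ℝ)).smul_const w).const_add x
  have h3 : HasFDerivAt f (fderiv ℝ f x) (x + (0 : ℝ) • w) := by simpa using hc.hasFDerivAt x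
  have := (h3.comp_hasDerivAt 0 h2).tendsto_slope_zero
  simpa using this

theorem mem_frontier_iff {x : E} (hx : x ∈ V) : x ∈ frontier Ω ↔ f x = 0 := by
  have hcont : Continuous f := hc.contDiff.continuous
  have hVx := hc.isOpen.mem_nhds hx
  have hlim : Tendsto (fun t : ℝ => x + t • v) (𝓝[≠] 0) (𝓝 x) := by
    have : Continuous (fun t : ℝ => x + t • v) := by fun_prop
    simpa using (this.tendsto 0).mono_left nhdsWithin_le_nhds
  constructor
  · rintro ⟨h1, h2⟩
    rcases lt_trichotomy (f x) 0 with h | h | h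
    · refine absurd (mem_interior_iff_mem_nhds.2 ?_) h2
      filter_upwards [hVx, hcont.continuousAt.eventually (gt_mem_nhds h)] with y hy hfy
      exact (hc.mem_iff y hy).2 hfy.le
    · exact h
    · rw [mem_closure_iff_frequently] at h1
      refine absurd ?_ h1
      filter_upwards [hVx, hcont.continuousAt.eventually (lt_mem_nhds h)] with y hy hfy hyΩ
      exact absurd ((hc.mem_iff y hy).1 hyΩ) (not_le.2 hfy)
  · intro h
    refine ⟨subset_closure ((hc.mem_iff x hx).2 h.le), fun hint => ?_⟩
    have h1 := (hlim.mono_left (nhdsGT_le_nhdsNE 0)).eventually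
      (Filter.inter_mem hVx (mem_interior_iff_mem_nhds.1 hint))
    obtain ⟨t, ⟨h2, h3⟩, ht⟩ := (h1.and self_mem_nhdsWithin).exists
    have := (hc.mem_iff _ h2).1 h3
    rw [hc.shift, h] at this
    have ht' : 0 < t := ht
    linarith

theorem eventually_shift_notMem_of_pos {x w : E} (hx : x ∈ V) (hfx : f x = 0)
    (hw : 0 < fderiv ℝ f x w) : ∀ᶠ t : ℝ in 𝓝[>] 0, x + t • w ∉ Ω := by
  have hlim : Tendsto (fun t : ℝ => x + t • w) (𝓝[>] 0) (𝓝 x) := by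
    have : Continuous (fun t : ℝ => x + t • w) := by fun_prop
    simpa using (this.tendsto 0).mono_left nhdsWithin_le_nhds
  filter_upwards [((hc.tendsto_slope x w).mono_left (nhdsGT_le_nhdsNE 0)).eventually
    (lt_mem_nhds hw), hlim.eventually (hc.isOpen.mem_nhds hx), self_mem_nhdsWithin] with t h1 h2 h3
  rw [hc.mem_iff _ h2, not_le]
  rw [hfx, sub_zero] at h1
  exact (pos_iff_pos_of_mul_pos h1).1 (inv_pos.2 h3)

theorem eventually_shift_mem_of_neg {x w : E} (hx : x ∈ V) (hfx : f x = 0)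
    (hw : fderiv ℝ f x w < 0) : ∀ᶠ t : ℝ in 𝓝[>] 0, x + t • w ∈ Ω := by
  have hlim : Tendsto (fun t : ℝ => x + t • w) (𝓝[>] 0) (𝓝 x) := by
    have : Continuous (fun t : ℝ => x + t • w) := by fun_prop
    simpa using (this.tendsto 0).mono_left nhdsWithin_le_nhds
  filter_upwards [((hc.tendsto_slope x w).mono_left (nhdsGT_le_nhdsNE 0)).eventually
    (gt_mem_nhds hw), hlim.eventually (hc.isOpen.mem_nhds hx), self_mem_nhdsWithin] with t h1 h2 h3
  rw [hc.mem_iff _ h2]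
  rw [hfx, sub_zero] at h1
  by_contra hcon
  exact absurd h1 (not_lt.2 (mul_nonneg (inv_pos.2 h3).le (not_le.1 hcon).le))

/-- The point `x - f x • v` lies on the graph. -/
theorem apply_proj (x : E) : f (x - f x • v) = 0 := by
  have := hc.shift x (-(f x))
  rw [neg_smul, ← sub_eq_add_neg] at this
  rw [this]; ring

theorem tangentCone_frontier {x : E} (hx : x ∈ V) (hfx : f x = 0) :
    tangentConeAt ℝ (frontier Ω) x = {w | fderiv ℝ f x w = 0} := by
  have hVx := hc.isOpen.mem_nhds hx
  ext w
  constructor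
  · intro hw
    have h1 : HasFDerivWithinAt f (fderiv ℝ f x) (frontier Ω) x :=
      (hc.hasFDerivAt x).hasFDerivWithinAt
    have h2 : HasFDerivWithinAt f (0 : E →L[ℝ] ℝ) (frontier Ω) x := by
      refine (hasFDerivWithinAt_const (0 : ℝ) x (frontier Ω)).congr_of_eventuallyEq ?_ hfx
      filter_upwards [mem_nhdsWithin_of_mem_nhds hVx, self_mem_nhdsWithin] with y hy hyf
      exact (hc.mem_frontier_iff hy).1 hyf
    exact h1.unique_on h2 hw
  · intro hw
    simp only [Set.mem_ofPred_eq] at hw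
    -- the curve `t ↦ x + t • w` pushed back to the boundary along `v`
    set c : ℝ → E := fun t => t • w - f (x + t • w) • v with hcdef
    have hcc : Continuous c := by
      have := hc.contDiff.continuous
      rw [hcdef]; fun_prop
    have hc0 : c 0 = 0 := by simp [hcdef, hfx]
    have hlim : Tendsto c (𝓝[≠] 0) (𝓝 0) := by
      have := (hcc.tendsto 0).mono_left (nhdsWithin_le_nhds (s := {0}ᶜ)); rwa [hc0] at this
    refine mem_tangentConeAt_of_seq (𝓝[≠] (0 : ℝ)) (fun t => t⁻¹) c hlim ?_ ?_
    · have h1 : Tendsto (fun t => x + c t) (𝓝[≠] 0) (𝓝 x) := by simpa using hlim.const_add x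
      filter_upwards [h1.eventually hVx] with t ht
      rw [hc.mem_frontier_iff ht]
      have := hc.apply_proj (x + t • w)
      simp only [hcdef]
      rwa [← add_sub_assoc]
    · have h1 := hc.tendsto_slope x w
      rw [hw] at h1
      have h2 : Tendsto (fun t : ℝ => w - (t⁻¹ * (f (x + t • w) - f x)) • v) (𝓝[≠] 0)
          (𝓝 (w - (0 : ℝ) • v)) := tendsto_const_nhds.sub (h1.smul_const v)
      rw [zero_smul, sub_zero] at h2
      refine h2.congr' ?_
      filter_upwards [self_mem_nhdsWithin] with t ht
      simp only [hcdef, hfx, sub_zero, smul_sub, smul_smul,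
        inv_mul_cancel₀ (Set.mem_compl_singleton_iff.1 ht), one_smul]

theorem uniqueDiffWithinAt {x : E} (hx : x ∈ V) (hfx : f x = 0) : UniqueDiffWithinAt ℝ Ω x := by
  refine ⟨?_, subset_closure ((hc.mem_iff x hx).2 hfx.le)⟩
  have hneg : ∀ w, fderiv ℝ f x w < 0 → w ∈ tangentConeAt ℝ Ω x := fun w hw => by
    refine mem_tangentConeAt_of_add_smul_mem (l := 𝓝[>] (0 : ℝ)) (c := id) ?_
      (hc.eventually_shift_mem_of_neg hx hfx hw)
    exact tendsto_id.mono_left (nhdsGT_le_nhdsNE 0)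
  -- the open half-space of inward directions spans the whole space
  have htop : Submodule.span ℝ (tangentConeAt ℝ Ω x) = ⊤ := by
    rw [eq_top_iff]
    rintro u -
    have h1 := Submodule.subset_span (R := ℝ) (hneg (u - (fderiv ℝ f x u + 1) • v) (by
      rw [map_sub, map_smul, hc.fderiv_self]; simp))
    have h2 := Submodule.subset_span (R := ℝ) (hneg (-v) (by rw [map_neg, hc.fderiv_self]; simp))
    have h3 := Submodule.sub_mem _ h1 (Submodule.smul_mem _ (fderiv ℝ f x u + 1) h2)
    simpa using h3
  rw [htop]
  exact dense_univ

end

theorem tangentSpace_eq {n : ℕ} {Ω : Set (Eu n)} {v : Eu n} {f : Eu n → ℝ} {V : Set (Eu n)}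
    (hc : IsGraphChart Ω v f V) {x : Eu n} (hx : x ∈ V) (hfx : f x = 0) :
    tangentSpace (frontier Ω) x = LinearMap.ker (fderiv ℝ f x).toLinearMap := by
  rw [tangentSpace, hc.tangentCone_frontier hx hfx]
  exact Submodule.span_eq (LinearMap.ker (fderiv ℝ f x).toLinearMap)

end IsGraphChart

theorem IsSmoothCompactDomain.uniqueDiffOn {n : ℕ} {Ω : Set (Eu n)}
    (hΩ : IsSmoothCompactDomain Ω) : UniqueDiffOn ℝ Ω := by
  intro x hx
  by_cases hxi : x ∈ interior Ω
  · exact uniqueDiffWithinAt_of_mem_nhds (mem_interior_iff_mem_nhds.1 hxi)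
  · have hxf : x ∈ frontier Ω := ⟨subset_closure hx, hxi⟩
    obtain ⟨v, f, V, hc, hxV⟩ := hΩ.exists_isGraphChart hxf
    exact hc.uniqueDiffWithinAt hxV ((hc.mem_frontier_iff hxV).1 hxf)

/-! ### Surface measure and flow coordinates in a graph chart -/

namespace IsGraphChart

variable {E : Type*} [NormedAddCommGroup E] [InnerProductSpace ℝ E] [FiniteDimensional ℝ E]
  [MeasurableSpace E] [BorelSpace E] {Ω : Set E} {v : E} {f : E → ℝ} {V : Set E}

/-- The parametrization of the graph by the hyperplane orthogonal to `v`. -/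
def graphMap (f : E → ℝ) (v : E) (y : (ℝ ∙ v)ᗮ) : E := (y : E) - f y • v

/-- The derivative of the parametrization of the graph. -/
def graphDeriv (f : E → ℝ) (v : E) (y : (ℝ ∙ v)ᗮ) : (ℝ ∙ v)ᗮ →L[ℝ] E :=
  (ContinuousLinearMap.id ℝ E - (fderiv ℝ f y).smulRight v) ∘L (ℝ ∙ v)ᗮ.subtypeL

@[simp]
theorem graphDeriv_apply (f : E → ℝ) (v : E) (y w : (ℝ ∙ v)ᗮ) :
    graphDeriv f v y w = (w : E) - fderiv ℝ f y w • v := rfl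

theorem inner_coe_orthogonal (y : (ℝ ∙ v)ᗮ) : inner ℝ v (y : E) = 0 :=
  Submodule.mem_orthogonal_singleton_iff_inner_right.1 y.2

theorem coe_orthogonalProjectionOnto_orthogonal (hv : ‖v‖ = 1) (x : E) :
    (((ℝ ∙ v)ᗮ).orthogonalProjectionOnto x : E) = x - inner ℝ v x • v := by
  rw [Submodule.coe_orthogonalProjectionOnto_apply, Submodule.starProjection_orthogonal_val,
    Submodule.starProjection_unit_singleton ℝ hv]

/-- The derivative of the height is constant along `v`. -/
theorem fderiv_shift (hc : IsGraphChart Ω v f V) (x : E) (t : ℝ) :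
    fderiv ℝ f (x + t • v) = fderiv ℝ f x := by
  have h1 : (fun z => f (z + t • v)) = fun z => f z + t := funext fun z => hc.shift z t
  have h2 := congrArg (fun g => fderiv ℝ g x) h1
  simpa [fderiv_comp_add_right, fderiv_add_const] using h2

theorem fderiv_graphMap (hc : IsGraphChart Ω v f V) (y : (ℝ ∙ v)ᗮ) :
    fderiv ℝ f (graphMap f v y) = fderiv ℝ f y := by
  rw [graphMap, sub_eq_add_neg, ← neg_smul, hc.fderiv_shift]

theorem apply_graphMap (hc : IsGraphChart Ω v f V) (y : (ℝ ∙ v)ᗮ) : f (graphMap f v y) = 0 :=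
  hc.apply_proj _

theorem continuous_graphMap (hc : IsGraphChart Ω v f V) : Continuous (graphMap f v) := by
  have := hc.contDiff.continuous
  unfold graphMap; fun_prop

theorem hasStrictFDerivAt_graphMap (hc : IsGraphChart Ω v f V) (y : (ℝ ∙ v)ᗮ) :
    HasStrictFDerivAt (graphMap f v) (graphDeriv f v y) y := by
  have h1 : HasStrictFDerivAt f (fderiv ℝ f y) (y : E) :=
    hc.contDiff.contDiffAt.hasStrictFDerivAt (by norm_num)
  have h2 : HasStrictFDerivAt (fun x : E => x - f x • v)
      (ContinuousLinearMap.id ℝ E - (fderiv ℝ f y).smulRight v) (y : E) :=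
    (hasStrictFDerivAt_id (y : E)).sub (h1.smul_const v)
  exact h2.comp y (((ℝ ∙ v)ᗮ).subtypeL.hasStrictFDerivAt)

/-- The coordinates `(y, t) ↦ γ y + t v`, where `γ` parametrizes the graph; in them the height `f`
is the coordinate `t`. -/
def flowHomeomorph (hc : IsGraphChart Ω v f V) : (ℝ ∙ v)ᗮ × ℝ ≃ₜ E where
  toFun p := graphMap f v p.1 + p.2 • v
  invFun x := ((ℝ ∙ v)ᗮ.orthogonalProjectionOnto x, f x)
  left_inv p := by
    have h1 : ((ℝ ∙ v)ᗮ).orthogonalProjectionOnto v = 0 :=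
      Submodule.orthogonalProjectionOnto_orthogonalComplement_singleton_eq_zero v
    refine Prod.ext ?_ ?_
    · simp [graphMap, h1]
    · simp [hc.shift, hc.apply_graphMap]
  right_inv x := by
    have h1 := coe_orthogonalProjectionOnto_orthogonal hc.norm_eq x
    have h3 : f (x - inner ℝ v x • v) = f x - inner ℝ v x := by
      rw [sub_eq_add_neg x, ← neg_smul, hc.shift]; ring
    simp only [graphMap, h1, h3]
    module
  continuous_toFun := by
    have := hc.continuous_graphMap
    fun_prop
  continuous_invFun := by
    have := hc.contDiff.continuous
    fun_prop

theorem flowHomeomorph_apply (hc : IsGraphChart Ω v f V) (p : (ℝ ∙ v)ᗮ × ℝ) :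
    hc.flowHomeomorph p = graphMap f v p.1 + p.2 • v := rfl

theorem apply_flowHomeomorph (hc : IsGraphChart Ω v f V) (p : (ℝ ∙ v)ᗮ × ℝ) :
    f (hc.flowHomeomorph p) = p.2 := by
  rw [flowHomeomorph_apply, hc.shift, hc.apply_graphMap, zero_add]

/-- The linear coordinates `(y, t) ↦ y + t v` are isometric. -/
def linearCoord (hv : ‖v‖ = 1) : WithLp 2 ((ℝ ∙ v)ᗮ × ℝ) ≃ₗᵢ[ℝ] E where
  toFun p := (p.fst : E) + p.snd • v
  map_add' p q := by simp only [WithLp.add_fst, WithLp.add_snd, Submodule.coe_add]; module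
  map_smul' c p := by
    simp only [WithLp.smul_fst, WithLp.smul_snd, Submodule.coe_smul, RingHom.id_apply, smul_eq_mul]
    module
  invFun x := WithLp.toLp 2 ((ℝ ∙ v)ᗮ.orthogonalProjectionOnto x, inner ℝ v x)
  left_inv p := by
    have h1 : ((ℝ ∙ v)ᗮ).orthogonalProjectionOnto v = 0 :=
      Submodule.orthogonalProjectionOnto_orthogonalComplement_singleton_eq_zero v
    refine (WithLp.ofLp_injective 2) (Prod.ext ?_ ?_)
    · simp [h1]
    · simp [inner_add_right, inner_smul_right, inner_coe_orthogonal, hv]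
  right_inv x := by
    show (((ℝ ∙ v)ᗮ).orthogonalProjectionOnto x : E) + inner ℝ v x • v = x
    rw [coe_orthogonalProjectionOnto_orthogonal hv, sub_add_cancel]
  norm_map' p := by
    rw [← sq_eq_sq₀ (norm_nonneg _) (norm_nonneg _), WithLp.prod_norm_sq_eq_of_L2]
    show ‖(p.fst : E) + p.snd • v‖ ^ 2 = _
    rw [norm_add_sq_real, inner_smul_right, real_inner_comm, inner_coe_orthogonal, norm_smul, hv]
    simp

/-- The flow coordinates are a shear of isometric linear coordinates, hence preserve the volume. -/
theorem measurePreserving_flowHomeomorph (hc : IsGraphChart Ω v f V) :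
    MeasurePreserving hc.flowHomeomorph := by
  have h1 : MeasurePreserving (fun p : (ℝ ∙ v)ᗮ × ℝ => (p.1 : E) + p.2 • v) :=
    (linearCoord hc.norm_eq).measurePreserving.comp (WithLp.volume_preserving_toLp _ _)
  have hcont := hc.contDiff.continuous
  have h2 : MeasurePreserving (fun p : (ℝ ∙ v)ᗮ × ℝ => (p.1, p.2 + -f p.1)) := by
    refine (MeasurePreserving.id volume).skew_product (g := fun (y : (ℝ ∙ v)ᗮ) t => t + -f y) ?_ ?_
    · have : Continuous (fun p : (ℝ ∙ v)ᗮ × ℝ => p.2 + -f p.1) := by fun_prop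
      exact this.measurable
    · exact Filter.Eventually.of_forall fun y => (measurePreserving_add_right volume _).map_eq
  convert h1.comp h2 using 1
  funext p
  simp only [flowHomeomorph_apply, graphMap, Function.comp_apply]
  module

theorem norm_fderiv_sq (hc : IsGraphChart Ω v f V) {ι : Type*} [Fintype ι]
    (w : OrthonormalBasis ι ℝ (ℝ ∙ v)ᗮ) (x : E) :
    ‖fderiv ℝ f x‖ ^ 2 = 1 + ∑ i, (fderiv ℝ f x (w i)) ^ 2 := by
  set g := (InnerProductSpace.toDual ℝ E).symm (fderiv ℝ f x) with hg
  have hgi : ∀ u, inner ℝ g u = fderiv ℝ f x u := fun u => by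
    rw [hg, InnerProductSpace.toDual_symm_apply]
  have hn : ‖fderiv ℝ f x‖ = ‖g‖ := by rw [hg, LinearIsometryEquiv.norm_map]
  set p := (linearCoord hc.norm_eq).symm g with hp
  have hgp : (p.fst : E) + p.snd • v = g := (linearCoord hc.norm_eq).apply_symm_apply g
  have hvv : inner ℝ v v = 1 := by rw [real_inner_self_eq_norm_sq, hc.norm_eq]; norm_num
  have h2 : p.snd = 1 := by
    have h3 := hc.fderiv_self x
    rw [← hgi, ← hgp, inner_add_left, inner_smul_left, real_inner_comm, inner_coe_orthogonal,
      hvv] at h3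
    simpa using h3
  have h1 : ∀ i, inner ℝ p.fst (w i) = fderiv ℝ f x (w i) := fun i => by
    rw [← hgi, ← hgp, inner_add_left, inner_smul_left, inner_coe_orthogonal, Submodule.coe_inner]
    simp
  rw [hn, ← (linearCoord hc.norm_eq).symm.norm_map g, ← hp, WithLp.prod_norm_sq_eq_of_L2, h2,
    ← w.sum_sq_norm_inner_left, add_comm]
  simp [h1]

theorem norm_fderiv_pos (hc : IsGraphChart Ω v f V) (x : E) : 0 < ‖fderiv ℝ f x‖ :=
  norm_pos_iff.2 fun h => by simpa [h] using hc.fderiv_self x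

/-- The Jacobian of the parametrization of the graph is the length of the gradient of the height. -/
theorem normDet_graphDeriv (hc : IsGraphChart Ω v f V) (y : (ℝ ∙ v)ᗮ) :
    (graphDeriv f v y).toLinearMap.normDet = ‖fderiv ℝ f (y : E)‖ := by
  classical
  rw [← sq_eq_sq₀ (LinearMap.normDet_nonneg _) (norm_nonneg _)]
  set w := stdOrthonormalBasis ℝ (ℝ ∙ v)ᗮ
  have h := LinearMap.normDet_sq_eq_det_gram (𝕜 := ℝ) (graphDeriv f v y).toLinearMap w
  rw [hc.norm_fderiv_sq w]
  have hvv : inner ℝ v v = 1 := by rw [real_inner_self_eq_norm_sq, hc.norm_eq]; norm_num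
  -- the Gram matrix is a rank-one perturbation of the identity
  have hM : Matrix.gram ℝ (fun i => (graphDeriv f v y).toLinearMap (w i)) =
      1 + Matrix.replicateCol Unit (fun i => fderiv ℝ f (y : E) (w i)) *
        Matrix.replicateRow Unit (fun i => fderiv ℝ f (y : E) (w i)) := by
    ext i j
    have hij : inner ℝ (w i : E) (w j : E) = if i = j then 1 else 0 := by
      rw [← Submodule.coe_inner]; exact orthonormal_iff_ite.1 w.orthonormal i j
    have h0 : ∀ z : (ℝ ∙ v)ᗮ, inner ℝ (z : E) v = 0 := fun z => by
      rw [real_inner_comm, inner_coe_orthogonal]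
    simp only [Matrix.gram_apply, ContinuousLinearMap.coe_coe, graphDeriv_apply, inner_sub_left,
      inner_sub_right, inner_smul_left, inner_smul_right, hij, inner_coe_orthogonal, h0, hvv,
      Matrix.add_apply, Matrix.one_apply, Matrix.mul_apply, Matrix.replicateCol_apply,
      Matrix.replicateRow_apply]
    simp [mul_comm]
  rw [hM, Matrix.det_one_add_replicateCol_mul_replicateRow] at h
  have h' : (graphDeriv f v y).toLinearMap.normDet ^ 2 = _ := h
  rw [h']
  simp [dotProduct, pow_two]

theorem norm_le_graphDeriv (y w : (ℝ ∙ v)ᗮ) : ‖w‖ ≤ ‖graphDeriv f v y w‖ := by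
  rw [← sq_le_sq₀ (norm_nonneg _) (norm_nonneg _), graphDeriv_apply, norm_sub_sq_real,
    inner_smul_right, real_inner_comm, inner_coe_orthogonal]
  simp

theorem range_graphMap (hc : IsGraphChart Ω v f V) : Set.range (graphMap f v) = {x | f x = 0} := by
  ext x
  constructor
  · rintro ⟨y, rfl⟩
    exact hc.apply_graphMap y
  · intro hx
    have h1 := hc.flowHomeomorph.apply_symm_apply x
    have h2 := hc.apply_flowHomeomorph (hc.flowHomeomorph.symm x)
    rw [h1] at h2
    rw [flowHomeomorph_apply, ← h2, show f x = 0 from hx, zero_smul, add_zero] at h1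
    exact ⟨_, h1⟩

theorem isClosedEmbedding_graphMap (hc : IsGraphChart Ω v f V) :
    Topology.IsClosedEmbedding (graphMap f v) := by
  have h1 : graphMap f v = fun y => hc.flowHomeomorph (y, 0) := by
    funext y; simp [flowHomeomorph_apply]
  rw [h1]
  refine hc.flowHomeomorph.isClosedEmbedding.comp ?_
  refine ⟨isEmbedding_prodMkLeft 0, ?_⟩
  have : Set.range (fun y : (ℝ ∙ v)ᗮ => (y, (0 : ℝ))) = Prod.snd ⁻¹' {0} := by
    ext ⟨a, b⟩; simp [eq_comm]
  rw [this]
  exact isClosed_singleton.preimage continuous_snd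

theorem measurableEmbedding_graphMap (hc : IsGraphChart Ω v f V) :
    MeasurableEmbedding (graphMap f v) := hc.isClosedEmbedding_graphMap.measurableEmbedding

theorem finrank_orthogonal (hc : IsGraphChart Ω v f V) {d : ℕ} (hd : Module.finrank ℝ E = d + 1) :
    Module.finrank ℝ (ℝ ∙ v)ᗮ = d := by
  have : Fact (Module.finrank ℝ E = d + 1) := ⟨hd⟩
  exact Submodule.finrank_orthogonal_span_singleton (by
    rintro rfl; simpa using hc.norm_eq)

/-- The surface measure of the graph in the parametrization by the hyperplane. -/
theorem restrict_euclideanHausdorffMeasure (hc : IsGraphChart Ω v f V) {d : ℕ}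
    (hd : Module.finrank ℝ E = d + 1) :
    (μHE[d] : Measure E).restrict {x | f x = 0} =
      ((volume : Measure (ℝ ∙ v)ᗮ).withDensity
        fun y => ((‖fderiv ℝ f (y : E)‖₊ : NNReal) : ENNReal)).map (graphMap f v) := by
  have hE := hc.measurableEmbedding_graphMap
  have hF := hc.finrank_orthogonal hd
  refine Measure.ext fun B hB => ?_
  rw [Measure.restrict_apply hB, hE.map_apply, withDensity_apply _ (hE.measurable hB)]
  have h := euclideanHausdorffMeasure_image_eq_lintegral hE (γ' := graphDeriv f v)
    norm_le_graphDeriv hc.hasStrictFDerivAt_graphMap (hE.measurable hB)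
  rw [hF, Set.image_preimage_eq_inter_range, hc.range_graphMap] at h
  rw [h]
  refine lintegral_congr fun y => ?_
  rw [hc.normDet_graphDeriv, ofReal_norm]
  rfl

theorem measure_inter_lt_top (hc : IsGraphChart Ω v f V) {d : ℕ}
    (hd : Module.finrank ℝ E = d + 1) {K : Set E} (hK : IsCompact K) :
    (μHE[d] : Measure E) (K ∩ {x | f x = 0}) < ⊤ := by
  have hE := hc.measurableEmbedding_graphMap
  rw [← Measure.restrict_apply hK.measurableSet, hc.restrict_euclideanHausdorffMeasure hd,
    hE.map_apply, withDensity_apply _ (hE.measurable hK.measurableSet)]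
  have hK' : IsCompact (graphMap f v ⁻¹' K) := hc.isClosedEmbedding_graphMap.isCompact_preimage hK
  have hcont : Continuous fun y : (ℝ ∙ v)ᗮ => ‖fderiv ℝ f (y : E)‖₊ := by
    have := hc.contDiff.continuous_fderiv (by norm_num)
    fun_prop
  obtain ⟨C, hC⟩ := (hK'.image hcont).bddAbove
  calc _ ≤ ∫⁻ _ in graphMap f v ⁻¹' K, (C : ENNReal) := by
        refine setLIntegral_mono' (hE.measurable hK.measurableSet) fun y hy => ?_
        exact_mod_cast hC (Set.mem_image_of_mem _ hy)
    _ < ⊤ := by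
        rw [setLIntegral_const]
        exact ENNReal.mul_lt_top (by simp) hK'.measure_lt_top

theorem setIntegral_graph (hc : IsGraphChart Ω v f V) {d : ℕ}
    (hd : Module.finrank ℝ E = d + 1) (g : E → ℝ) :
    ∫ x in {x | f x = 0}, g x ∂(μHE[d] : Measure E) =
      ∫ y : (ℝ ∙ v)ᗮ, ‖fderiv ℝ f (y : E)‖ * g (graphMap f v y) := by
  have hcont : Continuous fun y : (ℝ ∙ v)ᗮ => ‖fderiv ℝ f (y : E)‖₊ := by
    have := hc.contDiff.continuous_fderiv (by norm_num)
    fun_prop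
  rw [hc.restrict_euclideanHausdorffMeasure hd, hc.measurableEmbedding_graphMap.integral_map,
    integral_withDensity_eq_integral_smul hcont.measurable]
  rfl

end IsGraphChart

/-! ### The divergence theorem -/

/-- The Euclidean divergence of a vector field. -/
def divergence {E : Type*} [NormedAddCommGroup E] [NormedSpace ℝ E] (X : E → E) (x : E) : ℝ :=
  LinearMap.trace ℝ E (fderiv ℝ X x).toLinearMap

theorem integral_fderiv_apply_eq_zero {F : Type*} [NormedAddCommGroup F] [InnerProductSpace ℝ F]
    [FiniteDimensional ℝ F] [MeasurableSpace F] [BorelSpace F] {g : F → ℝ} (hg : ContDiff ℝ 1 g)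
    (hgc : HasCompactSupport g) (w : F) : ∫ y, fderiv ℝ g y w = 0 := by
  have hgi : Integrable g := hg.continuous.integrable_of_hasCompactSupport hgc
  have hg' : Integrable fun y => fderiv ℝ g y w := by
    refine Continuous.integrable_of_hasCompactSupport ?_ (hgc.fderiv_apply (𝕜 := ℝ) w)
    exact (hg.continuous_fderiv (by norm_num)).clm_apply continuous_const
  have h := integral_bilinear_hasLineDerivAt_right_eq_neg_left_of_integrable
    (μ := (volume : Measure F)) (f := fun _ : F => (1 : ℝ)) (f' := fun _ => 0) (g := g)
    (g' := fun y => fderiv ℝ g y w) (v := w) (B := ContinuousLinearMap.mul ℝ ℝ)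
    (by simp) (by simpa using hg') (by simpa using hgi)
    (fun x _ => by
      simpa using (hasFDerivAt_const (1 : ℝ) x).hasLineDerivAt w)
    (fun x _ => (hg.differentiable (by norm_num) x).hasFDerivAt.hasLineDerivAt w)
  simpa using h

namespace IsGraphChart

variable {E : Type*} [NormedAddCommGroup E] [InnerProductSpace ℝ E] [FiniteDimensional ℝ E]
  [MeasurableSpace E] [BorelSpace E] {Ω : Set E} {v : E} {f : E → ℝ} {V : Set E}

theorem sum_inner_smul_add (hv : ‖v‖ = 1) {ι : Type*} [Fintype ι]
    (w : OrthonormalBasis ι ℝ (ℝ ∙ v)ᗮ) (u : E) :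
    ∑ i, inner ℝ (w i : E) u • (w i : E) + inner ℝ v u • v = u := by
  have h1 := w.sum_repr' ((ℝ ∙ v)ᗮ.orthogonalProjectionOnto u)
  have h2 := congrArg (fun z : (ℝ ∙ v)ᗮ => (z : E)) h1
  simp only [Submodule.coe_sum, Submodule.coe_smul, coe_orthogonalProjectionOnto_orthogonal hv,
    Submodule.coe_inner] at h2
  have h3 : ∀ i, inner ℝ (w i : E) (u - inner ℝ v u • v) = inner ℝ (w i : E) u := fun i => by
    rw [inner_sub_right, inner_smul_right, real_inner_comm v, inner_coe_orthogonal]; simp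
  simp only [h3] at h2
  rw [h2]; abel

theorem trace_eq (hv : ‖v‖ = 1) {ι : Type*} [Fintype ι] [DecidableEq ι]
    (w : OrthonormalBasis ι ℝ (ℝ ∙ v)ᗮ) (T : E →L[ℝ] E) :
    LinearMap.trace ℝ E T.toLinearMap = ∑ i, inner ℝ (w i : E) (T (w i)) + inner ℝ v (T v) := by
  let B := (w.prod (OrthonormalBasis.singleton Unit ℝ)).map (linearCoord hv)
  rw [LinearMap.trace_eq_sum_inner _ B, Fintype.sum_sum_type]
  have h1 : ∀ i, B (Sum.inl i) = (w i : E) := fun i => by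
    show ((_ : (ℝ ∙ v)ᗮ) : E) + _ • v = _
    simp [OrthonormalBasis.prod]
  have h2 : ∀ i, B (Sum.inr i) = v := fun i => by
    show ((_ : (ℝ ∙ v)ᗮ) : E) + _ • v = _
    simp [OrthonormalBasis.prod]
  simp [h1, h2]

/-- The `v`-component of the divergence in flow coordinates is a derivative in `t`, the other
components are derivatives along the hyperplane. -/
theorem trace_eq_flow (hc : IsGraphChart Ω v f V) {ι : Type*} [Fintype ι] [DecidableEq ι]
    (w : OrthonormalBasis ι ℝ (ℝ ∙ v)ᗮ) (T : E →L[ℝ] E) (y : (ℝ ∙ v)ᗮ) :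
    LinearMap.trace ℝ E T.toLinearMap =
      ∑ i, inner ℝ (w i : E) (T (graphDeriv f v y (w i))) + fderiv ℝ f y (T v) := by
  rw [trace_eq hc.norm_eq w]
  conv_rhs => rw [← sum_inner_smul_add hc.norm_eq w (T v)]
  simp only [map_add, map_sum, map_smul, hc.fderiv_self, graphDeriv_apply, map_sub, inner_sub_right,
    inner_smul_right, Finset.sum_sub_distrib, smul_eq_mul, mul_one]
  have : ∑ i, (fderiv ℝ f (y : E)) (w i) * inner ℝ (w i : E) (T v) =
      ∑ i, inner ℝ (w i : E) (T v) * (fderiv ℝ f (y : E)) (w i) :=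
    Finset.sum_congr rfl fun i _ => mul_comm _ _
  rw [this]; ring

section Local

variable {X : E → E} (hc : IsGraphChart Ω v f V) (hX : ContDiffOn ℝ 1 X Ω)
  (hXV : tsupport X ⊆ V)
include hc hX hXV

/-- Strictly below the graph the field is differentiable in the ambient sense: inside the chart such
points are interior to `Ω`, and outside the support it vanishes. -/
theorem contDiffAt_of_neg {x : E} (hx : f x < 0) : ContDiffAt ℝ 1 X x := by
  by_cases hxs : x ∈ tsupport X
  · refine hX.contDiffAt ?_
    have hcont := hc.contDiff.continuous
    filter_upwards [hc.isOpen.mem_nhds (hXV hxs), hcont.continuousAt.eventually (gt_mem_nhds hx)]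
      with z hz hfz
    exact (hc.mem_iff z hz).2 hfz.le
  · have : X =ᶠ[𝓝 x] fun _ => 0 := by
      filter_upwards [(isClosed_tsupport X).isOpen_compl.mem_nhds hxs] with z hz
      exact image_eq_zero_of_notMem_tsupport hz
    exact contDiffAt_const.congr_of_eventuallyEq this

theorem fderiv_bound (hU : UniqueDiffOn ℝ Ω) (hΩ : IsClosed Ω) (hXc : HasCompactSupport X) :
    ∃ C, ∀ x, f x < 0 → ‖fderiv ℝ X x‖ ≤ C := by
  have h1 : ContinuousOn (fderivWithin ℝ X Ω) Ω := hX.continuousOn_fderivWithin hU le_rfl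
  have hK : IsCompact (tsupport X ∩ Ω) := IsCompact.inter_right hXc hΩ
  obtain ⟨C, hC⟩ := hK.exists_bound_of_continuousOn (h1.mono Set.inter_subset_right)
  refine ⟨max C 0, fun x hx => ?_⟩
  by_cases hxs : x ∈ tsupport X
  · have hxΩ : Ω ∈ 𝓝 x := by
      have hcont := hc.contDiff.continuous
      filter_upwards [hc.isOpen.mem_nhds (hXV hxs), hcont.continuousAt.eventually (gt_mem_nhds hx)]
        with z hz hfz
      exact (hc.mem_iff z hz).2 hfz.le
    rw [← fderivWithin_of_mem_nhds hxΩ]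
    exact (hC x ⟨hxs, mem_of_mem_nhds hxΩ⟩).trans (le_max_left _ _)
  · have := fderiv_of_notMem_tsupport (𝕜 := ℝ) hxs
    rw [this, norm_zero]
    exact le_max_right _ _

/-- Integrability, in flow coordinates, of a function dominated by the derivative of the field: it
is bounded with bounded support, but perhaps not continuous up to `{t = 0}`. -/
theorem integrableOn_flow (hU : UniqueDiffOn ℝ Ω) (hΩ : IsClosed Ω) (hXc : HasCompactSupport X)
    {h g : (ℝ ∙ v)ᗮ × ℝ → ℝ} (hh : ContinuousOn h {p | p.2 < 0}) (hg : Continuous g)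
    (hhg : ∀ p, p.2 < 0 → |h p| ≤ g p * ‖fderiv ℝ X (hc.flowHomeomorph p)‖) :
    IntegrableOn h {p | p.2 < 0} := by
  obtain ⟨C, hC⟩ := hc.fderiv_bound hX hXV hU hΩ hXc
  set K := hc.flowHomeomorph ⁻¹' tsupport X
  have hK : IsCompact K := hc.flowHomeomorph.isClosedEmbedding.isCompact_preimage hXc
  obtain ⟨D, hD⟩ := hK.exists_bound_of_continuousOn hg.continuousOn
  have hopen : IsOpen {p : (ℝ ∙ v)ᗮ × ℝ | p.2 < 0} := isOpen_lt continuous_snd continuous_const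
  have hzero : ∀ p ∈ {p : (ℝ ∙ v)ᗮ × ℝ | p.2 < 0} \ ({p : (ℝ ∙ v)ᗮ × ℝ | p.2 < 0} ∩ K), h p = 0 := by
    rintro p ⟨hp, hpK⟩
    have hp' : hc.flowHomeomorph p ∉ tsupport X := fun h => hpK ⟨hp, h⟩
    have h2 := hhg p hp
    rw [fderiv_of_notMem_tsupport (𝕜 := ℝ) hp', norm_zero, mul_zero] at h2
    exact abs_nonpos_iff.1 h2
  refine IntegrableOn.of_forall_sdiff_eq_zero (s := {p : (ℝ ∙ v)ᗮ × ℝ | p.2 < 0} ∩ K) ?_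
    hopen.measurableSet hzero
  refine Integrable.mono' (g := fun _ => D * max C 0) (integrableOn_const
    ((measure_mono Set.inter_subset_right).trans_lt hK.measure_lt_top).ne) ?_ ?_
  · exact (hh.aestronglyMeasurable hopen.measurableSet).mono_measure
      (Measure.restrict_mono Set.inter_subset_left le_rfl)
  · refine (ae_restrict_iff' (hopen.measurableSet.inter hK.measurableSet)).2
      (Eventually.of_forall fun p hp => ?_)
    rw [Real.norm_eq_abs]
    refine (hhg p hp.1).trans ?_
    have h3 := hC (hc.flowHomeomorph p) (by rw [hc.apply_flowHomeomorph]; exact hp.1)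
    have h4 := hD p hp.2
    rw [Real.norm_eq_abs] at h4
    have h5 : 0 ≤ D := (abs_nonneg _).trans h4
    calc g p * ‖fderiv ℝ X (hc.flowHomeomorph p)‖ ≤ D * ‖fderiv ℝ X (hc.flowHomeomorph p)‖ :=
          mul_le_mul_of_nonneg_right ((le_abs_self _).trans h4) (norm_nonneg _)
      _ ≤ D * max C 0 := mul_le_mul_of_nonneg_left (h3.trans (le_max_left _ _)) h5

/-- The divergence theorem for a field supported in a graph chart. In flow coordinates the
components along the hyperplane integrate to zero on each slice `{t = const}`, and the remaining one
by the fundamental theorem of calculus in `t`. -/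
theorem integral_divergence (hU : UniqueDiffOn ℝ Ω) (hΩ : IsClosed Ω) (hXc : HasCompactSupport X)
    {d : ℕ} (hd : Module.finrank ℝ E = d + 1) :
    ∫ x in Ω, divergence X x =
      ∫ x in frontier Ω, fderiv ℝ f x (X x) / ‖fderiv ℝ f x‖ ∂(μHE[d] : Measure E) := by
  classical
  have hfc : Continuous f := hc.contDiff.continuous
  have hdfc : Continuous (fderiv ℝ f) := hc.contDiff.continuous_fderiv (by norm_num)
  set Ψ := hc.flowHomeomorph with hΨ
  have hXz : ∀ x, x ∉ V → X x = 0 := fun x hx =>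
    image_eq_zero_of_notMem_tsupport fun h => hx (hXV h)
  have hX'z : ∀ x, x ∉ V → fderiv ℝ X x = 0 := fun x hx =>
    fderiv_of_notMem_tsupport (𝕜 := ℝ) fun h => hx (hXV h)
  -- both sides in flow coordinates
  have hL : ∫ x in Ω, divergence X x = ∫ p in {p : (ℝ ∙ v)ᗮ × ℝ | p.2 < 0}, divergence X (Ψ p) := by
    have h1 : ∫ x in Ω, divergence X x = ∫ x in {x | f x ≤ 0}, divergence X x := by
      rw [← integral_indicator hΩ.measurableSet,
        ← integral_indicator (isClosed_le hfc continuous_const).measurableSet]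
      congr 1
      funext x
      by_cases hx : x ∈ V
      · have := hc.mem_iff x hx
        by_cases hxΩ : x ∈ Ω
        · rw [Set.indicator_of_mem hxΩ, Set.indicator_of_mem (s := {z | f z ≤ 0}) (this.1 hxΩ)]
        · rw [Set.indicator_of_notMem hxΩ,
            Set.indicator_of_notMem (s := {z | f z ≤ 0}) fun h => hxΩ (this.2 h)]
      · have : divergence X x = 0 := by rw [divergence, hX'z x hx]; simp
        simp [Set.indicator, this]
    rw [h1, ← hc.measurePreserving_flowHomeomorph.setIntegral_preimage_emb
      Ψ.measurableEmbedding]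
    have h2 : (Ψ ⁻¹' {x | f x ≤ 0} : Set ((ℝ ∙ v)ᗮ × ℝ)) = Set.univ ×ˢ Set.Iic 0 := by
      ext p; simp [hΨ, hc.apply_flowHomeomorph]
    have h3 : {p : (ℝ ∙ v)ᗮ × ℝ | p.2 < 0} = Set.univ ×ˢ Set.Iio 0 := by
      ext p; simp
    rw [h2, h3, Measure.volume_eq_prod, ← Measure.prod_restrict, ← Measure.prod_restrict,
      Measure.restrict_congr_set (Iio_ae_eq_Iic (μ := (volume : Measure ℝ)) (a := 0))]
  have hR : ∫ x in frontier Ω, fderiv ℝ f x (X x) / ‖fderiv ℝ f x‖ ∂(μHE[d] : Measure E) =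
      ∫ y : (ℝ ∙ v)ᗮ, fderiv ℝ f y (X (graphMap f v y)) := by
    have h1 : ∫ x in frontier Ω, fderiv ℝ f x (X x) / ‖fderiv ℝ f x‖ ∂(μHE[d] : Measure E) =
        ∫ x in {x | f x = 0}, fderiv ℝ f x (X x) / ‖fderiv ℝ f x‖ ∂(μHE[d] : Measure E) := by
      rw [← integral_indicator isClosed_frontier.measurableSet,
        ← integral_indicator (isClosed_eq hfc continuous_const).measurableSet]
      congr 1
      funext x
      by_cases hx : x ∈ V
      · have := hc.mem_frontier_iff hx
        by_cases hxΩ : x ∈ frontier Ω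
        · rw [Set.indicator_of_mem hxΩ, Set.indicator_of_mem (s := {z | f z = 0}) (this.1 hxΩ)]
        · rw [Set.indicator_of_notMem hxΩ,
            Set.indicator_of_notMem (s := {z | f z = 0}) fun h => hxΩ (this.2 h)]
      · simp [Set.indicator, hXz x hx]
    rw [h1, hc.setIntegral_graph hd]
    congr 1
    funext y
    rw [hc.fderiv_graphMap]
    have := hc.norm_fderiv_pos (y : E)
    field_simp
  rw [hL, hR]
  set w := stdOrthonormalBasis ℝ (ℝ ∙ v)ᗮ
  have hdc : ContinuousOn (fun p => fderiv ℝ X (Ψ p)) {p : (ℝ ∙ v)ᗮ × ℝ | p.2 < 0} := by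
    intro p hp
    have h1 : ContinuousAt (fderiv ℝ X) (Ψ p) :=
      (hc.contDiffAt_of_neg hX hXV (by rw [hc.apply_flowHomeomorph]; exact hp)).fderiv_right
        (m := 0) (by norm_num) |>.continuousAt
    exact (ContinuousAt.comp h1 Ψ.continuous.continuousAt).continuousWithinAt
  have hgdc : ∀ i, Continuous fun p : (ℝ ∙ v)ᗮ × ℝ => graphDeriv f v p.1 (w i) := fun i => by
    simp only [graphDeriv_apply]; fun_prop
  have hint : ∀ i, IntegrableOn (fun p : (ℝ ∙ v)ᗮ × ℝ =>
      inner ℝ (w i : E) (fderiv ℝ X (Ψ p) (graphDeriv f v p.1 (w i)))) {p | p.2 < 0} := fun i => by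
    refine hc.integrableOn_flow hX hXV hU hΩ hXc (g := fun p => ‖graphDeriv f v p.1 (w i)‖) ?_
      (hgdc i).norm fun p hp => ?_
    · exact continuousOn_const.inner (hdc.clm_apply (hgdc i).continuousOn)
    · refine (abs_real_inner_le_norm _ _).trans ?_
      have := (fderiv ℝ X (Ψ p)).le_opNorm (graphDeriv f v p.1 (w i))
      have h1 : ‖(w i : E)‖ = 1 := w.norm_eq_one i
      rw [h1, one_mul, mul_comm]
      exact this
  have hint0 : IntegrableOn (fun p : (ℝ ∙ v)ᗮ × ℝ => fderiv ℝ f p.1 (fderiv ℝ X (Ψ p) v))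
      {p | p.2 < 0} := by
    refine hc.integrableOn_flow hX hXV hU hΩ hXc (g := fun p => ‖fderiv ℝ f (p.1 : E)‖) ?_
      (by fun_prop) fun p hp => ?_
    · exact (Continuous.continuousOn (by fun_prop)).clm_apply (hdc.clm_apply continuousOn_const)
    · refine ((fderiv ℝ f (p.1 : E)).le_opNorm _).trans ?_
      have := (fderiv ℝ X (Ψ p)).le_opNorm v
      rw [hc.norm_eq, mul_one] at this
      exact mul_le_mul_of_nonneg_left this (norm_nonneg _)
  have hset : (volume : Measure ((ℝ ∙ v)ᗮ × ℝ)).restrict {p | p.2 < 0} =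
      (volume : Measure (ℝ ∙ v)ᗮ).prod (volume.restrict (Set.Iio (0 : ℝ))) := by
    have h3 : {p : (ℝ ∙ v)ᗮ × ℝ | p.2 < 0} = Set.univ ×ˢ Set.Iio 0 := by
      ext p; simp
    rw [h3, Measure.volume_eq_prod, ← Measure.prod_restrict, Measure.restrict_univ]
  have hsplit : ∫ p in {p : (ℝ ∙ v)ᗮ × ℝ | p.2 < 0}, divergence X (Ψ p) =
      (∑ i, ∫ p in {p : (ℝ ∙ v)ᗮ × ℝ | p.2 < 0},
        inner ℝ (w i : E) (fderiv ℝ X (Ψ p) (graphDeriv f v p.1 (w i)))) +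
      ∫ p in {p : (ℝ ∙ v)ᗮ × ℝ | p.2 < 0}, fderiv ℝ f p.1 (fderiv ℝ X (Ψ p) v) := by
    rw [← integral_finsetSum _ fun i _ => hint i, ←
      integral_add (integrable_finsetSum _ fun i _ => hint i) hint0]
    exact integral_congr_ae (Eventually.of_forall fun p => hc.trace_eq_flow w _ p.1)
  rw [hsplit]
  -- the derivatives along the hyperplane integrate to zero on each slice
  have hzero : ∀ i, ∫ p in {p : (ℝ ∙ v)ᗮ × ℝ | p.2 < 0},
      inner ℝ (w i : E) (fderiv ℝ X (Ψ p) (graphDeriv f v p.1 (w i))) = 0 := by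
    intro i
    have hi := hint i
    rw [IntegrableOn, hset] at hi
    rw [hset, integral_prod_symm _ hi]
    refine setIntegral_eq_zero_of_forall_eq_zero fun t ht => ?_
    have ht' : t < 0 := ht
    set g : (ℝ ∙ v)ᗮ → ℝ := fun y => inner ℝ (w i : E) (X (Ψ (y, t))) with hg
    have hXat : ∀ y, ContDiffAt ℝ 1 X (Ψ (y, t)) := fun y =>
      hc.contDiffAt_of_neg hX hXV (by rw [hc.apply_flowHomeomorph]; exact ht')
    have hgd : ∀ y, HasFDerivAt g ((innerSL ℝ (w i : E)) ∘L
        (fderiv ℝ X (Ψ (y, t)) ∘L graphDeriv f v y)) y := by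
      intro y
      have h1 := ((hXat y).differentiableAt (by norm_num)).hasFDerivAt
      have h2 : HasFDerivAt (fun y => Ψ (y, t)) (graphDeriv f v y) y :=
        (hc.hasStrictFDerivAt_graphMap y).hasFDerivAt.add_const (t • v)
      exact ((innerSL ℝ (w i : E)).hasFDerivAt).comp y (h1.comp y h2)
    have hgC : ContDiff ℝ 1 g := by
      rw [contDiff_iff_contDiffAt]
      intro y
      have h2 : ContDiffAt ℝ 1 (fun y : (ℝ ∙ v)ᗮ => Ψ (y, t)) y := by
        have h3 : ContDiff ℝ 1 f := hc.contDiff.of_le (by norm_num)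
        have h4 : ContDiff ℝ 1 (fun y : (ℝ ∙ v)ᗮ => (y : E)) := (ℝ ∙ v)ᗮ.subtypeL.contDiff
        have h5 : ContDiff ℝ 1 (fun y : (ℝ ∙ v)ᗮ => (y : E) - f y • v + t • v) :=
          (h4.sub ((h3.comp h4).smul contDiff_const)).add contDiff_const
        exact h5.contDiffAt
      exact contDiffAt_const.inner ℝ ((hXat y).comp y h2)
    have hgcs : HasCompactSupport g := by
      have hemb : Topology.IsClosedEmbedding (fun y : (ℝ ∙ v)ᗮ => Ψ (y, t)) := by
        have : (fun y : (ℝ ∙ v)ᗮ => Ψ (y, t)) = (Homeomorph.addRight (t • v)) ∘ graphMap f v := by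
          funext y; rfl
        rw [this]
        exact (Homeomorph.addRight (t • v)).isClosedEmbedding.comp hc.isClosedEmbedding_graphMap
      exact (hXc.comp_isClosedEmbedding hemb).comp_left (g := fun z => inner ℝ (w i : E) z) (by simp)
    have := integral_fderiv_apply_eq_zero hgC hgcs (w i)
    simpa [(hgd _).fderiv] using this
  -- the remaining term is a derivative in `t`
  rw [Finset.sum_eq_zero fun i _ => hzero i, zero_add]
  rw [IntegrableOn, hset] at hint0
  rw [hset, integral_prod _ hint0]
  refine integral_congr_ae ?_
  filter_upwards [hint0.prod_right_ae] with y hy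
  have hderiv : ∀ t ∈ Set.Iio (0 : ℝ), HasDerivAt (fun t => fderiv ℝ f (y : E) (X (Ψ (y, t))))
      (fderiv ℝ f (y : E) (fderiv ℝ X (Ψ (y, t)) v)) t := by
    intro t ht
    have h1 := ((hc.contDiffAt_of_neg hX hXV (x := Ψ (y, t))
      (by rw [hc.apply_flowHomeomorph]; exact ht)).differentiableAt (by norm_num)).hasFDerivAt
    have h2 : HasDerivAt (fun t => Ψ (y, t)) v t := by
      have h3 := ((hasDerivAt_id t).smul_const v).const_add (graphMap f v y)
      rwa [one_smul] at h3
    exact (fderiv ℝ f (y : E)).hasFDerivAt.comp_hasDerivAt t (h1.comp_hasDerivAt t h2)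
  have hcontline : Continuous fun t : ℝ => Ψ (y, t) := Ψ.continuous.comp (by fun_prop)
  -- `X` is continuous at the boundary only from within `Ω`, where `t ≤ 0`
  have hcw : ContinuousWithinAt (fun t => fderiv ℝ f (y : E) (X (Ψ (y, t)))) (Set.Iic 0) 0 := by
    refine (fderiv ℝ f (y : E)).continuous.continuousAt.comp_continuousWithinAt ?_
    by_cases hs : Ψ (y, 0) ∈ tsupport X
    · have hV := hXV hs
      have h0 : Ψ (y, 0) ∈ Ω := (hc.mem_iff _ hV).2 (by rw [hc.apply_flowHomeomorph])
      have hev : ∀ᶠ t in 𝓝[Set.Iic 0] (0 : ℝ), Ψ (y, t) ∈ Ω := by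
        filter_upwards [self_mem_nhdsWithin, mem_nhdsWithin_of_mem_nhds
          (hcontline.continuousAt.eventually (hc.isOpen.mem_nhds hV))] with t ht htV
        exact (hc.mem_iff _ htV).2 (by rw [hc.apply_flowHomeomorph]; exact ht)
      have h1 := hX.continuousOn _ h0
      have h2 : Tendsto (fun t => Ψ (y, t)) (𝓝[Set.Iic 0] (0 : ℝ)) (𝓝[Ω] (Ψ (y, 0))) :=
        tendsto_nhdsWithin_iff.2 ⟨(hcontline.tendsto 0).mono_left nhdsWithin_le_nhds, hev⟩
      exact h1.tendsto.comp h2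
    · have h1 : X =ᶠ[𝓝 (Ψ (y, 0))] fun _ => 0 := by
        filter_upwards [(isClosed_tsupport X).isOpen_compl.mem_nhds hs] with z hz
        exact image_eq_zero_of_notMem_tsupport hz
      have h2 : ContinuousAt X (Ψ (y, 0)) := continuousAt_const.congr h1.symm
      exact (ContinuousAt.comp (f := fun t : ℝ => Ψ (y, t)) h2
        hcontline.continuousAt).continuousWithinAt
  have hlim : Tendsto (fun t => fderiv ℝ f (y : E) (X (Ψ (y, t)))) atBot (𝓝 0) := by
    obtain ⟨C, hC⟩ := IsCompact.exists_bound_of_continuousOn hXc hfc.continuousOn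
    refine tendsto_const_nhds.congr' ?_
    filter_upwards [eventually_lt_atBot (-C), eventually_lt_atBot 0] with t ht ht0
    have : Ψ (y, t) ∉ tsupport X := fun h => by
      have h1 := hC _ h
      rw [hc.apply_flowHomeomorph, Real.norm_eq_abs, abs_of_neg ht0] at h1
      linarith
    rw [image_eq_zero_of_notMem_tsupport this, map_zero]
  have hFTC := integral_Iic_of_hasDerivAt_of_tendsto hcw hderiv
    (by rw [IntegrableOn, Measure.restrict_congr_set
          (Iio_ae_eq_Iic (μ := (volume : Measure ℝ)) (a := 0)).symm]; exact hy) hlim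
  rw [Measure.restrict_congr_set (Iio_ae_eq_Iic (μ := (volume : Measure ℝ)) (a := 0)), hFTC]
  simp [hΨ, flowHomeomorph_apply]

end Local

end IsGraphChart

/-! ### Linear algebra of a Riemannian metric -/

section MetricAlgebra

variable {n : ℕ} (G : Eu n → Matrix (Fin n) (Fin n) ℝ) (x : Eu n)

theorem metricInner_eq_dotProduct (u v : Eu n) :
    metricInner G x u v = u.ofLp ⬝ᵥ (G x).mulVec v.ofLp := by
  simp only [metricInner, dotProduct, Matrix.mulVec, Finset.mul_sum]
  exact Finset.sum_congr rfl fun i _ => Finset.sum_congr rfl fun j _ => by ring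

theorem metricInner_add_left (u u' v : Eu n) :
    metricInner G x (u + u') v = metricInner G x u v + metricInner G x u' v := by
  simp [metricInner_eq_dotProduct, add_dotProduct]

theorem metricInner_smul_left (c : ℝ) (u v : Eu n) :
    metricInner G x (c • u) v = c * metricInner G x u v := by
  simp [metricInner_eq_dotProduct]

theorem metricInner_add_right (u v v' : Eu n) :
    metricInner G x u (v + v') = metricInner G x u v + metricInner G x u v' := by
  simp [metricInner_eq_dotProduct, Matrix.mulVec_add, dotProduct_add]

theorem metricInner_smul_right (c : ℝ) (u v : Eu n) :
    metricInner G x u (c • v) = c * metricInner G x u v := by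
  simp [metricInner_eq_dotProduct, Matrix.mulVec_smul]

/-- The inner product `g_x` as a bilinear map. -/
def metricBilin : Eu n →ₗ[ℝ] Eu n →ₗ[ℝ] ℝ :=
  LinearMap.mk₂ ℝ (metricInner G x) (metricInner_add_left G x) (metricInner_smul_left G x)
    (metricInner_add_right G x) (metricInner_smul_right G x)

theorem metricBilin_apply (u v : Eu n) : metricBilin G x u v = metricInner G x u v := rfl

theorem metricInner_sub_left (u u' v : Eu n) :
    metricInner G x (u - u') v = metricInner G x u v - metricInner G x u' v := by
  simp [← metricBilin_apply]

theorem metricInner_zero_left (v : Eu n) : metricInner G x 0 v = 0 := by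
  simp [← metricBilin_apply]

theorem metricInner_zero_right (v : Eu n) : metricInner G x v 0 = 0 := by
  simp [← metricBilin_apply]

theorem metricInner_sum_left {ι : Type*} (s : Finset ι) (u : ι → Eu n) (v : Eu n) :
    metricInner G x (∑ i ∈ s, u i) v = ∑ i ∈ s, metricInner G x (u i) v := by
  simp [← metricBilin_apply]

theorem metricInner_sum_right {ι : Type*} (s : Finset ι) (u : ι → Eu n) (v : Eu n) :
    metricInner G x v (∑ i ∈ s, u i) = ∑ i ∈ s, metricInner G x v (u i) := by
  simp [← metricBilin_apply]

variable {G x}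

theorem metricInner_comm (hG : (G x).PosDef) (u v : Eu n) :
    metricInner G x u v = metricInner G x v u := by
  have hs : ∀ i j, G x i j = G x j i := fun i j => by
    have := hG.isHermitian.apply i j
    simpa using this.symm
  simp only [metricInner]
  rw [Finset.sum_comm]
  refine Finset.sum_congr rfl fun i _ => Finset.sum_congr rfl fun j _ => ?_
  rw [hs]; ring

theorem metricInner_self_pos (hG : (G x).PosDef) {u : Eu n} (hu : u ≠ 0) :
    0 < metricInner G x u u := by
  have h := hG.dotProduct_mulVec_pos (x := u.ofLp) (by simpa using hu)
  rw [metricInner_eq_dotProduct]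
  simpa using h

theorem metricInner_self_nonneg (hG : (G x).PosDef) (u : Eu n) : 0 ≤ metricInner G x u u := by
  by_cases hu : u = 0
  · simp [hu, metricInner_zero_left]
  · exact (metricInner_self_pos hG hu).le

theorem eq_zero_of_metricInner_self (hG : (G x).PosDef) {u : Eu n} (h : metricInner G x u u = 0) :
    u = 0 := by
  by_contra hu
  exact (metricInner_self_pos hG hu).ne' h

/-- A metric Gram determinant of `n` vectors is `det G` times the Euclidean one. -/
theorem det_metricInner {ι : Type*} [Fintype ι] [DecidableEq ι] (hι : Fintype.card ι = n)
    (u : ι → Eu n) :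
    (Matrix.of fun a b => metricInner G x (u a) (u b)).det =
      (G x).det * (Matrix.of fun a b => (inner ℝ (u a) (u b) : ℝ)).det := by
  let e : Fin n ≃ ι := (Fintype.equivFinOfCardEq hι).symm
  let M : Matrix (Fin n) (Fin n) ℝ := Matrix.of fun i a => u (e a) i
  have h1 : (Matrix.of fun a b => metricInner G x (u a) (u b)).submatrix e e =
      M.transpose * (G x * M) := by
    ext a b
    simp only [Matrix.submatrix_apply, Matrix.of_apply, metricInner_eq_dotProduct, Matrix.mul_apply,
      dotProduct, Matrix.mulVec, M, Matrix.transpose_apply]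
  have h2 : (Matrix.of fun a b => (inner ℝ (u a) (u b) : ℝ)).submatrix e e = M.transpose * M := by
    ext a b
    simp [Matrix.mul_apply, M, PiLp.inner_apply, mul_comm]
  rw [← Matrix.det_submatrix_equiv_self e, h1,
    ← Matrix.det_submatrix_equiv_self e (Matrix.of fun a b => (inner ℝ (u a) (u b) : ℝ)), h2]
  simp only [Matrix.det_mul]
  ring

/-- The Gram determinant of a metric on a hyperplane, in terms of the metric unit normal `ν` and
the Euclidean unit normal `e`. -/
theorem det_metricInner_hyperplane {e ν : Eu n} (he : ‖e‖ = 1) {k : ℕ}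
    (t : OrthonormalBasis (Fin k) ℝ (ℝ ∙ e)ᗮ) (hk : k + 1 = n)
    (hν : metricInner G x ν ν = 1) (hG : (G x).PosDef)
    (hνt : ∀ i, metricInner G x ν (t i) = 0) :
    (Matrix.of fun i j => metricInner G x (t i) (t j)).det = (G x).det * (inner ℝ e ν) ^ 2 := by
  -- compare the two Gram determinants of the family consisting of the basis `t` and of `ν`
  have h := det_metricInner (G := G) (x := x) (ι := Fin k ⊕ Unit) (by simpa using hk)
    (Sum.elim (fun i => (t i : Eu n)) fun _ => ν)
  have h1 : (Matrix.of fun a b => metricInner G x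
      (Sum.elim (fun i => (t i : Eu n)) (fun _ => ν) a)
      (Sum.elim (fun i => (t i : Eu n)) (fun _ => ν) b)) =
      Matrix.fromBlocks (Matrix.of fun i j => metricInner G x (t i) (t j)) 0 0
        (1 : Matrix Unit Unit ℝ) := by
    ext a b
    rcases a with a | a <;> rcases b with b | b
    · simp
    · simp [metricInner_comm hG _ ν, hνt]
    · simp [hνt]
    · simp [hν]
  have h2 : (Matrix.of fun a b => (inner ℝ
      (Sum.elim (fun i => (t i : Eu n)) (fun _ => ν) a)
      (Sum.elim (fun i => (t i : Eu n)) (fun _ => ν) b) : ℝ)) =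
      Matrix.fromBlocks 1 (Matrix.of fun i (_ : Unit) => inner ℝ (t i : Eu n) ν)
        (Matrix.of fun (_ : Unit) i => inner ℝ (t i : Eu n) ν)
        (Matrix.of fun _ _ => inner ℝ ν ν : Matrix Unit Unit ℝ) := by
    ext a b
    rcases a with a | a <;> rcases b with b | b
    · simp only [Matrix.of_apply, Sum.elim_inl, Matrix.fromBlocks_apply₁₁, Matrix.one_apply]
      exact orthonormal_iff_ite.1 t.orthonormal a b
    · simp
    · simp [real_inner_comm]
    · simp
  -- the Schur complement in the second matrix is `|ν|² - ∑ ⟨t i, ν⟩² = ⟨e, ν⟩²`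
  rw [h1, h2, Matrix.det_fromBlocks_zero₂₁, Matrix.det_fromBlocks_one₁₁, Matrix.det_one, mul_one] at h
  rw [h]
  congr 1
  have h3 := IsGraphChart.sum_inner_smul_add he t ν
  have h4 := congrArg (fun z => inner ℝ z ν) h3
  simp only [inner_add_left, sum_inner, inner_smul_left] at h4
  simp only [Matrix.det_unique, Matrix.sub_apply, Matrix.of_apply, Matrix.mul_apply]
  simp only [RCLike.conj_to_real] at h4
  rw [← h4]; ring

end MetricAlgebra

/-! ### Smoothness of determinants and inverses -/

section MatrixSmooth

variable {E : Type*} [NormedAddCommGroup E] [NormedSpace ℝ E] {m : WithTop ℕ∞} {s : Set E}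

theorem contDiffOn_det {ι : Type*} [Fintype ι] [DecidableEq ι] {M : E → Matrix ι ι ℝ}
    (hM : ∀ i j, ContDiffOn ℝ m (fun x => M x i j) s) : ContDiffOn ℝ m (fun x => (M x).det) s := by
  simp only [Matrix.det_apply]
  exact ContDiffOn.sum fun σ _ => (contDiffOn_prod fun i _ => hM _ _).const_smul _

theorem contDiffOn_inv_apply {ι : Type*} [Fintype ι] [DecidableEq ι] {M : E → Matrix ι ι ℝ}
    (hM : ∀ i j, ContDiffOn ℝ m (fun x => M x i j) s) (hdet : ∀ x ∈ s, (M x).det ≠ 0) (i j : ι) :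
    ContDiffOn ℝ m (fun x => (M x)⁻¹ i j) s := by
  have h : (fun x => (M x)⁻¹ i j) = fun x => (M x).det⁻¹ * (M x).adjugate i j := by
    funext x
    rw [Matrix.inv_def, Ring.inverse_eq_inv', Matrix.smul_apply, smul_eq_mul]
  rw [h]
  refine ((contDiffOn_det hM).inv hdet).mul ?_
  simp only [Matrix.adjugate_apply]
  refine contDiffOn_det fun a b => ?_
  simp only [Matrix.updateRow_apply]
  split_ifs
  · exact contDiffOn_const
  · exact hM a b

end MatrixSmooth

/-! ### The outward unit normal and the surface density -/

section Normal

variable {n : ℕ} {G : Eu n → Matrix (Fin n) (Fin n) ℝ} {x : Eu n}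

theorem sum_smul_stdVec (u : Eu n) : ∑ i, u i • (stdVec i : Eu n) = u := by
  have h := (EuclideanSpace.basisFun (Fin n) ℝ).sum_repr u
  simpa [stdVec] using h

/-- The gradient of `f` with respect to the metric. -/
def metricGrad (G : Eu n → Matrix (Fin n) (Fin n) ℝ) (f : Eu n → ℝ) (x : Eu n) : Eu n :=
  WithLp.toLp 2 ((G x)⁻¹.mulVec fun i => fderiv ℝ f x (stdVec i))

theorem metricInner_metricGrad (hG : (G x).PosDef) (f : Eu n → ℝ) (ξ : Eu n) :
    metricInner G x ξ (metricGrad G f x) = fderiv ℝ f x ξ := by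
  have hu : IsUnit (G x).det := isUnit_iff_ne_zero.2 hG.det_pos.ne'
  rw [metricInner_eq_dotProduct, metricGrad]
  simp only [Matrix.mulVec_mulVec, Matrix.mul_nonsing_inv _ hu, Matrix.one_mulVec]
  conv_rhs => rw [← sum_smul_stdVec ξ]
  simp [dotProduct]

/-- The normalized metric gradient of `f`. -/
def gradNormal (G : Eu n → Matrix (Fin n) (Fin n) ℝ) (f : Eu n → ℝ) (x : Eu n) : Eu n :=
  (√(fderiv ℝ f x (metricGrad G f x)))⁻¹ • metricGrad G f x

theorem fderiv_metricGrad_pos (hG : (G x).PosDef) {f : Eu n → ℝ} (hf : fderiv ℝ f x ≠ 0) :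
    0 < fderiv ℝ f x (metricGrad G f x) := by
  rw [← metricInner_metricGrad hG]
  refine metricInner_self_pos hG fun h => hf ?_
  ext ξ
  rw [← metricInner_metricGrad hG, h, metricInner_zero_right]
  rfl

theorem metricInner_gradNormal (hG : (G x).PosDef) (f : Eu n → ℝ) (ξ : Eu n) :
    metricInner G x ξ (gradNormal G f x) =
      (√(fderiv ℝ f x (metricGrad G f x)))⁻¹ * fderiv ℝ f x ξ := by
  rw [gradNormal, metricInner_smul_right, metricInner_metricGrad hG]

theorem fderiv_gradNormal (hG : (G x).PosDef) {f : Eu n → ℝ} (hf : fderiv ℝ f x ≠ 0) :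
    fderiv ℝ f x (gradNormal G f x) = √(fderiv ℝ f x (metricGrad G f x)) := by
  have := fderiv_metricGrad_pos hG hf
  rw [gradNormal, map_smul, smul_eq_mul]
  field_simp
  exact (Real.sq_sqrt this.le).symm

theorem metricInner_gradNormal_self (hG : (G x).PosDef) {f : Eu n → ℝ} (hf : fderiv ℝ f x ≠ 0) :
    metricInner G x (gradNormal G f x) (gradNormal G f x) = 1 := by
  have := fderiv_metricGrad_pos hG hf
  rw [metricInner_gradNormal hG, fderiv_gradNormal hG hf]
  exact inv_mul_cancel₀ (Real.sqrt_pos.2 this).ne'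

namespace IsGraphChart

variable {Ω : Set (Eu n)} {v : Eu n} {f : Eu n → ℝ} {V : Set (Eu n)} (hc : IsGraphChart Ω v f V)
include hc

theorem fderiv_ne_zero (x : Eu n) : fderiv ℝ f x ≠ 0 :=
  norm_pos_iff.1 (hc.norm_fderiv_pos x)

theorem isOutwardUnitNormal_gradNormal (hx : x ∈ V) (hfx : f x = 0) (hG : (G x).PosDef) :
    IsOutwardUnitNormal G Ω x (gradNormal G f x) := by
  refine ⟨metricInner_gradNormal_self hG (hc.fderiv_ne_zero x), fun ξ hξ => ?_, ?_⟩
  · rw [hc.tangentSpace_eq hx hfx] at hξ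
    have h0 : fderiv ℝ f x ξ = 0 := hξ
    rw [metricInner_comm hG, metricInner_gradNormal hG, h0, mul_zero]
  · refine hc.eventually_shift_notMem_of_pos hx hfx ?_
    rw [fderiv_gradNormal hG (hc.fderiv_ne_zero x)]
    exact Real.sqrt_pos.2 (fderiv_metricGrad_pos hG (hc.fderiv_ne_zero x))

/-- The outward unit normal is unique: a vector orthogonal to the tangent hyperplane is a multiple
of the normalized gradient, and the sign is fixed by the outward condition. -/
theorem eq_of_isOutwardUnitNormal (hx : x ∈ V) (hfx : f x = 0) (hG : (G x).PosDef) {u : Eu n}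
    (hu : IsOutwardUnitNormal G Ω x u) : u = gradNormal G f x := by
  obtain ⟨hu1, hu2, hu3⟩ := hu
  set ν := gradNormal G f x with hν
  have hνν : metricInner G x ν ν = 1 := metricInner_gradNormal_self hG (hc.fderiv_ne_zero x)
  have hq := fderiv_metricGrad_pos hG (hc.fderiv_ne_zero x)
  have hdν : 0 < fderiv ℝ f x ν := by
    rw [hν, fderiv_gradNormal hG (hc.fderiv_ne_zero x)]
    exact Real.sqrt_pos.2 hq
  set c := metricInner G x u ν with hcdef
  have hξ : fderiv ℝ f x (u - c • ν) = 0 := by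
    have h1 : metricInner G x (u - c • ν) ν = 0 := by
      rw [metricInner_sub_left, metricInner_smul_left, hνν, ← hcdef]; ring
    rw [hν, metricInner_gradNormal hG] at h1
    have h2 : (√(fderiv ℝ f x (metricGrad G f x)))⁻¹ ≠ 0 := (inv_pos.2 (Real.sqrt_pos.2 hq)).ne'
    exact (mul_eq_zero.1 h1).resolve_left h2
  have hmem : u - c • ν ∈ tangentSpace (frontier Ω) x := by
    rw [hc.tangentSpace_eq hx hfx]; exact hξ
  have h0 : u - c • ν = 0 := by
    refine eq_zero_of_metricInner_self hG ?_
    conv_lhs => rw [metricInner_sub_left, metricInner_smul_left]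
    rw [hu2 _ hmem, metricInner_comm hG ν, hν, metricInner_gradNormal hG, ← hν, hξ]
    ring
  have huc : u = c • ν := sub_eq_zero.1 h0
  have hc2 : c ^ 2 = 1 := by
    rw [huc, metricInner_smul_left, metricInner_smul_right, hνν] at hu1
    nlinarith
  have hc0 : ¬ c < 0 := fun hneg => by
    have h1 : fderiv ℝ f x u < 0 := by
      rw [huc, map_smul, smul_eq_mul]; exact mul_neg_of_neg_of_pos hneg hdν
    obtain ⟨t, ht1, ht2⟩ := (hu3.and (hc.eventually_shift_mem_of_neg hx hfx h1)).exists
    exact ht1 ht2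
  have : c = 1 := by nlinarith
  rw [huc, this, one_smul]

theorem outwardNormal_eq (hx : x ∈ V) (hfx : f x = 0) (hG : (G x).PosDef) :
    outwardNormal G Ω x = gradNormal G f x :=
  hc.eq_of_isOutwardUnitNormal hx hfx hG
    (Classical.epsilon_spec ⟨_, hc.isOutwardUnitNormal_gradNormal hx hfx hG⟩)

/-- The surface density in terms of the defining function. The basis in the definition of
`surfaceDensity` is one of the hyperplane orthogonal to the Euclidean unit normal `e`. -/
theorem surfaceDensity_eq (hx : x ∈ V) (hfx : f x = 0) (hG : (G x).PosDef) :
    surfaceDensity G (frontier Ω) x =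
      √(G x).det * (√(fderiv ℝ f x (metricGrad G f x)) / ‖fderiv ℝ f x‖) := by
  set e := ‖fderiv ℝ f x‖⁻¹ • (InnerProductSpace.toDual ℝ (Eu n)).symm (fderiv ℝ f x) with he
  have hpos := hc.norm_fderiv_pos x
  have he1 : ‖e‖ = 1 := by
    rw [he, norm_smul, LinearIsometryEquiv.norm_map, norm_inv, norm_norm, inv_mul_cancel₀ hpos.ne']
  have hei : ∀ u, inner ℝ e u = ‖fderiv ℝ f x‖⁻¹ * fderiv ℝ f x u := fun u => by
    rw [he, inner_smul_left, InnerProductSpace.toDual_symm_apply]; rfl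
  have hT : tangentSpace (frontier Ω) x = (ℝ ∙ e)ᗮ := by
    rw [hc.tangentSpace_eq hx hfx]
    ext u
    rw [Submodule.mem_orthogonal_singleton_iff_inner_right, hei]
    constructor
    · intro h
      have h' : fderiv ℝ f x u = 0 := h
      rw [h', mul_zero]
    · intro h
      exact (mul_eq_zero.1 h).resolve_left (inv_pos.2 hpos).ne'
  -- the tangent space occurs in the type of its basis, hence the general `T`
  have key : ∀ T : Submodule ℝ (Eu n), T = (ℝ ∙ e)ᗮ →
      (Matrix.of fun i j => metricInner G x (stdOrthonormalBasis ℝ T i : Eu n)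
        (stdOrthonormalBasis ℝ T j : Eu n)).det = (G x).det *
          (inner ℝ e (gradNormal G f x)) ^ 2 := by
    rintro T rfl
    have hn0 : n ≠ 0 := by
      rintro rfl
      have := hc.norm_eq
      rw [Subsingleton.elim v 0, norm_zero] at this
      exact zero_ne_one this
    have hfact : Fact (Module.finrank ℝ (Eu n) = (n - 1) + 1) := ⟨by simp; omega⟩
    have hfin : Module.finrank ℝ (ℝ ∙ e)ᗮ = n - 1 :=
      Submodule.finrank_orthogonal_span_singleton (n := n - 1) (by
        rintro h; rw [h, norm_zero] at he1; exact zero_ne_one he1)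
    refine det_metricInner_hyperplane he1 _ (by omega)
      (metricInner_gradNormal_self hG (hc.fderiv_ne_zero x)) hG fun i => ?_
    have hi : fderiv ℝ f x (stdOrthonormalBasis ℝ (ℝ ∙ e)ᗮ i : Eu n) = 0 := by
      have h1 := inner_coe_orthogonal (stdOrthonormalBasis ℝ (ℝ ∙ e)ᗮ i)
      rw [hei] at h1
      exact (mul_eq_zero.1 h1).resolve_left (inv_pos.2 hpos).ne'
    rw [metricInner_comm hG, metricInner_gradNormal hG, hi, mul_zero]
  rw [surfaceDensity, key _ hT, hei, fderiv_gradNormal hG (hc.fderiv_ne_zero x),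
    Real.sqrt_mul hG.det_pos.le, Real.sqrt_sq (by positivity)]
  congr 1
  rw [div_eq_inv_mul]

/-- The flux densities `g(X, ν) dσ_g` and `⟨√(det G) X, e⟩ dσ` agree, where `e = ∇f / |∇f|` is the
Euclidean unit normal. -/
theorem surfaceDensity_mul_metricInner (hx : x ∈ V) (hfx : f x = 0) (hG : (G x).PosDef)
    (X : Eu n) :
    surfaceDensity G (frontier Ω) x * metricInner G x X (outwardNormal G Ω x) =
      fderiv ℝ f x (√(G x).det • X) / ‖fderiv ℝ f x‖ := by
  rw [hc.outwardNormal_eq hx hfx hG, hc.surfaceDensity_eq hx hfx hG, metricInner_gradNormal hG,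
    map_smul, smul_eq_mul]
  have h1 := hc.norm_fderiv_pos x
  have h2 := Real.sqrt_pos.2 (fderiv_metricGrad_pos hG (hc.fderiv_ne_zero x))
  field_simp

variable {U : Set (Eu n)}

theorem contDiffOn_metricGrad (hG : IsRiemannianMetricOn G U) :
    ContDiffOn ℝ 3 (metricGrad G f) U := by
  have h1 : ContDiff ℝ 3 (fderiv ℝ f) := hc.contDiff.fderiv_right (by norm_num)
  have hG3 : ∀ i j, ContDiffOn ℝ 3 (fun x => G x i j) U := fun i j =>
    (hG.1 i j).of_le ENat.LEInfty.out
  have h2 := contDiffOn_inv_apply hG3 fun x hx => (hG.2 x hx).det_pos.ne'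
  rw [contDiffOn_euclidean]
  intro i
  simp only [metricGrad, Matrix.mulVec, dotProduct]
  exact ContDiffOn.sum fun j _ => (h2 i j).mul ((h1.clm_apply contDiff_const).contDiffOn)

theorem contDiffOn_sqrt_fderiv (hG : IsRiemannianMetricOn G U) :
    ContDiffOn ℝ 3 (fun x => √(fderiv ℝ f x (metricGrad G f x))) U := by
  have h1 : ContDiff ℝ 3 (fderiv ℝ f) := hc.contDiff.fderiv_right (by norm_num)
  refine ContDiffOn.sqrt (h1.contDiffOn.clm_apply (hc.contDiffOn_metricGrad hG)) fun x hx => ?_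
  exact (fderiv_metricGrad_pos (hG.2 x hx) (hc.fderiv_ne_zero x)).ne'

theorem contDiffOn_gradNormal (hG : IsRiemannianMetricOn G U) :
    ContDiffOn ℝ 3 (gradNormal G f) U := by
  refine ContDiffOn.smul ((hc.contDiffOn_sqrt_fderiv hG).inv fun x hx => ?_)
    (hc.contDiffOn_metricGrad hG)
  exact (Real.sqrt_pos.2 (fderiv_metricGrad_pos (hG.2 x hx) (hc.fderiv_ne_zero x))).ne'

end IsGraphChart

section Domain

variable {Ω U : Set (Eu n)}

theorem contDiffOn_sqrt_det (hG : IsRiemannianMetricOn G U) :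
    ContDiffOn ℝ ∞ (fun x => √(G x).det) U :=
  ContDiffOn.sqrt (contDiffOn_det hG.1) fun x hx => (hG.2 x hx).det_pos.ne'

theorem IsSmoothCompactDomain.frontier_subset (hΩ : IsSmoothCompactDomain Ω) : frontier Ω ⊆ Ω :=
  hΩ.1.isClosed.frontier_subset

theorem IsSmoothCompactDomain.isCompact_frontier (hΩ : IsSmoothCompactDomain Ω) :
    IsCompact (frontier Ω) := hΩ.1.of_isClosed_subset isClosed_frontier hΩ.frontier_subset

/-- A function on the boundary that agrees near each point with a continuous function is
continuous. -/
theorem IsSmoothCompactDomain.continuousOn_frontier {Y : Type*} [TopologicalSpace Y]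
    (hΩ : IsSmoothCompactDomain Ω) {q : Eu n → Y}
    (h : ∀ v f V x, IsGraphChart Ω v f V → x ∈ V → f x = 0 →
      ∃ q' : Eu n → Y, ContinuousWithinAt q' (frontier Ω) x ∧
        ∀ y ∈ V, y ∈ frontier Ω → f y = 0 → q y = q' y) :
    ContinuousOn q (frontier Ω) := by
  intro x hx
  obtain ⟨v, f, V, hc, hxV⟩ := hΩ.exists_isGraphChart hx
  have hfx := (hc.mem_frontier_iff hxV).1 hx
  obtain ⟨q', hq', hqq⟩ := h v f V x hc hxV hfx
  refine hq'.congr_of_eventuallyEq ?_ (hqq x hxV hx hfx)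
  filter_upwards [mem_nhdsWithin_of_mem_nhds (hc.isOpen.mem_nhds hxV), self_mem_nhdsWithin]
    with y hy hyf
  exact hqq y hy hyf ((hc.mem_frontier_iff hy).1 hyf)

theorem continuousOn_outwardNormal (hΩ : IsSmoothCompactDomain Ω) (hU : IsOpen U) (hΩU : Ω ⊆ U)
    (hG : IsRiemannianMetricOn G U) : ContinuousOn (outwardNormal G Ω) (frontier Ω) := by
  refine hΩ.continuousOn_frontier fun v f V x hc hxV hfx => ⟨gradNormal G f, ?_, ?_⟩
  · have hxU := hΩU ((hc.mem_iff x hxV).2 hfx.le)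
    exact ((hc.contDiffOn_gradNormal hG).continuousOn.continuousAt
      (hU.mem_nhds hxU)).continuousWithinAt
  · intro y hy hyf hfy
    exact hc.outwardNormal_eq hy hfy (hG.2 y (hΩU (hΩ.frontier_subset hyf)))

theorem continuousOn_surfaceDensity (hΩ : IsSmoothCompactDomain Ω) (hU : IsOpen U) (hΩU : Ω ⊆ U)
    (hG : IsRiemannianMetricOn G U) :
    ContinuousOn (surfaceDensity G (frontier Ω)) (frontier Ω) := by
  refine hΩ.continuousOn_frontier fun v f V x hc hxV hfx => ⟨fun x => √(G x).det *
    (√(fderiv ℝ f x (metricGrad G f x)) / ‖fderiv ℝ f x‖), ?_, ?_⟩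
  · have hxU := hΩU ((hc.mem_iff x hxV).2 hfx.le)
    have h1 := (contDiffOn_sqrt_det hG).continuousOn
    have h2 := (hc.contDiffOn_sqrt_fderiv hG).continuousOn
    have h3 : Continuous fun x => ‖fderiv ℝ f x‖ :=
      (hc.contDiff.continuous_fderiv (by norm_num)).norm
    exact ((h1.mul (h2.div h3.continuousOn fun y _ => (hc.norm_fderiv_pos y).ne')).continuousAt
      (hU.mem_nhds hxU)).continuousWithinAt
  · intro y hy hyf hfy
    exact hc.surfaceDensity_eq hy hfy (hG.2 y (hΩU (hΩ.frontier_subset hyf)))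

end Domain

end Normal

/-! ### Globalization by a partition of unity -/

theorem exists_smooth_partition {E : Type*} [NormedAddCommGroup E] [NormedSpace ℝ E]
    [FiniteDimensional ℝ E] {K : Set E} (hK : IsCompact K) (V : E → Set E)
    (hV : ∀ x ∈ K, IsOpen (V x) ∧ x ∈ V x) :
    ∃ (t : Finset E) (φ : E → E → ℝ), (∀ x ∈ t, x ∈ K ∧ ContDiff ℝ ∞ (φ x) ∧
      HasCompactSupport (φ x) ∧ tsupport (φ x) ⊆ V x) ∧ ∀ y ∈ K, ∑ x ∈ t, φ x y = 1 := by
  classical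
  -- intersecting with balls makes the supports compact
  obtain ⟨t, htK, ht⟩ := hK.elim_nhds_subcover (fun x => V x ∩ Metric.ball x 1) fun x hx =>
    Filter.inter_mem ((hV x hx).1.mem_nhds (hV x hx).2) (Metric.ball_mem_nhds x one_pos)
  obtain ⟨φ, hφ⟩ := SmoothPartitionOfUnity.exists_isSubordinate (modelWithCornersSelf ℝ E)
    hK.isClosed (fun i : t => V i ∩ Metric.ball (i : E) 1)
    (fun i => (hV i (htK i i.2)).1.inter Metric.isOpen_ball) (by
      intro y hy
      obtain ⟨x, hx, hyx⟩ := Set.mem_iUnion₂.1 (ht hy)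
      exact Set.mem_iUnion.2 ⟨⟨x, hx⟩, hyx⟩)
  refine ⟨t, fun x => if hx : x ∈ t then φ ⟨x, hx⟩ else 0, fun x hx => ?_, fun y hy => ?_⟩
  · simp only [hx, dif_pos]
    have hsub := hφ ⟨x, hx⟩
    refine ⟨htK x hx, (φ ⟨x, hx⟩).contMDiff.contDiff, ?_, hsub.trans Set.inter_subset_left⟩
    exact (isCompact_closedBall x 1).of_isClosed_subset (isClosed_tsupport _)
      (hsub.trans (Set.inter_subset_right.trans Metric.ball_subset_closedBall))
  · have h1 := φ.sum_eq_one hy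
    rw [finsum_eq_sum_of_fintype] at h1
    rw [← h1, ← Finset.sum_coe_sort t]
    exact Finset.sum_congr rfl fun i _ => by simp

section Divergence

variable {E : Type*} [NormedAddCommGroup E] [InnerProductSpace ℝ E] [FiniteDimensional ℝ E]
  [MeasurableSpace E] [BorelSpace E] {Ω : Set E}

/-- The divergence of a compactly supported field in the interior integrates to zero. -/
theorem integral_divergence_of_tsupport_subset_interior {X : E → E} (hX : ContDiffOn ℝ 1 X Ω)
    (hXc : HasCompactSupport X) (hXi : tsupport X ⊆ interior Ω) :
    ∫ x in Ω, divergence X x = 0 := by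
  have hXC : ContDiff ℝ 1 X := by
    rw [contDiff_iff_contDiffAt]
    intro x
    by_cases hx : x ∈ tsupport X
    · exact hX.contDiffAt (mem_interior_iff_mem_nhds.1 (hXi hx))
    · have : X =ᶠ[𝓝 x] fun _ => 0 := by
        filter_upwards [(isClosed_tsupport X).isOpen_compl.mem_nhds hx] with z hz
        exact image_eq_zero_of_notMem_tsupport hz
      exact contDiffAt_const.congr_of_eventuallyEq this
  have h0 : ∀ x, x ∉ Ω → divergence X x = 0 := fun x hx => by
    rw [divergence, fderiv_of_notMem_tsupport (𝕜 := ℝ) fun h => hx (interior_subset (hXi h))]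
    simp
  rw [setIntegral_eq_integral_of_forall_compl_eq_zero h0]
  set b := stdOrthonormalBasis ℝ E
  have hb : ∀ i x, HasFDerivAt (fun x => inner ℝ (b i) (X x))
      ((innerSL ℝ (b i)) ∘L fderiv ℝ X x) x := fun i x =>
    (innerSL ℝ (b i)).hasFDerivAt.comp x (hXC.differentiable (by norm_num) x).hasFDerivAt
  have hC : ∀ i, ContDiff ℝ 1 (fun x => inner ℝ (b i) (X x)) := fun i => contDiff_const.inner ℝ hXC
  have hcs : ∀ i, HasCompactSupport (fun x => inner ℝ (b i) (X x)) := fun i =>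
    hXc.comp_left (g := fun z => inner ℝ (b i) z) (by simp)
  have h1 : ∀ x, divergence X x = ∑ i, fderiv ℝ (fun x => inner ℝ (b i) (X x)) x (b i) := fun x => by
    rw [divergence, LinearMap.trace_eq_sum_inner _ b]
    exact Finset.sum_congr rfl fun i _ => by rw [(hb i x).fderiv]; rfl
  simp only [h1]
  rw [integral_finsetSum]
  · exact Finset.sum_eq_zero fun i _ => integral_fderiv_apply_eq_zero (hC i) (hcs i) _
  · intro i _
    refine Continuous.integrable_of_hasCompactSupport ?_ ((hcs i).fderiv_apply (𝕜 := ℝ) _)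
    exact ((hC i).continuous_fderiv (by norm_num)).clm_apply continuous_const

/-- On the interior the divergence is the restriction of a continuous function on `Ω`. At boundary
points `divergence` has no meaning, as the field is differentiable only within `Ω`. -/
theorem integrableOn_divergence {X : E → E} (hU : UniqueDiffOn ℝ Ω) (hΩ : IsCompact Ω)
    (hX : ContDiffOn ℝ 1 X Ω) : IntegrableOn (divergence X) (interior Ω) := by
  have h1 : ContinuousOn (fderivWithin ℝ X Ω) Ω := hX.continuousOn_fderivWithin hU le_rfl
  have h2 : ContinuousOn (fun x => LinearMap.trace ℝ E (fderivWithin ℝ X Ω x).toLinearMap) Ω := by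
    have : Continuous fun T : E →L[ℝ] E => LinearMap.trace ℝ E T.toLinearMap :=
      LinearMap.continuous_of_finiteDimensional
        ((LinearMap.trace ℝ E) ∘ₗ (ContinuousLinearMap.coeLM ℝ : (E →L[ℝ] E) →ₗ[ℝ] E →ₗ[ℝ] E))
    exact this.comp_continuousOn h1
  refine ((h2.integrableOn_compact hΩ).mono_set interior_subset).congr_fun (fun x hx => ?_)
    isOpen_interior.measurableSet
  simp only [divergence]
  rw [fderivWithin_of_mem_nhds (mem_interior_iff_mem_nhds.1 hx)]

theorem IsGraphChart.volume_eq_zero {v : E} {f : E → ℝ} {V : Set E} (hc : IsGraphChart Ω v f V) :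
    volume {x | f x = 0} = 0 := by
  have hfc : Continuous f := hc.contDiff.continuous
  rw [← hc.measurePreserving_flowHomeomorph.measure_preimage
    (isClosed_eq hfc continuous_const).measurableSet.nullMeasurableSet]
  have h2 : (hc.flowHomeomorph ⁻¹' {x | f x = 0} : Set ((ℝ ∙ v)ᗮ × ℝ)) = Set.univ ×ˢ {0} := by
    ext p; simp [hc.apply_flowHomeomorph]
  rw [h2, Measure.volume_eq_prod, Measure.prod_prod]
  simp

end Divergence

section Domain

variable {n : ℕ} {Ω U : Set (Eu n)} {G : Eu n → Matrix (Fin n) (Fin n) ℝ}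

theorem IsSmoothCompactDomain.volume_frontier (hΩ : IsSmoothCompactDomain Ω) :
    volume (frontier Ω) = 0 := by
  refine measure_null_of_locally_null _ fun x hx => ?_
  obtain ⟨v, f, V, hc, hxV⟩ := hΩ.exists_isGraphChart hx
  refine ⟨frontier Ω ∩ V, Filter.inter_mem self_mem_nhdsWithin
    (mem_nhdsWithin_of_mem_nhds (hc.isOpen.mem_nhds hxV)), ?_⟩
  exact measure_mono_null (fun y hy => (hc.mem_frontier_iff hy.2).1 hy.1) hc.volume_eq_zero

/-- The boundary is a null set, so that values at boundary points do not matter. -/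
theorem IsSmoothCompactDomain.setIntegral_eq_interior (hΩ : IsSmoothCompactDomain Ω)
    (g : Eu n → ℝ) : ∫ x in Ω, g x = ∫ x in interior Ω, g x := by
  refine setIntegral_congr_set ?_
  have h : Ω \ interior Ω ⊆ frontier Ω := fun x hx => ⟨subset_closure hx.1, hx.2⟩
  have h0 := measure_mono_null h hΩ.volume_frontier
  exact (ae_eq_set.2 ⟨h0, by rw [Set.sdiff_eq_empty.2 interior_subset, measure_empty]⟩)

theorem IsSmoothCompactDomain.measure_frontier_lt_top (hΩ : IsSmoothCompactDomain Ω) (hn : n ≠ 0) :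
    (μHE[n - 1] : Measure (Eu n)) (frontier Ω) < ⊤ := by
  refine hΩ.isCompact_frontier.measure_lt_top_of_nhdsWithin fun x hx => ?_
  obtain ⟨v, f, V, hc, hxV⟩ := hΩ.exists_isGraphChart hx
  obtain ⟨r, hr, hrV⟩ := Metric.nhds_basis_closedBall.mem_iff.1 (hc.isOpen.mem_nhds hxV)
  refine ⟨frontier Ω ∩ Metric.closedBall x r, Filter.inter_mem self_mem_nhdsWithin
    (mem_nhdsWithin_of_mem_nhds (Metric.closedBall_mem_nhds x hr)), ?_⟩
  refine (measure_mono fun y hy => ?_).trans_lt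
    (hc.measure_inter_lt_top (d := n - 1) (by simp; omega) (isCompact_closedBall x r))
  exact ⟨hy.2, (hc.mem_frontier_iff (hrV hy.2)).1 hy.1⟩

theorem IsSmoothCompactDomain.integrableOn_frontier (hΩ : IsSmoothCompactDomain Ω) (hn : n ≠ 0)
    {F : Type*} [NormedAddCommGroup F] {g : Eu n → F}
    (hg : ContinuousOn g (frontier Ω)) : IntegrableOn g (frontier Ω) (μHE[n - 1]) := by
  have hfin : IsFiniteMeasure ((μHE[n - 1] : Measure (Eu n)).restrict (frontier Ω)) :=
    ⟨by rw [Measure.restrict_apply_univ]; exact hΩ.measure_frontier_lt_top hn⟩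
  obtain ⟨C, hC⟩ := hΩ.isCompact_frontier.exists_bound_of_continuousOn hg
  refine Integrable.mono' (g := fun _ => C) (integrable_const C) ?_ ?_
  · exact hg.aestronglyMeasurable_of_isCompact hΩ.isCompact_frontier
      isClosed_frontier.measurableSet
  · exact (ae_restrict_iff' isClosed_frontier.measurableSet).2 (Eventually.of_forall hC)

/-- The **divergence theorem** on a compact domain with smooth boundary, for the Riemannian volume
and surface measures. The divergence is that of the weighted field `√(det G) X`. -/
theorem IsSmoothCompactDomain.integral_divergence (hΩ : IsSmoothCompactDomain Ω) (hn : n ≠ 0)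
    (hU : IsOpen U) (hΩU : Ω ⊆ U) (hG : IsRiemannianMetricOn G U) {X : Eu n → Eu n}
    (hX : ContDiffOn ℝ 1 X Ω) :
    ∫ x in Ω, divergence (fun x => √(G x).det • X x) x =
      surfaceIntegral G (frontier Ω) fun x => metricInner G x (X x) (outwardNormal G Ω x) := by
  classical
  have hud := hΩ.uniqueDiffOn
  set Y : Eu n → Eu n := fun x => √(G x).det • X x with hYdef
  have hY : ContDiffOn ℝ 1 Y Ω :=
    (((contDiffOn_sqrt_det hG).mono hΩU).of_le ENat.LEInfty.out).smul hX
  set q : Eu n → ℝ := fun x => surfaceDensity G (frontier Ω) x *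
    metricInner G x (X x) (outwardNormal G Ω x) with hq
  have hqc : ContinuousOn q (frontier Ω) := by
    have h1 := continuousOn_surfaceDensity hΩ hU hΩU hG
    have h2 := continuousOn_outwardNormal hΩ hU hΩU hG
    refine h1.mul ?_
    simp only [metricInner]
    refine continuousOn_finsetSum _ fun i _ => continuousOn_finsetSum _ fun j _ => ?_
    have h3 : ContinuousOn (fun x => G x i j) (frontier Ω) :=
      (hG.1 i j).continuousOn.mono (hΩ.frontier_subset.trans hΩU)
    have h4 : ContinuousOn X (frontier Ω) := hX.continuousOn.mono hΩ.frontier_subset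
    have h5 : ∀ k, Continuous fun u : Eu n => u k := fun k => by fun_prop
    exact (h3.mul ((h5 i).comp_continuousOn h4)).mul ((h5 j).comp_continuousOn h2)
  -- each point has a neighbourhood on which the localized statement holds
  have hloc : ∀ x ∈ Ω, ∃ V : Set (Eu n), IsOpen V ∧ x ∈ V ∧ ∀ φ : Eu n → ℝ, ContDiff ℝ ∞ φ →
      HasCompactSupport φ → tsupport φ ⊆ V →
      ∫ x in Ω, divergence (fun x => φ x • Y x) x =
        ∫ x in frontier Ω, φ x * q x ∂(μHE[n - 1] : Measure (Eu n)) := by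
    intro x hx
    have hφY : ∀ φ : Eu n → ℝ, ContDiff ℝ ∞ φ → ContDiffOn ℝ 1 (fun x => φ x • Y x) Ω :=
      fun φ hφ => ((hφ.of_le ENat.LEInfty.out).contDiffOn).smul hY
    by_cases hxi : x ∈ interior Ω
    · refine ⟨interior Ω, isOpen_interior, hxi, fun φ hφ hφc hφs => ?_⟩
      rw [integral_divergence_of_tsupport_subset_interior (hφY φ hφ) hφc.smul_right
        ((tsupport_smul_subset_left φ Y).trans hφs)]
      symm
      refine setIntegral_eq_zero_of_forall_eq_zero fun y hy => ?_
      rw [image_eq_zero_of_notMem_tsupport fun h => hy.2 (hφs h), zero_mul]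
    · have hxf : x ∈ frontier Ω := ⟨subset_closure hx, hxi⟩
      obtain ⟨v, f, V, hc, hxV⟩ := hΩ.exists_isGraphChart hxf
      refine ⟨V, hc.isOpen, hxV, fun φ hφ hφc hφs => ?_⟩
      rw [hc.integral_divergence (hφY φ hφ) ((tsupport_smul_subset_left φ Y).trans hφs) hud
        hΩ.1.isClosed hφc.smul_right (d := n - 1) (by simp; omega)]
      refine setIntegral_congr_fun isClosed_frontier.measurableSet fun y hy => ?_
      by_cases hyV : y ∈ V
      · have hfy := (hc.mem_frontier_iff hyV).1 hy
        have := hc.surfaceDensity_mul_metricInner hyV hfy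
          (hG.2 y (hΩU (hΩ.frontier_subset hy))) (X y)
        simp only [hq, this, hYdef, map_smul, smul_eq_mul]
        ring
      · simp [image_eq_zero_of_notMem_tsupport fun h => hyV (hφs h)]
  choose! V hVo hxV hV using hloc
  obtain ⟨t, φ, hφ, hφ1⟩ := exists_smooth_partition hΩ.1 V fun x hx => ⟨hVo x hx, hxV x hx⟩
  have hφY : ∀ z ∈ t, ContDiffOn ℝ 1 (fun x => φ z x • Y x) Ω :=
    fun z hz => (((hφ z hz).2.1.of_le ENat.LEInfty.out).contDiffOn).smul hY
  have hL : ∫ x in Ω, divergence Y x = ∑ z ∈ t, ∫ x in Ω, divergence (fun x => φ z x • Y x) x := by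
    rw [hΩ.setIntegral_eq_interior]
    simp only [hΩ.setIntegral_eq_interior]
    rw [← integral_finsetSum _ fun z hz => integrableOn_divergence hud hΩ.1 (hφY z hz)]
    refine setIntegral_congr_fun isOpen_interior.measurableSet fun x hx => ?_
    have hxn := mem_interior_iff_mem_nhds.1 hx
    have h1 : Y =ᶠ[𝓝 x] fun x => ∑ z ∈ t, φ z x • Y x := by
      filter_upwards [hxn] with y hy
      rw [← Finset.sum_smul, hφ1 y hy, one_smul]
    simp only [divergence]
    rw [h1.fderiv_eq, fderiv_fun_sum fun z hz =>
      ((hφY z hz).contDiffAt hxn).differentiableAt (by norm_num)]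
    simp
  have hR : surfaceIntegral G (frontier Ω) (fun x => metricInner G x (X x) (outwardNormal G Ω x)) =
      ∑ z ∈ t, ∫ x in frontier Ω, φ z x * q x ∂(μHE[n - 1] : Measure (Eu n)) := by
    rw [← integral_finsetSum _ fun z hz => ?_]
    · refine setIntegral_congr_fun isClosed_frontier.measurableSet fun x hx => ?_
      simp only [← Finset.sum_mul, hφ1 x (hΩ.frontier_subset hx), one_mul]
      rfl
    · exact hΩ.integrableOn_frontier hn ((hφ z hz).2.1.continuous.continuousOn.mul hqc)
  rw [hL, hR]
  exact Finset.sum_congr rfl fun z hz => hV z (hφ z hz).1 _ (hφ z hz).2.1 (hφ z hz).2.2.1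
    (hφ z hz).2.2.2

end Domain

/-! ### Clifford algebra identities -/

section Clifford

variable {n : ℕ} {𝒜 : Type*} [Ring 𝒜] [Algebra ℝ 𝒜] {γ : Fin n → 𝒜}

/-- Cyclic rotation of three summation indices. -/
theorem sum_rotate {M : Type*} [AddCommMonoid M] (F : Fin n → Fin n → Fin n → M) :
    ∑ p, ∑ q, ∑ a, F q a p = ∑ p, ∑ q, ∑ a, F p q a := by
  rw [Finset.sum_comm]
  refine Finset.sum_congr rfl fun q _ => ?_
  rw [Finset.sum_comm]

/-- The Clifford relations for the negative definite form. -/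
def IsClifford (γ : Fin n → 𝒜) : Prop :=
  ∀ a b, γ a * γ b + γ b * γ a = -((if a = b then (2 : ℝ) else 0) • 1)

theorem IsClifford.swap (hγ : IsClifford γ) (a b : Fin n) :
    γ a * γ b = -(γ b * γ a) - (if a = b then (2 : ℝ) else 0) • 1 := by
  have := hγ a b
  rw [sub_eq_add_neg, ← this]; abel

/-- Moving the first of three generators to the end. -/
theorem IsClifford.triple (hγ : IsClifford γ) (a p q : Fin n) :
    γ a * γ p * γ q = γ p * γ q * γ a + (if a = q then (2 : ℝ) else 0) • γ p -
      (if a = p then (2 : ℝ) else 0) • γ q := by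
  rw [hγ.swap a p, sub_mul, neg_mul, mul_assoc, hγ.swap a q, mul_sub, mul_neg]
  simp only [smul_mul_assoc, mul_smul_comm, one_mul, mul_one, mul_assoc]
  abel

/-- The commutator of the spin representation of an infinitesimal rotation with a Clifford
generator. -/
theorem IsClifford.commutator (hγ : IsClifford γ) {θ : Fin n → Fin n → ℝ}
    (hθ : ∀ a c, θ a c = -θ c a) (c : Fin n) :
    ((1 / 4 : ℝ) • ∑ j, ∑ k, θ j k • (γ j * γ k)) * γ c -
      γ c * ((1 / 4 : ℝ) • ∑ j, ∑ k, θ j k • (γ j * γ k)) = ∑ k, θ c k • γ k := by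
  have h1 : (∑ j, ∑ k, θ j k • (γ j * γ k)) * γ c - γ c * ∑ j, ∑ k, θ j k • (γ j * γ k) =
      ∑ j, ∑ k, θ j k • ((if c = j then (2 : ℝ) else 0) • γ k -
        (if c = k then (2 : ℝ) else 0) • γ j) := by
    simp only [Finset.sum_mul, Finset.mul_sum, ← Finset.sum_sub_distrib]
    refine Finset.sum_congr rfl fun j _ => Finset.sum_congr rfl fun k _ => ?_
    rw [smul_mul_assoc, mul_smul_comm, ← smul_sub]
    congr 1
    have := hγ.triple c j k
    rw [← mul_assoc, this]
    abel
  have h2 : ∑ j, ∑ k, θ j k • ((if c = j then (2 : ℝ) else 0) • γ k -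
        (if c = k then (2 : ℝ) else 0) • γ j) = (4 : ℝ) • ∑ k, θ c k • γ k := by
    have e1 : ∑ j, ∑ k, θ j k • ((if c = j then (2 : ℝ) else 0) • γ k) =
        ∑ k, (θ c k * 2) • γ k := by
      rw [Finset.sum_comm]
      refine Finset.sum_congr rfl fun k _ => ?_
      simp [ite_smul, smul_ite, smul_smul]
    have e2 : ∑ j, ∑ k, θ j k • ((if c = k then (2 : ℝ) else 0) • γ j) =
        ∑ k, (θ k c * 2) • γ k := by
      refine Finset.sum_congr rfl fun k _ => ?_
      simp [ite_smul, smul_ite, smul_smul]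
    simp only [smul_sub, Finset.sum_sub_distrib]
    rw [e1, e2, ← Finset.sum_sub_distrib, Finset.smul_sum]
    refine Finset.sum_congr rfl fun k _ => ?_
    rw [hθ k c, ← sub_smul, smul_smul]
    congr 1; ring
  rw [smul_mul_assoc, mul_smul_comm, ← smul_sub, h1, h2, smul_smul]
  norm_num

/-- The commutator of the spin representations of two infinitesimal rotations. -/
theorem IsClifford.commutator_commutator (hγ : IsClifford γ) {θ η : Fin n → Fin n → ℝ}
    (hθ : ∀ a c, θ a c = -θ c a) :
    ((1 / 4 : ℝ) • ∑ j, ∑ k, θ j k • (γ j * γ k)) * ((1 / 4 : ℝ) • ∑ j, ∑ k, η j k • (γ j * γ k)) -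
      ((1 / 4 : ℝ) • ∑ j, ∑ k, η j k • (γ j * γ k)) *
        ((1 / 4 : ℝ) • ∑ j, ∑ k, θ j k • (γ j * γ k)) =
      (1 / 4 : ℝ) • ∑ a, ∑ c, (-∑ d, (θ a d * η d c - η a d * θ d c)) • (γ a * γ c) := by
  set A := (1 / 4 : ℝ) • ∑ j, ∑ k, θ j k • (γ j * γ k) with hA
  have hc := hγ.commutator hθ
  rw [← hA] at hc
  clear_value A
  rw [mul_smul_comm, smul_mul_assoc, ← smul_sub]
  congr 1
  simp only [Finset.sum_mul, Finset.mul_sum, ← Finset.sum_sub_distrib]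
  have h1 : ∀ j k, A * (η j k • (γ j * γ k)) - η j k • (γ j * γ k) * A =
      ∑ m, (η j k * θ j m) • (γ m * γ k) + ∑ m, (η j k * θ k m) • (γ j * γ m) := by
    intro j k
    -- the commutator with `A` is a derivation
    have h2 : A * (γ j * γ k) - γ j * γ k * A = (A * γ j - γ j * A) * γ k + γ j * (A * γ k - γ k * A) := by
      noncomm_ring
    rw [mul_smul_comm, smul_mul_assoc, ← smul_sub, h2, hc, hc, smul_add, Finset.sum_mul,
      Finset.mul_sum, Finset.smul_sum, Finset.smul_sum]
    simp only [smul_mul_assoc, mul_smul_comm, smul_smul]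
  simp only [h1, Finset.sum_add_distrib]
  have h3 : ∑ j, ∑ k, ∑ m, (η j k * θ j m) • (γ m * γ k) =
      ∑ a, ∑ c, (∑ d, η d c * θ d a) • (γ a * γ c) := by
    simp only [Finset.sum_smul]
    rw [← sum_rotate]
    refine Finset.sum_congr rfl fun a _ => ?_
    rw [Finset.sum_comm]
  have h4 : ∑ j, ∑ k, ∑ m, (η j k * θ k m) • (γ j * γ m) =
      ∑ a, ∑ c, (∑ d, η a d * θ d c) • (γ a * γ c) := by
    simp only [Finset.sum_smul]
    refine Finset.sum_congr rfl fun a _ => ?_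
    rw [Finset.sum_comm]
  rw [h3, h4]
  simp only [← Finset.sum_add_distrib, ← add_smul]
  refine Finset.sum_congr rfl fun a _ => Finset.sum_congr rfl fun c _ => ?_
  congr 1
  rw [← Finset.sum_neg_distrib]
  refine Finset.sum_congr rfl fun d _ => ?_
  rw [hθ d a]; ring

/-- Contraction of a curvature tensor with three Clifford generators: by the Bianchi identity only
the Ricci contraction survives. Rotating the indices cyclically in `V = ∑ R_{pqa} γ_p γ_q γ_a`
produces multiples of `W = ∑ R_{pqq} γ_p`, and the sum of the three rotations vanishes. -/
theorem IsClifford.bianchi_contract (hγ : IsClifford γ) {R : Fin n → Fin n → Fin n → ℝ}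
    (hanti : ∀ p q a, R p q a = -R q p a) (hB : ∀ p q a, R p q a + R q a p + R a p q = 0) :
    ∑ p, ∑ q, ∑ a, R p q a • (γ p * γ q * γ a) = -((2 : ℝ) • ∑ p, (∑ q, R p q q) • γ p) := by
  set V := ∑ p, ∑ q, ∑ a, R p q a • (γ p * γ q * γ a) with hV
  set W := ∑ p, (∑ q, R p q q) • γ p with hW
  have hW' : ∑ p, ∑ q, R p q q • γ p = W := by simp only [hW, Finset.sum_smul]
  have hW'' : ∑ p, ∑ q, R p q p • γ q = -W := by
    rw [← hW', ← Finset.sum_neg_distrib, Finset.sum_comm]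
    refine Finset.sum_congr rfl fun p _ => ?_
    rw [← Finset.sum_neg_distrib]
    refine Finset.sum_congr rfl fun q _ => ?_
    rw [hanti q p q, neg_smul]
  have hdiag : ∀ p a, R p p a = 0 := fun p a => by have := hanti p p a; linarith
  have h0 : ∑ p, ∑ q, ∑ a, (R p q a + R q a p + R a p q) • (γ p * γ q * γ a) = 0 := by
    simp [hB]
  have h1 : ∑ p, ∑ q, ∑ a, R q a p • (γ p * γ q * γ a) = V + (4 : ℝ) • W := by
    rw [sum_rotate fun x y z => R x y z • (γ z * γ x * γ y)]
    have e1 : ∑ p, ∑ q, ∑ a, R p q a • ((if a = q then (2 : ℝ) else 0) • γ p) = (2 : ℝ) • W := by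
      rw [← hW', Finset.smul_sum]
      refine Finset.sum_congr rfl fun p _ => ?_
      rw [Finset.smul_sum]
      refine Finset.sum_congr rfl fun q _ => ?_
      simp [ite_smul, smul_ite, smul_smul, mul_comm]
    have e2 : ∑ p, ∑ q, ∑ a, R p q a • ((if a = p then (2 : ℝ) else 0) • γ q) =
        -((2 : ℝ) • W) := by
      rw [← smul_neg, ← hW'', Finset.smul_sum]
      refine Finset.sum_congr rfl fun p _ => ?_
      rw [Finset.smul_sum]
      refine Finset.sum_congr rfl fun q _ => ?_
      simp [ite_smul, smul_ite, smul_smul, mul_comm]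
    have e3 : ∀ p q a, R p q a • (γ a * γ p * γ q) = R p q a • (γ p * γ q * γ a) +
        R p q a • ((if a = q then (2 : ℝ) else 0) • γ p) -
        R p q a • ((if a = p then (2 : ℝ) else 0) • γ q) := by
      intro p q a
      rw [hγ.triple, smul_sub, smul_add]
    simp only [e3, Finset.sum_sub_distrib, Finset.sum_add_distrib]
    rw [← hV, e1, e2]
    module
  have h2 : ∑ p, ∑ q, ∑ a, R a p q • (γ p * γ q * γ a) = V + (2 : ℝ) • W := by
    rw [← sum_rotate fun x y z => R z x y • (γ x * γ y * γ z)]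
    have e2 : ∑ p, ∑ q, ∑ a, R p q a • ((if p = a then (2 : ℝ) else 0) • γ q) =
        -((2 : ℝ) • W) := by
      rw [← smul_neg, ← hW'', Finset.smul_sum]
      refine Finset.sum_congr rfl fun p _ => ?_
      rw [Finset.smul_sum]
      refine Finset.sum_congr rfl fun q _ => ?_
      simp [ite_smul, smul_ite, smul_smul, mul_comm]
    have e3 : ∀ p q a, R p q a • (γ q * γ a * γ p) = R p q a • (γ p * γ q * γ a) -
        R p q a • ((if p = a then (2 : ℝ) else 0) • γ q) := by
      intro p q a
      rw [hγ.triple p q a, smul_sub, smul_add]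
      by_cases h : p = q
      · subst h; simp [hdiag]
      · simp [h]
    simp only [e3, Finset.sum_sub_distrib]
    rw [← hV, e2]
    module
  have h3 : (3 : ℝ) • V + (6 : ℝ) • W = 0 := by
    rw [← h0]
    simp only [add_smul, Finset.sum_add_distrib]
    rw [h1, h2, ← hV]
    module
  have h4 : V + (2 : ℝ) • W = (1 / 3 : ℝ) • ((3 : ℝ) • V + (6 : ℝ) • W) := by module
  rw [h3, smul_zero] at h4
  exact eq_neg_of_add_eq_zero_left h4

end Clifford

/-! ### The Levi-Civita connection -/

section OrthonormalFamily

variable {n : ℕ} {G : Eu n → Matrix (Fin n) (Fin n) ℝ} {x : Eu n}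
variable {ι : Type*} [Fintype ι] [DecidableEq ι] {e : ι → Eu n}

theorem linearIndependent_of_metricInner
    (he : ∀ a c, metricInner G x (e a) (e c) = if a = c then 1 else 0) :
    LinearIndependent ℝ e := by
  rw [Fintype.linearIndependent_iff]
  intro g hg i
  have h := congrArg (fun u => metricInner G x u (e i)) hg
  simpa [metricInner_sum_left, metricInner_smul_left, he, metricInner_zero_left] using h

/-- A `g_x`-orthonormal family of `n` vectors, as a basis. -/
def metricBasis (hι : Fintype.card ι = n)
    (he : ∀ a c, metricInner G x (e a) (e c) = if a = c then 1 else 0) :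
    Module.Basis ι ℝ (Eu n) :=
  Module.Basis.mk (linearIndependent_of_metricInner he) (by
    rw [(linearIndependent_of_metricInner he).span_eq_top_of_card_eq_finrank' (by simp [hι])])

theorem sum_metricInner_smul (hι : Fintype.card ι = n)
    (he : ∀ a c, metricInner G x (e a) (e c) = if a = c then 1 else 0) (v : Eu n) :
    ∑ a, metricInner G x v (e a) • e a = v := by
  have h := (metricBasis hι he).sum_repr v
  simp only [metricBasis, Module.Basis.mk_apply] at h
  have h2 : ∀ c, metricInner G x v (e c) = (metricBasis hι he).repr v c := by
    intro c
    conv_lhs => rw [← h]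
    simp [metricInner_sum_left, metricInner_smul_left, he, metricBasis]
  simp only [h2]
  exact h

theorem trace_eq_sum_metricInner (hι : Fintype.card ι = n)
    (he : ∀ a c, metricInner G x (e a) (e c) = if a = c then 1 else 0)
    (L : Eu n →ₗ[ℝ] Eu n) :
    LinearMap.trace ℝ (Eu n) L = ∑ a, metricInner G x (L (e a)) (e a) := by
  rw [LinearMap.trace_eq_matrix_trace ℝ (metricBasis hι he), Matrix.trace]
  refine Finset.sum_congr rfl fun a _ => ?_
  rw [Matrix.diag_apply, LinearMap.toMatrix_apply]
  have h := (metricBasis hι he).sum_repr (L (e a))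
  conv_rhs => rw [← h]
  simp [metricInner_sum_left, metricInner_smul_left, he, metricBasis]

theorem metricInner_eq_sum_mul (hι : Fintype.card ι = n)
    (he : ∀ a c, metricInner G x (e a) (e c) = if a = c then 1 else 0)
    (u v : Eu n) :
    metricInner G x u v = ∑ a, metricInner G x u (e a) * metricInner G x v (e a) := by
  conv_lhs => rw [← sum_metricInner_smul hι he v]
  rw [metricInner_sum_right]
  refine Finset.sum_congr rfl fun a _ => ?_
  rw [metricInner_smul_right, mul_comm]

/-- The inverse of the metric in terms of an orthonormal basis. -/
theorem sum_mul_eq_inv (hι : Fintype.card ι = n)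
    (he : ∀ a c, metricInner G x (e a) (e c) = if a = c then 1 else 0) (hG : (G x).PosDef)
    (j k : Fin n) : ∑ a, e a j * e a k = (G x)⁻¹ j k := by
  have h : (Matrix.of fun j k => ∑ a, e a j * e a k) * G x = 1 := by
    ext i l
    have h1 := congrArg (fun u : Eu n => u i) (sum_metricInner_smul hι he (stdVec l))
    simp only [WithLp.ofLp_sum, WithLp.ofLp_smul, Finset.sum_apply, Pi.smul_apply,
      smul_eq_mul] at h1
    have h2 : ∀ a, metricInner G x (stdVec l) (e a) = ∑ k, G x l k * e a k := by
      intro a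
      simp only [metricInner, stdVec]
      rw [Finset.sum_eq_single l]
      · simp
      · intro b _ hb; simp [hb]
      · simp
    have hs : ∀ i j, G x i j = G x j i := fun i j => by
      have := hG.isHermitian.apply i j
      simpa using this.symm
    rw [Matrix.mul_apply]
    simp only [Matrix.of_apply, Finset.sum_mul]
    rw [Finset.sum_comm]
    have h3 : (1 : Matrix (Fin n) (Fin n) ℝ) i l = (stdVec l : Eu n) i := by
      simp [stdVec, Matrix.one_apply]
    rw [h3, ← h1]
    refine Finset.sum_congr rfl fun a _ => ?_
    rw [h2, Finset.sum_mul]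
    refine Finset.sum_congr rfl fun k _ => ?_
    rw [hs k l]; ring
  rw [Matrix.inv_eq_left_inv h, Matrix.of_apply]

end OrthonormalFamily

section Det

variable {E : Type*} [NormedAddCommGroup E] [NormedSpace ℝ E]

/-- Jacobi's formula for the derivative of a determinant. -/
theorem hasFDerivAt_det {ι : Type*} [Fintype ι] [DecidableEq ι] {M : E → Matrix ι ι ℝ}
    {M' : ι → ι → E →L[ℝ] ℝ} {x : E} (hM : ∀ i j, HasFDerivAt (fun y => M y i j) (M' i j) x) :
    HasFDerivAt (fun y => (M y).det) (∑ i, ∑ j, (M x).adjugate j i • M' i j) x := by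
  let D : ContinuousMultilinearMap ℝ (fun _ : ι => ι → ℝ) ℝ :=
    ⟨(Matrix.detRowAlternating (n := ι) (R := ℝ)).toMultilinearMap,
      (continuous_id.matrix_det : Continuous fun A : Matrix ι ι ℝ => A.det)⟩
  have h1 : HasFDerivAt (fun y => (fun i j => M y i j : ι → ι → ℝ))
      (ContinuousLinearMap.pi fun i => ContinuousLinearMap.pi fun j => M' i j) x :=
    hasFDerivAt_pi.2 fun i => hasFDerivAt_pi.2 fun j => hM i j
  have h2 := (D.hasFDerivAt (x := (fun i j => M x i j : ι → ι → ℝ))).comp x h1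
  refine h2.congr_fderiv ?_
  ext v
  simp only [ContinuousLinearMap.comp_apply, ContinuousMultilinearMap.linearDeriv_apply,
    sum_apply, smul_apply, smul_eq_mul]
  refine Finset.sum_congr rfl fun i _ => ?_
  have h3 : D (Function.update (fun i j => M x i j) i fun j => M' i j v) =
      ((M x).updateRow i fun j => M' i j v).det := rfl
  have h4 := Matrix.cramer_transpose_apply (M x) (fun j => M' i j v) i
  rw [Matrix.cramer_eq_adjugate_mulVec, ← Matrix.adjugate_transpose] at h4
  exact h3.trans (h4.symm.trans (by simp [Matrix.mulVec, dotProduct]))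

end Det

section LeviCivita

variable {n : ℕ} {G : Eu n → Matrix (Fin n) (Fin n) ℝ} {U : Set (Eu n)} {x : Eu n}

theorem IsRiemannianMetricOn.symm (hG : IsRiemannianMetricOn G U) (hx : x ∈ U) (i j : Fin n) :
    G x i j = G x j i := by
  have := (hG.2 x hx).isHermitian.apply i j
  simpa using this.symm

theorem IsRiemannianMetricOn.differentiableAt (hG : IsRiemannianMetricOn G U) (hU : IsOpen U)
    (hx : x ∈ U) (i j : Fin n) : DifferentiableAt ℝ (fun y => G y i j) x :=
  ((hG.1 i j).contDiffAt (hU.mem_nhds hx)).differentiableAt (by simp)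

theorem IsRiemannianMetricOn.fderiv_symm (hG : IsRiemannianMetricOn G U) (hU : IsOpen U)
    (hx : x ∈ U) (i j : Fin n) :
    fderiv ℝ (fun y => G y i j) x = fderiv ℝ (fun y => G y j i) x := by
  refine Filter.EventuallyEq.fderiv_eq ?_
  filter_upwards [hU.mem_nhds hx] with y hy using hG.symm hy i j

theorem IsRiemannianMetricOn.partialDeriv_symm (hG : IsRiemannianMetricOn G U) (hU : IsOpen U)
    (hx : x ∈ U) (l i j : Fin n) :
    partialDeriv l (fun y => G y i j) x = partialDeriv l (fun y => G y j i) x := by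
  rw [partialDeriv, partialDeriv, hG.fderiv_symm hU hx]

/-- The Levi-Civita connection is torsion free. -/
theorem christoffel_comm (hG : IsRiemannianMetricOn G U) (hU : IsOpen U) (hx : x ∈ U)
    (k i j : Fin n) : christoffel G k i j x = christoffel G k j i x := by
  rw [christoffel, christoffel]
  congr 1
  refine Finset.sum_congr rfl fun l _ => ?_
  rw [hG.partialDeriv_symm hU hx l i j]
  ring

/-- Lowering the upper index of the Christoffel symbols. -/
theorem sum_mul_christoffel (hG : IsRiemannianMetricOn G U) (hx : x ∈ U) (i j k : Fin n) :
    ∑ m, G x k m * christoffel G m i j x =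
      (1 / 2) * (partialDeriv i (fun y => G y j k) x + partialDeriv j (fun y => G y i k) x
        - partialDeriv k (fun y => G y i j) x) := by
  obtain ⟨F, hF⟩ : ∃ F : Fin n → ℝ, ∀ l, partialDeriv i (fun y => G y j l) x +
    partialDeriv j (fun y => G y i l) x - partialDeriv l (fun y => G y i j) x = F l :=
    ⟨_, fun _ => rfl⟩
  have h1 : G x * (G x)⁻¹ = 1 := Matrix.mul_nonsing_inv _ (hG.2 x hx).det_pos.ne'.isUnit
  have h2 : (G x).mulVec ((G x)⁻¹.mulVec F) k = F k := by
    rw [Matrix.mulVec_mulVec, h1, Matrix.one_mulVec]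
  rw [hF, ← h2, Matrix.mulVec, dotProduct, Finset.mul_sum]
  refine Finset.sum_congr rfl fun m _ => ?_
  rw [christoffel, Matrix.mulVec, dotProduct]
  simp only [hF]
  ring

/-- The Christoffel symbols at `x`, as a bilinear map. -/
def christoffelMap (G : Eu n → Matrix (Fin n) (Fin n) ℝ) (x : Eu n) :
    Eu n →ₗ[ℝ] Eu n →ₗ[ℝ] Eu n :=
  LinearMap.mk₂ ℝ
    (fun X Y => WithLp.toLp 2 (fun k => ∑ i, ∑ j, christoffel G k i j x * X i * Y j))
    (fun X X' Y => by
      ext k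
      simp only [PiLp.add_apply, ← Finset.sum_add_distrib]
      exact Finset.sum_congr rfl fun i _ => Finset.sum_congr rfl fun j _ => by ring)
    (fun c X Y => by
      ext k
      simp only [PiLp.smul_apply, smul_eq_mul, Finset.mul_sum]
      exact Finset.sum_congr rfl fun i _ => Finset.sum_congr rfl fun j _ => by ring)
    (fun X Y Y' => by
      ext k
      simp only [PiLp.add_apply, ← Finset.sum_add_distrib]
      exact Finset.sum_congr rfl fun i _ => Finset.sum_congr rfl fun j _ => by ring)
    (fun c X Y => by
      ext k
      simp only [PiLp.smul_apply, smul_eq_mul, Finset.mul_sum]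
      exact Finset.sum_congr rfl fun i _ => Finset.sum_congr rfl fun j _ => by ring)

theorem christoffelMap_apply (X Y : Eu n) (k : Fin n) :
    christoffelMap G x X Y k = ∑ i, ∑ j, christoffel G k i j x * X i * Y j := rfl

theorem christoffelMap_stdVec (i j k : Fin n) :
    christoffelMap G x (stdVec i) (stdVec j) k = christoffel G k i j x := by
  rw [christoffelMap_apply]
  simp [stdVec]

theorem covDeriv_eq (A : Set (Eu n)) (Y : Eu n → Eu n) (X : Eu n) :
    covDeriv G A Y x X = fderivWithin ℝ Y A x X + christoffelMap G x X (Y x) := rfl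

theorem covDeriv_univ (Y : Eu n → Eu n) (X : Eu n) :
    covDeriv G Set.univ Y x X = fderiv ℝ Y x X + christoffelMap G x X (Y x) := by
  rw [covDeriv_eq, fderivWithin_univ]

/-- The covariant derivative of a field, as a linear map. -/
def covDerivMap (G : Eu n → Matrix (Fin n) (Fin n) ℝ) (Y : Eu n → Eu n) (x : Eu n) :
    Eu n →ₗ[ℝ] Eu n :=
  (fderiv ℝ Y x).toLinearMap + (christoffelMap G x).flip (Y x)

theorem covDerivMap_apply (Y : Eu n → Eu n) (X : Eu n) :
    covDerivMap G Y x X = covDeriv G Set.univ Y x X := by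
  rw [covDeriv_univ]; rfl

theorem christoffelMap_comm (hG : IsRiemannianMetricOn G U) (hU : IsOpen U) (hx : x ∈ U)
    (X Y : Eu n) : christoffelMap G x X Y = christoffelMap G x Y X := by
  ext k
  rw [christoffelMap_apply, christoffelMap_apply, Finset.sum_comm]
  refine Finset.sum_congr rfl fun i _ => Finset.sum_congr rfl fun j _ => ?_
  rw [christoffel_comm hG hU hx]; ring

theorem covDeriv_smul {φ : Eu n → ℝ} {Y : Eu n → Eu n} (hφ : DifferentiableAt ℝ φ x)
    (hY : DifferentiableAt ℝ Y x) (X : Eu n) :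
    covDeriv G Set.univ (fun y => φ y • Y y) x X =
      fderiv ℝ φ x X • Y x + φ x • covDeriv G Set.univ Y x X := by
  rw [covDeriv_univ, covDeriv_univ, fderiv_fun_smul hφ hY, map_smul]
  simp only [add_apply, smul_apply,
    ContinuousLinearMap.smulRight_apply, smul_add]
  abel

theorem covDeriv_sum {ι : Type*} {s : Finset ι} {Y : ι → Eu n → Eu n}
    (hY : ∀ i ∈ s, DifferentiableAt ℝ (Y i) x) (X : Eu n) :
    covDeriv G Set.univ (fun y => ∑ i ∈ s, Y i y) x X =
      ∑ i ∈ s, covDeriv G Set.univ (Y i) x X := by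
  simp only [covDeriv_univ]
  rw [fderiv_fun_sum hY, map_sum, Finset.sum_add_distrib, sum_apply]

theorem metricInner_stdVec_right (u : Eu n) (j : Fin n) :
    metricInner G x u (stdVec j) = ∑ i, G x i j * u i := by
  simp [metricInner, stdVec]

/-- The coordinate form of metric compatibility. -/
theorem fderiv_metric (hG : IsRiemannianMetricOn G U) (hU : IsOpen U) (hx : x ∈ U) (X : Eu n)
    (i j : Fin n) :
    fderiv ℝ (fun y => G y i j) x X = metricInner G x (christoffelMap G x X (stdVec i)) (stdVec j)
      + metricInner G x (stdVec i) (christoffelMap G x X (stdVec j)) := by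
  have h1 : ∀ l, fderiv ℝ (fun y => G y i j) x (stdVec l) =
      metricInner G x (christoffelMap G x (stdVec l) (stdVec i)) (stdVec j)
      + metricInner G x (stdVec i) (christoffelMap G x (stdVec l) (stdVec j)) := by
    intro l
    rw [metricInner_comm (hG.2 x hx) (stdVec i), metricInner_stdVec_right,
      metricInner_stdVec_right]
    simp only [christoffelMap_stdVec]
    have e1 := sum_mul_christoffel hG hx l i j
    have e2 := sum_mul_christoffel hG hx l j i
    simp only [hG.symm hx _ j, hG.symm hx _ i]
    rw [e1, e2]
    change partialDeriv l (fun y => G y i j) x = _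
    rw [hG.partialDeriv_symm hU hx l j i, hG.partialDeriv_symm hU hx i l j,
      hG.partialDeriv_symm hU hx j l i]
    ring
  conv_lhs => rw [← sum_smul_stdVec X]
  conv_rhs => rw [← sum_smul_stdVec X]
  simp only [map_sum, map_smul, LinearMap.sum_apply, LinearMap.smul_apply, metricInner_sum_left,
    metricInner_sum_right, metricInner_smul_left, metricInner_smul_right, h1, smul_eq_mul]
  rw [← Finset.sum_add_distrib]
  exact Finset.sum_congr rfl fun i _ => by ring

/-- The Levi-Civita connection is compatible with the metric. -/
theorem hasFDerivAt_metricInner (hG : IsRiemannianMetricOn G U) (hU : IsOpen U) (hx : x ∈ U)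
    {Y Z : Eu n → Eu n} (hY : DifferentiableAt ℝ Y x) (hZ : DifferentiableAt ℝ Z x) :
    DifferentiableAt ℝ (fun y => metricInner G y (Y y) (Z y)) x ∧ ∀ X,
    fderiv ℝ (fun y => metricInner G y (Y y) (Z y)) x X =
      metricInner G x (covDeriv G Set.univ Y x X) (Z x) +
        metricInner G x (Y x) (covDeriv G Set.univ Z x X) := by
  have hYc : ∀ i, HasFDerivAt (fun y => Y y i) ((PiLp.proj 2 (fun _ : Fin n => ℝ) i).comp
      (fderiv ℝ Y x)) x := fun i =>
    ((PiLp.proj (𝕜 := ℝ) 2 (fun _ : Fin n => ℝ) i).hasFDerivAt (x := Y x)).comp x hY.hasFDerivAt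
  have hZc : ∀ i, HasFDerivAt (fun y => Z y i) ((PiLp.proj 2 (fun _ : Fin n => ℝ) i).comp
      (fderiv ℝ Z x)) x := fun i =>
    ((PiLp.proj (𝕜 := ℝ) 2 (fun _ : Fin n => ℝ) i).hasFDerivAt (x := Z x)).comp x hZ.hasFDerivAt
  have hd : HasFDerivAt (fun y => metricInner G y (Y y) (Z y)) _ x :=
    HasFDerivAt.fun_sum fun i _ => HasFDerivAt.fun_sum fun j _ =>
      (((hG.differentiableAt hU hx i j).hasFDerivAt.mul (hYc i)).mul (hZc j))
  refine ⟨hd.differentiableAt, fun X => ?_⟩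
  rw [hd.fderiv]
  -- `fderiv_metric` extended bilinearly from the basis vectors
  have hs : ∀ u v : Eu n, metricInner G x (christoffelMap G x X u) v +
      metricInner G x u (christoffelMap G x X v) =
      ∑ i, ∑ j, fderiv ℝ (fun y => G y i j) x X * u i * v j := by
    intro u v
    conv_lhs => rw [← sum_smul_stdVec u, ← sum_smul_stdVec v]
    simp only [fderiv_metric hG hU hx, map_sum, map_smul, metricInner_sum_left,
      metricInner_sum_right, metricInner_smul_left, metricInner_smul_right, Finset.mul_sum]
    rw [← Finset.sum_add_distrib]
    conv_rhs => rw [Finset.sum_comm]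
    refine Finset.sum_congr rfl fun i _ => ?_
    rw [← Finset.sum_add_distrib]
    refine Finset.sum_congr rfl fun j _ => ?_
    ring
  have h1 := hs (Y x) (Z x)
  rw [covDeriv_univ, covDeriv_univ, metricInner_add_left, metricInner_add_right]
  have h2 : metricInner G x (fderiv ℝ Y x X) (Z x) +
      metricInner G x (christoffelMap G x X (Y x)) (Z x) +
      (metricInner G x (Y x) (fderiv ℝ Z x X) +
      metricInner G x (Y x) (christoffelMap G x X (Z x))) =
      metricInner G x (fderiv ℝ Y x X) (Z x) + metricInner G x (Y x) (fderiv ℝ Z x X) +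
      ∑ i, ∑ j, fderiv ℝ (fun y => G y i j) x X * Y x i * Z x j := by
    rw [← h1]; ring
  rw [h2, metricInner, metricInner, ← Finset.sum_add_distrib, ← Finset.sum_add_distrib,
    sum_apply]
  refine Finset.sum_congr rfl fun i _ => ?_
  rw [← Finset.sum_add_distrib, ← Finset.sum_add_distrib, sum_apply]
  refine Finset.sum_congr rfl fun j _ => ?_
  simp
  ring

/-- The logarithmic derivative of the volume density is the trace of the Christoffel symbols. -/
theorem hasFDerivAt_sqrt_det (hG : IsRiemannianMetricOn G U) (hU : IsOpen U) (hx : x ∈ U) :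
    DifferentiableAt ℝ (fun y => √(G y).det) x ∧ ∀ X, fderiv ℝ (fun y => √(G y).det) x X =
      √(G x).det * LinearMap.trace ℝ (Eu n) ((christoffelMap G x).flip X) := by
  have hpos := (hG.2 x hx).det_pos
  have h1 := (hasFDerivAt_det fun i j => (hG.differentiableAt hU hx i j).hasFDerivAt).sqrt hpos.ne'
  refine ⟨h1.differentiableAt, fun X => ?_⟩
  rw [h1.fderiv]
  have hinv : ∀ i j, (G x).adjugate j i = (G x).det * (G x)⁻¹ j i := by
    intro i j
    rw [Matrix.inv_def, Ring.inverse_eq_inv', Matrix.smul_apply, smul_eq_mul,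
      mul_inv_cancel_left₀ hpos.ne']
  have hisymm : ∀ i j, (G x)⁻¹ i j = (G x)⁻¹ j i := fun i j => by
    have := (hG.2 x hx).isHermitian.inv.apply i j
    simpa using this.symm
  have htr : LinearMap.trace ℝ (Eu n) ((christoffelMap G x).flip X) =
      ∑ l, X l * ∑ k, christoffel G k k l x := by
    have hb : ∀ v : Eu n, ∀ k, (EuclideanSpace.basisFun (Fin n) ℝ).toBasis.repr v k = v k := by
      intro v k; simp
    rw [LinearMap.trace_eq_matrix_trace ℝ (EuclideanSpace.basisFun (Fin n) ℝ).toBasis,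
      Matrix.trace]
    simp only [Matrix.diag_apply, LinearMap.toMatrix_apply, hb]
    simp only [Finset.mul_sum]
    rw [Finset.sum_comm]
    refine Finset.sum_congr rfl fun k _ => ?_
    rw [LinearMap.flip_apply, christoffelMap_apply]
    simp only [OrthonormalBasis.coe_toBasis, EuclideanSpace.basisFun_apply]
    rw [Finset.sum_eq_single k]
    · exact Finset.sum_congr rfl fun l _ => by simp; ring
    · intro b _ hb; simp [hb]
    · simp
  -- in the contracted symbol two of the three derivatives of the metric cancel
  have hc : ∀ l, ∑ k, christoffel G k k l x =
      (1 / 2) * ∑ i, ∑ j, (G x)⁻¹ j i * partialDeriv l (fun y => G y i j) x := by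
    intro l
    simp only [christoffel]
    rw [← Finset.mul_sum]
    congr 1
    simp only [mul_sub, mul_add, Finset.sum_sub_distrib, Finset.sum_add_distrib]
    have e1 : ∑ k, ∑ m, (G x)⁻¹ k m * partialDeriv k (fun y => G y l m) x =
        ∑ k, ∑ m, (G x)⁻¹ k m * partialDeriv m (fun y => G y k l) x := by
      rw [Finset.sum_comm]
      refine Finset.sum_congr rfl fun i _ => Finset.sum_congr rfl fun j _ => ?_
      rw [hisymm, hG.partialDeriv_symm hU hx]
    rw [e1]
    rw [add_sub_cancel_left]
    refine Finset.sum_congr rfl fun i _ => Finset.sum_congr rfl fun j _ => ?_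
    rw [hisymm]
  have hX : ∀ i j, fderiv ℝ (fun y => G y i j) x X =
      ∑ l, X l * partialDeriv l (fun y => G y i j) x := by
    intro i j
    conv_lhs => rw [← sum_smul_stdVec X]
    simp only [map_sum, map_smul, smul_eq_mul, partialDeriv]
  rw [htr]
  simp only [smul_apply, sum_apply, smul_eq_mul, hinv, hc,
    hX]
  have hs : √(G x).det * √(G x).det = (G x).det := Real.mul_self_sqrt hpos.le
  have hs0 : √(G x).det ≠ 0 := (Real.sqrt_pos.2 hpos).ne'
  have e2 : ∑ i, ∑ j, (G x).det * (G x)⁻¹ j i * ∑ l, X l * partialDeriv l (fun y => G y i j) x =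
      (G x).det * ∑ l, X l * ∑ i, ∑ j, (G x)⁻¹ j i * partialDeriv l (fun y => G y i j) x := by
    simp only [Finset.mul_sum]
    rw [Finset.sum_comm' (t' := Finset.univ) (s' := fun _ => Finset.univ) (by simp)]
    symm
    rw [Finset.sum_comm]
    refine (Finset.sum_congr rfl fun i _ => Finset.sum_comm).trans ?_
    rw [Finset.sum_comm]
    refine Finset.sum_congr rfl fun j _ => Finset.sum_congr rfl fun i _ =>
      Finset.sum_congr rfl fun l _ => by ring
  rw [e2]
  have e3 : ∑ l, X l * ((1 / 2) * ∑ i, ∑ j, (G x)⁻¹ j i * partialDeriv l (fun y => G y i j) x) =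
      (1 / 2) * ∑ l, X l * ∑ i, ∑ j, (G x)⁻¹ j i * partialDeriv l (fun y => G y i j) x := by
    rw [Finset.mul_sum]
    exact Finset.sum_congr rfl fun l _ => by ring
  rw [e3]
  generalize ∑ l, X l * ∑ i, ∑ j, (G x)⁻¹ j i * partialDeriv l (fun y => G y i j) x = T
  field_simp
  rw [sq, hs]

/-- The Euclidean divergence of the weighted field `√(det G) X` is the density of the Riemannian
divergence, the trace of `ξ ↦ ∇_ξ X`. -/
theorem divergence_sqrt_det_smul (hG : IsRiemannianMetricOn G U) (hU : IsOpen U) (hx : x ∈ U)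
    {X : Eu n → Eu n} (hX : DifferentiableAt ℝ X x) :
    divergence (fun y => √(G y).det • X y) x =
      √(G x).det * LinearMap.trace ℝ (Eu n) (covDerivMap G X x) := by
  obtain ⟨h1, h2⟩ := hasFDerivAt_sqrt_det hG hU hx
  rw [divergence, fderiv_fun_smul h1 hX, covDerivMap, map_add]
  have e1 : ((√(G x).det • fderiv ℝ X x +
      (fderiv ℝ (fun y => √(G y).det) x).smulRight (X x) : Eu n →L[ℝ] Eu n) : Eu n →ₗ[ℝ] Eu n) =
      √(G x).det • (fderiv ℝ X x).toLinearMap +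
        (fderiv ℝ (fun y => √(G y).det) x).toLinearMap.smulRight (X x) := rfl
  rw [e1, map_add, map_smul, LinearMap.trace_smulRight, smul_eq_mul, mul_add]
  congr 1
  exact h2 (X x)

end LeviCivita

/-! ### Orthonormal frames and curvature -/

section PartialDeriv

variable {n : ℕ} {f g : Eu n → ℝ} {x : Eu n} {U : Set (Eu n)}

theorem contDiffOn_partialDeriv (hU : IsOpen U) (hf : ContDiffOn ℝ ∞ f U) (i : Fin n) :
    ContDiffOn ℝ ∞ (partialDeriv i f) U :=
  (hf.fderiv_of_isOpen hU (by simp)).clm_apply contDiffOn_const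

theorem partialDeriv_mul (hf : DifferentiableAt ℝ f x) (hg : DifferentiableAt ℝ g x) (i : Fin n) :
    partialDeriv i (fun y => f y * g y) x = partialDeriv i f x * g x + f x * partialDeriv i g x := by
  rw [partialDeriv, fderiv_fun_mul hf hg]
  simp only [add_apply, smul_apply, smul_eq_mul, partialDeriv]
  ring

theorem partialDeriv_sub (hf : DifferentiableAt ℝ f x) (hg : DifferentiableAt ℝ g x) (i : Fin n) :
    partialDeriv i (fun y => f y - g y) x = partialDeriv i f x - partialDeriv i g x := by
  rw [partialDeriv, fderiv_fun_sub hf hg]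
  rfl

theorem partialDeriv_sum {ι : Type*} {s : Finset ι} {F : ι → Eu n → ℝ}
    (hF : ∀ k ∈ s, DifferentiableAt ℝ (F k) x) (i : Fin n) :
    partialDeriv i (fun y => ∑ k ∈ s, F k y) x = ∑ k ∈ s, partialDeriv i (F k) x := by
  rw [partialDeriv, fderiv_fun_sum hF, sum_apply]
  rfl

theorem partialDeriv_congr (h : f =ᶠ[𝓝 x] g) (i : Fin n) : partialDeriv i f x = partialDeriv i g x := by
  rw [partialDeriv, partialDeriv, h.fderiv_eq]

theorem fderiv_fderiv_comm {F : Type*} [NormedAddCommGroup F] [NormedSpace ℝ F] {f : Eu n → F}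
    (hf : ContDiffAt ℝ 2 f x) (u v : Eu n) :
    fderiv ℝ (fun y => fderiv ℝ f y u) x v = fderiv ℝ (fun y => fderiv ℝ f y v) x u := by
  have hd : DifferentiableAt ℝ (fderiv ℝ f) x :=
    (hf.fderiv_right (m := 1) (by norm_num)).differentiableAt (by simp)
  rw [fderiv_clm_apply hd (by fun_prop), fderiv_clm_apply hd (by fun_prop)]
  simpa using (hf.isSymmSndFDerivAt (by simp)).eq v u

theorem partialDeriv_comm (hf : ContDiffAt ℝ 2 f x) (i j : Fin n) :
    partialDeriv i (partialDeriv j f) x = partialDeriv j (partialDeriv i f) x :=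
  fderiv_fderiv_comm hf _ _

end PartialDeriv

section Curvature

variable {n : ℕ} {G : Eu n → Matrix (Fin n) (Fin n) ℝ} {U : Set (Eu n)} {x : Eu n}

theorem contDiffOn_christoffel (hG : IsRiemannianMetricOn G U) (hU : IsOpen U) (k i j : Fin n) :
    ContDiffOn ℝ ∞ (christoffel G k i j) U := by
  refine contDiffOn_const.mul (ContDiffOn.sum fun l _ => ?_)
  refine (contDiffOn_inv_apply hG.1 (fun x hx => (hG.2 x hx).det_pos.ne') k l).mul ?_
  exact ((contDiffOn_partialDeriv hU (hG.1 j l) i).add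
    (contDiffOn_partialDeriv hU (hG.1 i l) j)).sub (contDiffOn_partialDeriv hU (hG.1 i j) l)

/-- The Riemann curvature tensor `R^k_{lij}`: the `k`-th component of `R(E_i, E_j) E_l`. -/
def riemann (G : Eu n → Matrix (Fin n) (Fin n) ℝ) (k l i j : Fin n) (x : Eu n) : ℝ :=
  partialDeriv i (christoffel G k j l) x - partialDeriv j (christoffel G k i l) x
    + ∑ m, (christoffel G k i m x * christoffel G m j l x
      - christoffel G k j m x * christoffel G m i l x)

theorem ricci_eq_sum_riemann (j k : Fin n) : ricci G j k x = ∑ i, riemann G i k i j x := rfl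

theorem partialDeriv_christoffel_comm (hG : IsRiemannianMetricOn G U) (hU : IsOpen U) (hx : x ∈ U)
    (m k i j : Fin n) :
    partialDeriv m (christoffel G k i j) x = partialDeriv m (christoffel G k j i) x :=
  partialDeriv_congr (by
    filter_upwards [hU.mem_nhds hx] with y hy using christoffel_comm hG hU hy k i j) m

/-- The first Bianchi identity. -/
theorem riemann_bianchi (hG : IsRiemannianMetricOn G U) (hU : IsOpen U) (hx : x ∈ U)
    (k l i j : Fin n) :
    riemann G k l i j x + riemann G k i j l x + riemann G k j l i x = 0 := by
  have h : ∑ m, (christoffel G k i m x * christoffel G m j l x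
      - christoffel G k j m x * christoffel G m i l x) +
      ∑ m, (christoffel G k j m x * christoffel G m l i x
      - christoffel G k l m x * christoffel G m j i x) +
      ∑ m, (christoffel G k l m x * christoffel G m i j x
      - christoffel G k i m x * christoffel G m l j x) = 0 := by
    rw [← Finset.sum_add_distrib, ← Finset.sum_add_distrib]
    refine Finset.sum_eq_zero fun m _ => ?_
    rw [christoffel_comm hG hU hx m l i, christoffel_comm hG hU hx m j i,
      christoffel_comm hG hU hx m l j]
    ring
  simp only [riemann]
  rw [partialDeriv_christoffel_comm hG hU hx j k l i, partialDeriv_christoffel_comm hG hU hx l k j i,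
    partialDeriv_christoffel_comm hG hU hx i k l j]
  linarith

variable {b : Fin n → Eu n → Eu n}

/-- The connection form `g(∇_X b_a, b_c)` of a frame; it is antisymmetric in `a`, `c` for an
orthonormal frame. -/
def connForm (G : Eu n → Matrix (Fin n) (Fin n) ℝ) (b : Fin n → Eu n → Eu n) (x X : Eu n)
    (a c : Fin n) : ℝ :=
  metricInner G x (covDeriv G Set.univ (b a) x X) (b c x)

theorem connForm_eq_sum (X : Eu n) (a c : Fin n) :
    connForm G b x X a c = ∑ i, X i * connForm G b x (stdVec i) a c := by
  simp only [connForm, ← covDerivMap_apply]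
  conv_lhs => rw [← sum_smul_stdVec X]
  simp only [map_sum, map_smul, metricInner_sum_left, metricInner_smul_left]

theorem IsOrientedOrthonormalFrame.differentiableAt (hb : IsOrientedOrthonormalFrame G U b)
    (hU : IsOpen U) (hx : x ∈ U) (a : Fin n) : DifferentiableAt ℝ (b a) x :=
  ((hb.1 a).contDiffAt (hU.mem_nhds hx)).differentiableAt (by simp)

theorem connForm_antisymm (hG : IsRiemannianMetricOn G U) (hU : IsOpen U)
    (hb : IsOrientedOrthonormalFrame G U b) (hx : x ∈ U) (X : Eu n) (a c : Fin n) :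
    connForm G b x X a c = -connForm G b x X c a := by
  have h := (hasFDerivAt_metricInner hG hU hx (hb.differentiableAt hU hx a)
    (hb.differentiableAt hU hx c)).2 X
  have h0 : (fun y => metricInner G y (b a y) (b c y)) =ᶠ[𝓝 x] fun _ => if a = c then 1 else 0 := by
    filter_upwards [hU.mem_nhds hx] with y hy using hb.2.1 y hy a c
  rw [h0.fderiv_eq, metricInner_comm (hG.2 x hx) (b a x)] at h
  simp only [fderiv_fun_const, Pi.zero_apply, zero_apply] at h
  simp only [connForm]
  linarith

theorem covDeriv_frame (hb : IsOrientedOrthonormalFrame G U b) (hx : x ∈ U) (X : Eu n)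
    (a : Fin n) :
    covDeriv G Set.univ (b a) x X = ∑ c, connForm G b x X a c • b c x :=
  (sum_metricInner_smul (Fintype.card_fin n) (hb.2.1 x hx) _).symm

theorem contDiffOn_metricInner {m : WithTop ℕ∞} (hG : ∀ i j, ContDiffOn ℝ m (fun x => G x i j) U)
    {Y Z : Eu n → Eu n} (hY : ContDiffOn ℝ m Y U) (hZ : ContDiffOn ℝ m Z U) :
    ContDiffOn ℝ m (fun x => metricInner G x (Y x) (Z x)) U := by
  rw [contDiffOn_euclidean] at hY hZ
  exact ContDiffOn.sum fun i _ => ContDiffOn.sum fun j _ => ((hG i j).mul (hY i)).mul (hZ j)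

theorem contDiffOn_covDeriv (hG : IsRiemannianMetricOn G U) (hU : IsOpen U) {m k : WithTop ℕ∞}
    (hm : m ≤ ∞) (hk : m + 1 ≤ k) {Y X : Eu n → Eu n} (hY : ContDiffOn ℝ k Y U)
    (hX : ContDiffOn ℝ m X U) :
    ContDiffOn ℝ m (fun x => covDeriv G Set.univ Y x (X x)) U := by
  simp only [covDeriv_univ]
  refine ((hY.fderiv_of_isOpen hU hk).clm_apply hX).add ?_
  have hY' : ContDiffOn ℝ m Y U := hY.of_le (le_trans le_self_add hk)
  rw [contDiffOn_euclidean] at hY' hX ⊢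
  intro l
  simp only [christoffelMap_apply]
  exact ContDiffOn.sum fun i _ => ContDiffOn.sum fun j _ =>
    (((contDiffOn_christoffel hG hU l i j).of_le hm).mul (hX i)).mul (hY' j)

theorem contDiffOn_connForm (hG : IsRiemannianMetricOn G U) (hU : IsOpen U)
    (hb : IsOrientedOrthonormalFrame G U b) (i a c : Fin n) :
    ContDiffOn ℝ ∞ (fun y => connForm G b y (stdVec i) a c) U :=
  contDiffOn_metricInner hG.1
    (contDiffOn_covDeriv hG hU le_rfl (by simp) (hb.1 a) contDiffOn_const) (hb.1 c)

/-- The curvature form of the frame, in the coordinate directions `i`, `j`. -/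
def curvForm (G : Eu n → Matrix (Fin n) (Fin n) ℝ) (b : Fin n → Eu n → Eu n) (x : Eu n)
    (i j a c : Fin n) : ℝ :=
  partialDeriv i (fun y => connForm G b y (stdVec j) a c) x -
    partialDeriv j (fun y => connForm G b y (stdVec i) a c) x -
    ∑ d, (connForm G b x (stdVec i) a d * connForm G b x (stdVec j) d c -
      connForm G b x (stdVec j) a d * connForm G b x (stdVec i) d c)

theorem curvForm_antisymm (i j a c : Fin n) : curvForm G b x i j a c = -curvForm G b x j i a c := by
  simp only [curvForm, Finset.sum_sub_distrib]
  ring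

/-- The derivative of the frame in terms of the connection form and the Christoffel symbols. -/
theorem partialDeriv_frame (hb : IsOrientedOrthonormalFrame G U b) (hU : IsOpen U) (hx : x ∈ U)
    (j a k : Fin n) :
    partialDeriv j (fun y => b a y k) x =
      ∑ c, connForm G b x (stdVec j) a c * b c x k - ∑ l, b a x l * christoffel G k j l x := by
  have h := congrArg (fun u : Eu n => u k) (covDeriv_frame hb hx (stdVec j) a)
  rw [covDeriv_univ] at h
  have h1 : partialDeriv j (fun y => b a y k) x = fderiv ℝ (b a) x (stdVec j) k := by
    have h2 := ((PiLp.proj (𝕜 := ℝ) 2 (fun _ : Fin n => ℝ) k).hasFDerivAt (x := b a x)).comp x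
      (hb.differentiableAt hU hx a).hasFDerivAt
    exact congrArg (fun L : Eu n →L[ℝ] ℝ => L (stdVec j)) h2.fderiv
  have h3 : christoffelMap G x (stdVec j) (b a x) k = ∑ l, b a x l * christoffel G k j l x := by
    rw [christoffelMap_apply, Finset.sum_eq_single j]
    · exact Finset.sum_congr rfl fun l _ => by simp [stdVec]; ring
    · intro i _ hi; simp [stdVec, hi]
    · simp
  simp only [PiLp.add_apply, WithLp.ofLp_sum, WithLp.ofLp_smul, Finset.sum_apply, Pi.smul_apply,
    smul_eq_mul, h3] at h
  rw [h1, ← h]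
  ring

/-- Cartan's structure equation: the curvature form of a frame computes the Riemann tensor. It
expresses the symmetry of the second derivatives of the frame. -/
theorem sum_curvForm_mul (hG : IsRiemannianMetricOn G U) (hU : IsOpen U)
    (hb : IsOrientedOrthonormalFrame G U b) (hx : x ∈ U) (i j a k : Fin n) :
    ∑ c, curvForm G b x i j a c * b c x k = ∑ l, b a x l * riemann G k l i j x := by
  -- In matrix form `∂_j B = T_j B - B C_j` by `partialDeriv_frame`; equating `∂_i ∂_j B` and `∂_j
  -- ∂_i B` gives the claim.
  let B : Matrix (Fin n) (Fin n) ℝ := Matrix.of fun a k => b a x k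
  let T : Fin n → Matrix (Fin n) (Fin n) ℝ := fun j =>
    Matrix.of fun a c => connForm G b x (stdVec j) a c
  let C : Fin n → Matrix (Fin n) (Fin n) ℝ := fun j => Matrix.of fun l k => christoffel G k j l x
  let dT : Fin n → Fin n → Matrix (Fin n) (Fin n) ℝ := fun i j =>
    Matrix.of fun a c => partialDeriv i (fun y => connForm G b y (stdVec j) a c) x
  let dC : Fin n → Fin n → Matrix (Fin n) (Fin n) ℝ := fun i j =>
    Matrix.of fun l k => partialDeriv i (christoffel G k j l) x
  have hbk : ∀ a k, ContDiffOn ℝ ∞ (fun y => b a y k) U := fun a k =>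
    contDiffOn_euclidean.1 (hb.1 a) k
  have hd : ∀ {f : Eu n → ℝ}, ContDiffOn ℝ ∞ f U → DifferentiableAt ℝ f x := fun hf =>
    (hf.contDiffAt (hU.mem_nhds hx)).differentiableAt (by simp)
  have hdB : ∀ j, (Matrix.of fun a k => partialDeriv j (fun y => b a y k) x) =
      T j * B - B * C j := by
    intro j
    ext a k
    simp only [Matrix.of_apply, Matrix.sub_apply, Matrix.mul_apply, T, B, C]
    exact partialDeriv_frame hb hU hx j a k
  have hddB : ∀ i j, (Matrix.of fun a k =>
      partialDeriv i (partialDeriv j (fun y => b a y k)) x) =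
      dT i j * B + T j * (T i * B - B * C i) - ((T i * B - B * C i) * C j + B * dC i j) := by
    intro i j
    rw [← hdB]
    ext a k
    have h1 : partialDeriv j (fun y => b a y k) =ᶠ[𝓝 x] fun y =>
        ∑ c, connForm G b y (stdVec j) a c * b c y k - ∑ l, b a y l * christoffel G k j l y := by
      filter_upwards [hU.mem_nhds hx] with y hy using partialDeriv_frame hb hU hy j a k
    have hd1 : ∀ c, DifferentiableAt ℝ (fun y => connForm G b y (stdVec j) a c) x := fun c =>
      hd (contDiffOn_connForm hG hU hb j a c)
    have hd2 : ∀ a k, DifferentiableAt ℝ (fun y => b a y k) x := fun a k => hd (hbk a k)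
    have hd3 : ∀ l, DifferentiableAt ℝ (christoffel G k j l) x := fun l =>
      hd (contDiffOn_christoffel hG hU k j l)
    simp only [Matrix.of_apply, Matrix.sub_apply, Matrix.add_apply, Matrix.mul_apply, T, B, C, dT,
      dC]
    rw [partialDeriv_congr h1, partialDeriv_sub
      (DifferentiableAt.fun_sum fun c _ => (hd1 c).fun_mul (hd2 c k))
      (DifferentiableAt.fun_sum fun l _ => (hd2 a l).fun_mul (hd3 l)),
      partialDeriv_sum (fun c _ => (hd1 c).fun_mul (hd2 c k)),
      partialDeriv_sum (fun l _ => (hd2 a l).fun_mul (hd3 l)), ← Finset.sum_add_distrib,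
      ← Finset.sum_add_distrib]
    congr 1
    · exact Finset.sum_congr rfl fun c _ => partialDeriv_mul (hd1 c) (hd2 c k) i
    · exact Finset.sum_congr rfl fun l _ => partialDeriv_mul (hd2 a l) (hd3 l) i
  have hsymm : (Matrix.of fun a k => partialDeriv i (partialDeriv j (fun y => b a y k)) x) =
      Matrix.of fun a k => partialDeriv j (partialDeriv i (fun y => b a y k)) x := by
    ext a k
    exact partialDeriv_comm (((hbk a k).contDiffAt (hU.mem_nhds hx)).of_le ENat.LEInfty.out) i j
  rw [hddB, hddB] at hsymm
  have hmat : (dT i j - dT j i - (T i * T j - T j * T i)) * B =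
      B * (dC i j - dC j i + (C j * C i - C i * C j)) := by
    rw [← sub_eq_zero] at hsymm ⊢
    rw [← hsymm]
    noncomm_ring
  have h := congrFun (congrFun hmat a) k
  rw [Matrix.mul_apply, Matrix.mul_apply] at h
  convert h using 2 with c _ l _
  · simp only [curvForm, Matrix.sub_apply, Matrix.mul_apply, dT, T, B, Matrix.of_apply,
      Finset.sum_sub_distrib]
  · simp only [riemann, Matrix.sub_apply, Matrix.add_apply, Matrix.mul_apply, dC, C, B,
      Matrix.of_apply, Finset.sum_sub_distrib]
    simp only [mul_comm]

/-- The components `g(R(b_p, b_q) b_a, b_c)` of the Riemann tensor with respect to an orthonormal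
frame. -/
def frameCurv (G : Eu n → Matrix (Fin n) (Fin n) ℝ) (b : Fin n → Eu n → Eu n) (x : Eu n)
    (p q a c : Fin n) : ℝ :=
  ∑ i, ∑ j, b p x i * b q x j * curvForm G b x i j a c

theorem frameCurv_antisymm (p q a c : Fin n) :
    frameCurv G b x p q a c = -frameCurv G b x q p a c := by
  simp only [frameCurv, ← Finset.sum_neg_distrib]
  rw [Finset.sum_comm]
  refine Finset.sum_congr rfl fun i _ => Finset.sum_congr rfl fun j _ => ?_
  rw [curvForm_antisymm]; ring

/-- The vector with frame components `frameCurv p q a ·` is `R(b_p, b_q) b_a`. -/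
theorem sum_frameCurv_mul (hG : IsRiemannianMetricOn G U) (hU : IsOpen U)
    (hb : IsOrientedOrthonormalFrame G U b) (hx : x ∈ U) (p q a k : Fin n) :
    ∑ c, frameCurv G b x p q a c * b c x k =
      ∑ i, ∑ j, ∑ l, b p x i * b q x j * b a x l * riemann G k l i j x := by
  simp only [frameCurv, Finset.sum_mul]
  rw [Finset.sum_comm]
  refine Finset.sum_congr rfl fun i _ => ?_
  rw [Finset.sum_comm]
  refine Finset.sum_congr rfl fun j _ => ?_
  have h := sum_curvForm_mul hG hU hb hx i j a k
  simp only [mul_assoc, ← Finset.mul_sum]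
  rw [h]

/-- The first Bianchi identity in the frame. -/
theorem frameCurv_bianchi (hG : IsRiemannianMetricOn G U) (hU : IsOpen U)
    (hb : IsOrientedOrthonormalFrame G U b) (hx : x ∈ U) (p q a c : Fin n) :
    frameCurv G b x p q a c + frameCurv G b x q a p c + frameCurv G b x a p q c = 0 := by
  set r : Fin n → ℝ := fun c =>
    frameCurv G b x p q a c + frameCurv G b x q a p c + frameCurv G b x a p q c with hr
  have h1 : ∑ c, r c • b c x = 0 := by
    ext k
    simp only [WithLp.ofLp_sum, WithLp.ofLp_smul, Finset.sum_apply, Pi.smul_apply, smul_eq_mul, hr,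
      add_mul, Finset.sum_add_distrib, sum_frameCurv_mul hG hU hb hx, PiLp.zero_apply]
    have e1 : ∑ i, ∑ j, ∑ l, b q x i * b a x j * b p x l * riemann G k l i j x =
        ∑ i, ∑ j, ∑ l, b p x i * b q x j * b a x l * riemann G k i j l x := by
      rw [← sum_rotate fun i j l => b q x i * b a x j * b p x l * riemann G k l i j x]
      refine Finset.sum_congr rfl fun i _ => Finset.sum_congr rfl fun j _ =>
        Finset.sum_congr rfl fun l _ => ?_
      ring
    have e2 : ∑ i, ∑ j, ∑ l, b a x i * b p x j * b q x l * riemann G k l i j x =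
        ∑ i, ∑ j, ∑ l, b p x i * b q x j * b a x l * riemann G k j l i x := by
      rw [← sum_rotate fun i j l => b p x i * b q x j * b a x l * riemann G k j l i x]
      refine Finset.sum_congr rfl fun i _ => Finset.sum_congr rfl fun j _ =>
        Finset.sum_congr rfl fun l _ => ?_
      ring
    rw [e1, e2]
    simp only [← Finset.sum_add_distrib, ← mul_add, riemann_bianchi hG hU hx, mul_zero,
      Finset.sum_const_zero]
  exact (Fintype.linearIndependent_iff.1 (linearIndependent_of_metricInner (hb.2.1 x hx))) r h1 c

/-- The scalar curvature as the double trace of the curvature in the frame. -/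
theorem sum_frameCurv_eq_scalarCurvature (hG : IsRiemannianMetricOn G U) (hU : IsOpen U)
    (hb : IsOrientedOrthonormalFrame G U b) (hx : x ∈ U) :
    ∑ p, ∑ q, frameCurv G b x p q q p = scalarCurvature G x := by
  have h1 : ∀ q, ∑ p, frameCurv G b x p q q p =
      ∑ j, ∑ l, b q x j * b q x l * ricci G j l x := by
    intro q
    have e1 : ∀ p, frameCurv G b x p q q p = ∑ i, ∑ j, b q x j * (curvForm G b x i j q p * b p x i) := by
      intro p
      exact Finset.sum_congr rfl fun i _ => Finset.sum_congr rfl fun j _ => by ring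
    simp only [e1]
    refine (Finset.sum_comm.trans (Finset.sum_congr rfl fun i _ => Finset.sum_comm)).trans ?_
    rw [Finset.sum_comm]
    refine Finset.sum_congr rfl fun j _ => ?_
    simp only [← Finset.mul_sum, sum_curvForm_mul hG hU hb hx, ricci_eq_sum_riemann]
    simp only [Finset.mul_sum]
    rw [Finset.sum_comm]
    exact Finset.sum_congr rfl fun l _ => Finset.sum_congr rfl fun i _ => by ring
  rw [Finset.sum_comm]
  simp only [h1]
  rw [Finset.sum_comm, scalarCurvature]
  refine Finset.sum_congr rfl fun j _ => ?_
  rw [Finset.sum_comm]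
  refine Finset.sum_congr rfl fun l _ => ?_
  rw [← sum_mul_eq_inv (Fintype.card_fin n) (hb.2.1 x hx) (hG.2 x hx), Finset.sum_mul]

end Curvature

/-! ### The Lichnerowicz formula -/

section SpinAlgebra

variable {n : ℕ} {S : Type*} [NormedAddCommGroup S] [InnerProductSpace ℝ S]
variable {γ : Fin n → Module.End ℝ S}

/-- The Clifford generators act by skew-adjoint endomorphisms. -/
def IsSkew (γ : Fin n → Module.End ℝ S) : Prop :=
  ∀ a u v, inner ℝ (γ a u) v = -inner ℝ u (γ a v)

/-- The endomorphism `(1/4) ∑ θ_{jk} γ_j γ_k` by which the infinitesimal rotation `θ` acts on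
spinors. -/
def spinConn (γ : Fin n → Module.End ℝ S) : (Fin n → Fin n → ℝ) →ₗ[ℝ] Module.End ℝ S where
  toFun θ := (1 / 4 : ℝ) • ∑ j, ∑ k, θ j k • (γ j * γ k)
  map_add' θ η := by
    simp only [Pi.add_apply, add_smul, Finset.sum_add_distrib, smul_add]
  map_smul' c θ := by
    simp only [Pi.smul_apply, smul_eq_mul, mul_smul, ← Finset.smul_sum, RingHom.id_apply]
    rw [smul_comm]

theorem spinConn_apply (θ : Fin n → Fin n → ℝ) :
    spinConn γ θ = (1 / 4 : ℝ) • ∑ j, ∑ k, θ j k • (γ j * γ k) := rfl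

theorem spinConn_apply_apply (θ : Fin n → Fin n → ℝ) (u : S) :
    spinConn γ θ u = (1 / 4 : ℝ) • ∑ j, ∑ k, θ j k • γ j (γ k u) := by
  simp [spinConn_apply, LinearMap.sum_apply]

theorem IsClifford.apply (hγ : IsClifford γ) (a c : Fin n) (u : S) :
    γ a (γ c u) + γ c (γ a u) = -((if a = c then (2 : ℝ) else 0) • u) := by
  have h := congrArg (fun T : Module.End ℝ S => T u) (hγ a c)
  simpa only [LinearMap.add_apply, Module.End.mul_apply, LinearMap.neg_apply, LinearMap.smul_apply,
    Module.End.one_apply] using h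

theorem inner_gen_gen (hγ : IsClifford γ) (hs : IsSkew γ) (a c : Fin n) (u : S) :
    inner ℝ (γ a u) (γ c u) = if a = c then ‖u‖ ^ 2 else 0 := by
  have h := congrArg (fun v => inner ℝ v u) (hγ.apply a c u)
  simp only [inner_add_left, inner_neg_left, real_inner_smul_left] at h
  rw [hs a (γ c u) u, hs c (γ a u) u, real_inner_comm (γ a u) (γ c u),
    real_inner_self_eq_norm_sq] at h
  split_ifs at h ⊢ <;> linarith

theorem inner_spinConn (hγ : IsClifford γ) (hs : IsSkew γ) {θ : Fin n → Fin n → ℝ}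
    (hθ : ∀ a c, θ a c = -θ c a) (u v : S) :
    inner ℝ (spinConn γ θ u) v = -inner ℝ u (spinConn γ θ v) := by
  have hd : ∀ a, θ a a = 0 := fun a => by have := hθ a a; linarith
  rw [spinConn_apply_apply, spinConn_apply_apply, real_inner_smul_left, real_inner_smul_right,
    sum_inner, inner_sum, ← mul_neg, ← Finset.sum_neg_distrib]
  congr 1
  simp only [sum_inner, inner_sum, real_inner_smul_left, real_inner_smul_right]
  refine Finset.sum_congr rfl fun j _ => ?_
  rw [← Finset.sum_neg_distrib]
  refine Finset.sum_congr rfl fun k _ => ?_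
  rw [hs j, hs k, neg_neg]
  have h := hγ.apply k j v
  by_cases hjk : j = k
  · subst hjk; simp [hd]
  · have : γ k (γ j v) = -γ j (γ k v) := by
      rw [eq_neg_iff_add_eq_zero, h]; simp [Ne.symm hjk]
    rw [this, inner_neg_right]; ring

/-- The antisymmetric part `γ_a γ_c + δ_{ac}` of `γ_a γ_c`. -/
def cliffordWedge (γ : Fin n → Module.End ℝ S) (a c : Fin n) : Module.End ℝ S :=
  γ a * γ c + (if a = c then (1 : ℝ) else 0) • 1

theorem cliffordWedge_apply (a c : Fin n) (u : S) :
    cliffordWedge γ a c u = γ a (γ c u) + (if a = c then (1 : ℝ) else 0) • u := by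
  simp only [cliffordWedge, LinearMap.add_apply, Module.End.mul_apply, LinearMap.smul_apply,
    Module.End.one_apply]

theorem cliffordWedge_antisymm (hγ : IsClifford γ) (a c : Fin n) :
    cliffordWedge γ a c = -cliffordWedge γ c a := by
  rw [eq_neg_iff_add_eq_zero]
  have h := hγ a c
  simp only [cliffordWedge]
  have e : γ a * γ c + (if a = c then (1 : ℝ) else 0) • (1 : Module.End ℝ S) +
      (γ c * γ a + (if c = a then (1 : ℝ) else 0) • 1) = (γ a * γ c + γ c * γ a) +
      ((if a = c then (1 : ℝ) else 0) + (if c = a then (1 : ℝ) else 0)) • 1 := by module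
  rw [e, h]
  by_cases hac : a = c
  · subst hac
    simp only [if_true]
    module
  · simp [hac, Ne.symm hac]

/-- `spinConn γ θ` acts on the bivectors `γ_a ∧ γ_c` as a derivation, through the infinitesimal
rotation `θ` of the two indices. -/
theorem spinConn_mul_cliffordWedge (hγ : IsClifford γ) {θ : Fin n → Fin n → ℝ}
    (hθ : ∀ a c, θ a c = -θ c a) (a c : Fin n) :
    spinConn γ θ * cliffordWedge γ a c = cliffordWedge γ a c * spinConn γ θ +
      (∑ k, θ a k • cliffordWedge γ k c + ∑ k, θ c k • cliffordWedge γ a k) := by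
  have h1 : ∀ a, spinConn γ θ * γ a = γ a * spinConn γ θ + ∑ k, θ a k • γ k := fun a => by
    rw [← hγ.commutator hθ a]; simp only [spinConn_apply]; abel
  simp only [cliffordWedge, mul_add, add_mul]
  rw [← mul_assoc, h1, add_mul, mul_assoc (γ a), h1, mul_add, Finset.sum_mul, Finset.mul_sum]
  simp only [smul_add, Finset.sum_add_distrib, mul_smul_comm, smul_mul_assoc, mul_one, one_mul,
    mul_assoc]
  have h3 : ∑ k, θ a k • (if k = c then (1 : ℝ) else 0) • (1 : Module.End ℝ S) = θ a c • 1 := by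
    simp [ite_smul, smul_ite]
  have h4 : ∑ k, θ c k • (if a = k then (1 : ℝ) else 0) • (1 : Module.End ℝ S) = θ c a • 1 := by
    simp [ite_smul, smul_ite]
  rw [h3, h4, hθ c a]
  module

/-- All terms linear in the connection form cancel in the divergence of the field `∑ ⟨(γ_a γ_c +
δ_{ac}) D_c, s⟩ b_a`, once the derivatives `p`, `q` of `s`, `D` are replaced by covariant ones. Here
`θ a` is the connection form in the direction `b_a`, `p a` and `q a c` stand for the derivatives of
`s` and of `D_c` in that direction, and the term `θ d a d` is the divergence of `b_a`. -/
theorem sum_inner_cliffordWedge (hγ : IsClifford γ) (hs : IsSkew γ)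
    {θ : Fin n → Fin n → Fin n → ℝ} (hθ : ∀ a c d, θ a c d = -θ a d c)
    (s : S) (D p : Fin n → S) (q : Fin n → Fin n → S) (hD : ∀ a, D a = p a + spinConn γ (θ a) s) :
    ∑ a, ∑ c, (inner ℝ (cliffordWedge γ a c (q a c)) s + inner ℝ (cliffordWedge γ a c (D c)) (p a)) +
      ∑ d, ∑ a, θ d a d * ∑ c, inner ℝ (cliffordWedge γ a c (D c)) s =
    ∑ a, ∑ c, inner ℝ (cliffordWedge γ a c
        (q a c + spinConn γ (θ a) (D c) - ∑ d, θ a c d • D d)) s +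
      ∑ a, ∑ c, inner ℝ (cliffordWedge γ a c (D c)) (D a) := by
  set I : Fin n → Fin n → Fin n → ℝ := fun a c d => inner ℝ (cliffordWedge γ a c (D d)) s with hI
  have h1 : ∀ a c, inner ℝ (cliffordWedge γ a c (D c)) (D a) =
      inner ℝ (cliffordWedge γ a c (D c)) (p a) -
        inner ℝ (cliffordWedge γ a c (spinConn γ (θ a) (D c))) s -
        (∑ k, θ a a k * I k c c + ∑ k, θ a c k * I a k c) := by
    intro a c
    have h2 := congrArg (fun T : Module.End ℝ S => inner ℝ (T (D c)) s)
      (spinConn_mul_cliffordWedge hγ (hθ a) a c)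
    simp only [Module.End.mul_apply, LinearMap.add_apply, LinearMap.sum_apply, LinearMap.smul_apply,
      inner_add_left, sum_inner, real_inner_smul_left] at h2
    rw [inner_spinConn hγ hs (hθ a)] at h2
    have h3 : inner ℝ (cliffordWedge γ a c (D c)) (D a) =
        inner ℝ (cliffordWedge γ a c (D c)) (p a) +
        inner ℝ (cliffordWedge γ a c (D c)) (spinConn γ (θ a) s) := by
      rw [← inner_add_right, ← hD]
    linarith
  have h4 : ∀ a c, inner ℝ (cliffordWedge γ a c
        (q a c + spinConn γ (θ a) (D c) - ∑ d, θ a c d • D d)) s =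
      inner ℝ (cliffordWedge γ a c (q a c)) s +
        inner ℝ (cliffordWedge γ a c (spinConn γ (θ a) (D c))) s - ∑ k, θ a c k * I a c k := by
    intro a c
    simp only [map_sub, map_add, map_sum, map_smul, inner_sub_left, inner_add_left, sum_inner,
      real_inner_smul_left, hI]
  simp only [h1, h4, Finset.sum_sub_distrib, Finset.sum_add_distrib]
  have e1 : ∑ d, ∑ a, θ d a d * ∑ c, inner ℝ (cliffordWedge γ a c (D c)) s =
      -∑ a, ∑ c, ∑ k, θ a a k * I k c c := by
    simp only [Finset.mul_sum, ← Finset.sum_neg_distrib]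
    refine Finset.sum_congr rfl fun d _ => ?_
    rw [Finset.sum_comm]
    refine Finset.sum_congr rfl fun c _ => Finset.sum_congr rfl fun k _ => ?_
    rw [hθ d k d]; ring
  have e2 : ∑ a, ∑ c, ∑ k, θ a c k * I a c k = -∑ a, ∑ c, ∑ k, θ a c k * I a k c := by
    simp only [← Finset.sum_neg_distrib]
    refine Finset.sum_congr rfl fun a _ => ?_
    rw [Finset.sum_comm]
    refine Finset.sum_congr rfl fun c _ => Finset.sum_congr rfl fun k _ => ?_
    rw [hθ a k c]; ring
  rw [e1, e2]
  ring

/-- The quadratic form of the bivectors is `|∇s|²` (from `δ_{ac}`) minus the square of the Dirac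
operator (from `γ_a γ_c`). -/
theorem sum_inner_cliffordWedge_self (hs : IsSkew γ) (D : Fin n → S) :
    ∑ a, ∑ c, inner ℝ (cliffordWedge γ a c (D c)) (D a) =
      ∑ a, ‖D a‖ ^ 2 - ‖∑ a, γ a (D a)‖ ^ 2 := by
  have h : ∀ a c, inner ℝ (cliffordWedge γ a c (D c)) (D a) =
      (if a = c then inner ℝ (D c) (D a) else 0) - inner ℝ (γ c (D c)) (γ a (D a)) := by
    intro a c
    rw [cliffordWedge_apply, inner_add_left, hs a, real_inner_smul_left]
    split_ifs <;> ring
  simp only [h, Finset.sum_sub_distrib, Finset.sum_ite_eq, Finset.mem_univ, if_true,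
    real_inner_self_eq_norm_sq]
  rw [← real_inner_self_eq_norm_sq (∑ a, γ a (D a)), inner_sum]
  simp only [sum_inner]

/-- The curvature term of the Lichnerowicz formula. Here `K p q` stands for the covariant second
derivative of `s`; only its antisymmetric part, the curvature `spinConn γ (R p q) s`, survives the
contraction with the antisymmetric `cliffordWedge`. The first Bianchi identity reduces the product
of four generators to the Ricci contraction of `R`, and the pairing with `s` keeps the trace of
that. -/
theorem sum_inner_cliffordWedge_curv (hγ : IsClifford γ) (hs : IsSkew γ)
    {R : Fin n → Fin n → Fin n → Fin n → ℝ} (hanti : ∀ p q a c, R p q a c = -R q p a c)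
    (hB : ∀ p q a c, R p q a c + R q a p c + R a p q c = 0) (s : S) (K : Fin n → Fin n → S)
    (hK : ∀ p q, K p q - K q p = spinConn γ (R p q) s) :
    ∑ p, ∑ q, inner ℝ (cliffordWedge γ p q (K p q)) s =
      1 / 4 * (∑ p, ∑ q, R p q q p) * ‖s‖ ^ 2 := by
  -- The diagonal terms vanish, so that `γ_p γ_q` may replace `cliffordWedge γ p q` below.
  have hdiag : ∀ p a c, R p p a c = 0 := fun p a c => by have := hanti p p a c; linarith
  have h1 : ∑ p, ∑ q, inner ℝ (cliffordWedge γ p q (K p q)) s =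
      1 / 2 * ∑ p, ∑ q, inner ℝ (cliffordWedge γ p q (K p q - K q p)) s := by
    have e : ∑ p, ∑ q, inner ℝ (cliffordWedge γ p q (K q p)) s =
        -∑ p, ∑ q, inner ℝ (cliffordWedge γ p q (K p q)) s := by
      rw [Finset.sum_comm]
      simp only [← Finset.sum_neg_distrib]
      refine Finset.sum_congr rfl fun p _ => Finset.sum_congr rfl fun q _ => ?_
      rw [cliffordWedge_antisymm hγ, LinearMap.neg_apply, inner_neg_left]
    simp only [map_sub, inner_sub_left, Finset.sum_sub_distrib]
    rw [e]; ring
  have h2 : ∀ p q, cliffordWedge γ p q (spinConn γ (R p q) s) =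
      (1 / 4 : ℝ) • ∑ c, ∑ a, R p q a c • (γ p * γ q * γ a) (γ c s) := by
    intro p q
    rw [cliffordWedge_apply]
    have e : (if p = q then (1 : ℝ) else 0) • spinConn γ (R p q) s = 0 := by
      by_cases h : p = q
      · subst h
        have : R p p = 0 := by ext a c; exact hdiag p a c
        simp [this]
      · simp [h]
    rw [e, add_zero, spinConn_apply_apply, Finset.sum_comm]
    simp only [map_smul, map_sum, Module.End.mul_apply]
  have h3 : ∀ c, ∑ p, ∑ q, ∑ a, R p q a c • (γ p * γ q * γ a) (γ c s) =
      -((2 : ℝ) • ∑ p, (∑ q, R p q q c) • γ p (γ c s)) := by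
    intro c
    have h := congrArg (fun T : Module.End ℝ S => T (γ c s))
      (hγ.bianchi_contract (fun p q a => hanti p q a c) (fun p q a => hB p q a c))
    simpa only [LinearMap.sum_apply, LinearMap.smul_apply, LinearMap.neg_apply] using h
  have h4 : ∑ p, ∑ q, cliffordWedge γ p q (spinConn γ (R p q) s) =
      -((1 / 2 : ℝ) • ∑ c, ∑ p, (∑ q, R p q q c) • γ p (γ c s)) := by
    simp only [h2, ← Finset.smul_sum]
    have e : ∑ p, ∑ q, ∑ c, ∑ a, R p q a c • (γ p * γ q * γ a) (γ c s) =
        ∑ c, ∑ p, ∑ q, ∑ a, R p q a c • (γ p * γ q * γ a) (γ c s) := by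
      rw [Finset.sum_comm]
      refine (Finset.sum_congr rfl fun q _ => Finset.sum_comm).trans ?_
      rw [Finset.sum_comm]
      exact Finset.sum_congr rfl fun c _ => Finset.sum_comm
    rw [e]
    simp only [h3, Finset.sum_neg_distrib, ← Finset.smul_sum]
    module
  have h5 : ∀ p c, inner ℝ (γ p (γ c s)) s = -(if p = c then ‖s‖ ^ 2 else 0) := by
    intro p c
    rw [hs, inner_gen_gen hγ hs]
    simp only [eq_comm]
  rw [h1]
  simp only [hK, ← sum_inner]
  rw [h4]
  simp only [inner_neg_left, real_inner_smul_left, sum_inner, h5, mul_neg, mul_ite, mul_zero,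
    Finset.sum_neg_distrib, Finset.sum_ite_eq', Finset.mem_univ, if_true, ← Finset.sum_mul]
  ring

end SpinAlgebra

section SpinField

variable {n : ℕ} {S : Type*} [NormedAddCommGroup S] [InnerProductSpace ℝ S] [FiniteDimensional ℝ S]
variable {γ : Fin n → Module.End ℝ S} {G : Eu n → Matrix (Fin n) (Fin n) ℝ} {U : Set (Eu n)}
  {b : Fin n → Eu n → Eu n} {x : Eu n}

theorem differentiableAt_linearMap_apply (T : Module.End ℝ S) {s : Eu n → S}
    (hs : DifferentiableAt ℝ s x) : DifferentiableAt ℝ (fun y => T (s y)) x :=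
  (LinearMap.toContinuousLinearMap T).differentiableAt.comp x hs

theorem fderiv_linearMap_apply (T : Module.End ℝ S) {s : Eu n → S}
    (hs : DifferentiableAt ℝ s x) (X : Eu n) :
    fderiv ℝ (fun y => T (s y)) x X = T (fderiv ℝ s x X) := by
  have h := ((LinearMap.toContinuousLinearMap T).hasFDerivAt (x := s x)).comp x hs.hasFDerivAt
  exact congrArg (fun L : Eu n →L[ℝ] S => L X) h.fderiv

theorem contDiffOn_linearMap_apply {m : WithTop ℕ∞} {A : Set (Eu n)} (T : Module.End ℝ S)
    {s : Eu n → S} (hs : ContDiffOn ℝ m s A) : ContDiffOn ℝ m (fun y => T (s y)) A :=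
  (LinearMap.toContinuousLinearMap T).contDiff.comp_contDiffOn hs

/-- The Leibniz rule for a variable infinitesimal rotation acting on a spinor field. -/
theorem hasFDerivAt_spinConn {θ : Eu n → Fin n → Fin n → ℝ} {s : Eu n → S}
    (hθ : ∀ j k, DifferentiableAt ℝ (fun y => θ y j k) x) (hs : DifferentiableAt ℝ s x) :
    DifferentiableAt ℝ (fun y => spinConn γ (θ y) (s y)) x ∧
    ∀ X, fderiv ℝ (fun y => spinConn γ (θ y) (s y)) x X =
      spinConn γ (fun j k => fderiv ℝ (fun y => θ y j k) x X) (s x) +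
        spinConn γ (θ x) (fderiv ℝ s x X) := by
  have h0 := fun j k => (hθ j k).hasFDerivAt.fun_smul
    (differentiableAt_linearMap_apply (γ j * γ k) hs).hasFDerivAt
  have h1 := (HasFDerivAt.fun_sum (u := Finset.univ) fun j _ =>
    HasFDerivAt.fun_sum (u := Finset.univ) fun k _ => h0 j k).fun_const_smul (1 / 4 : ℝ)
  have he : (fun y => spinConn γ (θ y) (s y)) =
      fun y => (1 / 4 : ℝ) • ∑ j, ∑ k, θ y j k • (γ j * γ k) (s y) := by
    funext y; exact spinConn_apply_apply _ _
  have h : HasFDerivAt (fun y => spinConn γ (θ y) (s y)) _ x := he ▸ h1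
  refine ⟨h.differentiableAt, fun X => ?_⟩
  rw [h.fderiv]
  simp only [smul_apply, sum_apply, add_apply, ContinuousLinearMap.smulRight_apply,
    fderiv_linearMap_apply _ hs, spinConn_apply_apply, ← smul_add, ← Finset.sum_add_distrib]
  congr 1
  refine Finset.sum_congr rfl fun j _ => Finset.sum_congr rfl fun k _ => ?_
  rw [add_comm]; rfl

/-- The zeroth order term of the spin connection. -/
def spinConnMap (γ : Fin n → Module.End ℝ S) (G : Eu n → Matrix (Fin n) (Fin n) ℝ)
    (b : Fin n → Eu n → Eu n) (x : Eu n) (u : S) : Eu n →ₗ[ℝ] S where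
  toFun X := spinConn γ (connForm G b x X) u
  map_add' X Y := by
    have : connForm G b x (X + Y) = connForm G b x X + connForm G b x Y := by
      ext a c
      simp only [connForm, ← covDerivMap_apply, map_add, metricInner_add_left, Pi.add_apply]
    rw [this, map_add, LinearMap.add_apply]
  map_smul' r X := by
    have : connForm G b x (r • X) = r • connForm G b x X := by
      ext a c
      simp only [connForm, ← covDerivMap_apply, map_smul, metricInner_smul_left, Pi.smul_apply,
        smul_eq_mul]
    rw [this, map_smul, LinearMap.smul_apply, RingHom.id_apply]

/-- The spin connection, for a representation on a real inner product space, acting on spinor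
fields defined near `x`. -/
def spinorDeriv (γ : Fin n → Module.End ℝ S) (G : Eu n → Matrix (Fin n) (Fin n) ℝ)
    (b : Fin n → Eu n → Eu n) (s : Eu n → S) (x : Eu n) : Eu n →ₗ[ℝ] S :=
  (fderiv ℝ s x).toLinearMap + spinConnMap γ G b x (s x)

theorem spinorDeriv_apply (s : Eu n → S) (X : Eu n) :
    spinorDeriv γ G b s x X = fderiv ℝ s x X + spinConn γ (connForm G b x X) (s x) := rfl

theorem spinorDeriv_eq_sum (s : Eu n → S) (X : Eu n) :
    spinorDeriv γ G b s x X = ∑ j, X j • spinorDeriv γ G b s x (stdVec j) := by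
  conv_lhs => rw [← sum_smul_stdVec X]
  simp

/-- The curvature of the spin connection in coordinate directions: the commutator of `∇_i` and `∇_j`
is the action of the curvature form of the frame, regarded as an infinitesimal rotation. -/
theorem spinorDeriv_curvature (hγ : IsClifford γ) (hG : IsRiemannianMetricOn G U) (hU : IsOpen U)
    (hb : IsOrientedOrthonormalFrame G U b) (hx : x ∈ U) {s : Eu n → S}
    (hs : ContDiffAt ℝ 2 s x) (j : Fin n) :
    DifferentiableAt ℝ (fun y => spinorDeriv γ G b s y (stdVec j)) x ∧ ∀ i,
    (fderiv ℝ (fun y => spinorDeriv γ G b s y (stdVec j)) x (stdVec i) +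
        spinConn γ (connForm G b x (stdVec i)) (spinorDeriv γ G b s x (stdVec j))) -
      (fderiv ℝ (fun y => spinorDeriv γ G b s y (stdVec i)) x (stdVec j) +
        spinConn γ (connForm G b x (stdVec j)) (spinorDeriv γ G b s x (stdVec i))) =
      spinConn γ (curvForm G b x i j) (s x) := by
  have hθ : ∀ j a c, DifferentiableAt ℝ (fun y => connForm G b y (stdVec j) a c) x := fun j a c =>
    ((contDiffOn_connForm hG hU hb j a c).contDiffAt (hU.mem_nhds hx)).differentiableAt (by simp)
  have hs1 : DifferentiableAt ℝ s x := hs.differentiableAt (by simp)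
  have hs2 : ∀ j, DifferentiableAt ℝ (fun y => fderiv ℝ s y (stdVec j)) x := fun j =>
    ((hs.fderiv_right (m := 1) (by norm_num)).differentiableAt (by simp)).clm_apply
      (differentiableAt_const _)
  have hc := fun j => hasFDerivAt_spinConn (γ := γ) (hθ j) hs1
  refine ⟨(hs2 j).add (hc j).1, fun i => ?_⟩
  have hf : ∀ i j, fderiv ℝ (fun y => spinorDeriv γ G b s y (stdVec j)) x (stdVec i) =
      fderiv ℝ (fun y => fderiv ℝ s y (stdVec j)) x (stdVec i) +
      (spinConn γ (fun a c => partialDeriv i (fun y => connForm G b y (stdVec j) a c) x) (s x) +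
        spinConn γ (connForm G b x (stdVec j)) (fderiv ℝ s x (stdVec i))) := by
    intro i j
    simp only [spinorDeriv_apply]
    rw [fderiv_fun_add (hs2 j) (hc j).1, add_apply, (hc j).2]
    rfl
  rw [hf, hf, fderiv_fderiv_comm hs (stdVec j) (stdVec i), spinorDeriv_apply, spinorDeriv_apply,
    map_add, map_add]
  have hcc := congrArg (fun T : Module.End ℝ S => T (s x)) (hγ.commutator_commutator
    (θ := connForm G b x (stdVec i)) (η := connForm G b x (stdVec j))
    (connForm_antisymm hG hU hb hx _))
  simp only [← spinConn_apply, LinearMap.sub_apply, Module.End.mul_apply] at hcc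
  have hcurv : curvForm G b x i j =
      (fun a c => partialDeriv i (fun y => connForm G b y (stdVec j) a c) x) -
      (fun a c => partialDeriv j (fun y => connForm G b y (stdVec i) a c) x) +
      (fun a c => -∑ d, (connForm G b x (stdVec i) a d * connForm G b x (stdVec j) d c -
      connForm G b x (stdVec j) a d * connForm G b x (stdVec i) d c)) := by
    ext a c
    simp only [curvForm, Pi.add_apply, Pi.sub_apply]
    ring
  rw [hcurv, map_add, map_sub, LinearMap.add_apply, LinearMap.sub_apply, ← hcc]
  abel

/-- The vector field whose divergence is the difference of the two sides of the Lichnerowicz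
formula. -/
def lichnerowiczField (γ : Fin n → Module.End ℝ S) (G : Eu n → Matrix (Fin n) (Fin n) ℝ)
    (b : Fin n → Eu n → Eu n) (s : Eu n → S) (y : Eu n) : Eu n :=
  ∑ a, (∑ c, inner ℝ (cliffordWedge γ a c (spinorDeriv γ G b s y (b c y))) (s y)) • b a y

/-- The Lichnerowicz formula, in divergence form. -/
theorem divergence_lichnerowiczField (hγ : IsClifford γ) (hsk : IsSkew γ)
    (hG : IsRiemannianMetricOn G U) (hU : IsOpen U)
    (hb : IsOrientedOrthonormalFrame G U b) (hx : x ∈ U) {s : Eu n → S}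
    (hs : ContDiffAt ℝ 2 s x) :
    divergence (fun y => √(G y).det • lichnerowiczField γ G b s y) x = √(G x).det *
      (∑ a, ‖spinorDeriv γ G b s x (b a x)‖ ^ 2 - ‖∑ a, γ a (spinorDeriv γ G b s x (b a x))‖ ^ 2 +
        1 / 4 * scalarCurvature G x * ‖s x‖ ^ 2) := by
  have hs1 : DifferentiableAt ℝ s x := hs.differentiableAt (by simp)
  have hbd := hb.differentiableAt hU hx
  set θ : Fin n → Fin n → Fin n → ℝ := fun d a c => connForm G b x (b d x) a c with hθdef
  have hθ : ∀ d a c, θ d a c = -θ d c a := fun d => connForm_antisymm hG hU hb hx _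
  set u : Fin n → Eu n → S := fun j y => spinorDeriv γ G b s y (stdVec j) with hu
  have hud : ∀ j, DifferentiableAt ℝ (u j) x := fun j =>
    (spinorDeriv_curvature hγ hG hU hb hx hs j).1
  set D : Fin n → Eu n → S := fun c y => spinorDeriv γ G b s y (b c y) with hD
  have hDe : ∀ c, D c = fun y => ∑ j, b c y j • u j y := fun c => by
    funext y; exact spinorDeriv_eq_sum s _
  have hbj : ∀ c j, HasFDerivAt (fun y => b c y j)
      ((PiLp.proj (𝕜 := ℝ) 2 (fun _ : Fin n => ℝ) j).comp (fderiv ℝ (b c) x)) x := fun c j =>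
    ((PiLp.proj (𝕜 := ℝ) 2 (fun _ : Fin n => ℝ) j).hasFDerivAt (x := b c x)).comp x
      (hbd c).hasFDerivAt
  have hDd : ∀ c, HasFDerivAt (D c) (∑ j, (b c x j • fderiv ℝ (u j) x +
      ((PiLp.proj (𝕜 := ℝ) 2 (fun _ : Fin n => ℝ) j).comp (fderiv ℝ (b c) x)).smulRight
        (u j x))) x := fun c => by
    rw [hDe]
    exact HasFDerivAt.fun_sum fun j _ => (hbj c j).smul (hud j).hasFDerivAt
  set f : Fin n → Eu n → ℝ := fun a y => ∑ c, inner ℝ (cliffordWedge γ a c (D c y)) (s y) with hf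
  have hCd : ∀ a c, DifferentiableAt ℝ (fun y => cliffordWedge γ a c (D c y)) x := fun a c =>
    differentiableAt_linearMap_apply _ (hDd c).differentiableAt
  have hfd : ∀ a, DifferentiableAt ℝ (f a) x := fun a =>
    DifferentiableAt.fun_sum fun c _ => (hCd a c).inner ℝ hs1
  have hfa : ∀ a X, fderiv ℝ (f a) x X = ∑ c, (inner ℝ (cliffordWedge γ a c (fderiv ℝ (D c) x X)) (s x)
      + inner ℝ (cliffordWedge γ a c (D c x)) (fderiv ℝ s x X)) := by
    intro a X
    rw [hf]
    simp only
    rw [fderiv_fun_sum fun c _ => (hCd a c).inner ℝ hs1, sum_apply]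
    refine Finset.sum_congr rfl fun c _ => ?_
    rw [fderiv_inner_apply ℝ (hCd a c) hs1, fderiv_linearMap_apply _ (hDd c).differentiableAt,
      add_comm]
  -- The divergence of `∑ f_a b_a` in the frame: the derivatives of the components, and the
  -- connection form that measures the divergence of the `b_a`.
  have htr : LinearMap.trace ℝ (Eu n) (covDerivMap G (lichnerowiczField γ G b s) x) =
      ∑ a, fderiv ℝ (f a) x (b a x) + ∑ d, ∑ a, θ d a d * f a x := by
    rw [trace_eq_sum_metricInner (Fintype.card_fin n) (hb.2.1 x hx), ← Finset.sum_add_distrib]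
    refine Finset.sum_congr rfl fun d _ => ?_
    rw [covDerivMap_apply]
    have e : lichnerowiczField γ G b s = fun y => ∑ a, f a y • b a y := rfl
    rw [e, covDeriv_sum fun a _ => (hfd a).fun_smul (hbd a), metricInner_sum_left]
    simp only [covDeriv_smul (hfd _) (hbd _), metricInner_add_left, metricInner_smul_left,
      hb.2.1 x hx, Finset.sum_add_distrib, mul_ite, mul_one, mul_zero, Finset.sum_ite_eq',
      Finset.mem_univ, if_true]
    congr 1
    exact Finset.sum_congr rfl fun a _ => mul_comm _ _
  have hXd : DifferentiableAt ℝ (lichnerowiczField γ G b s) x :=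
    DifferentiableAt.fun_sum fun a _ => (hfd a).smul (hbd a)
  rw [divergence_sqrt_det_smul hG hU hx hXd, htr]
  congr 1
  have hmain := sum_inner_cliffordWedge hγ hsk hθ (s x) (fun c => D c x)
    (fun a => fderiv ℝ s x (b a x)) (fun a c => fderiv ℝ (D c) x (b a x)) (fun a => rfl)
  simp only [hfa]
  rw [hmain, sum_inner_cliffordWedge_self hsk]
  -- The covariant second derivative of `s` in the frame.
  set K : Fin n → Fin n → S := fun p q => fderiv ℝ (D q) x (b p x) +
    spinConn γ (θ p) (D q x) - ∑ d, θ p q d • D d x with hK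
  -- In coordinates the connection form of the frame cancels against the derivatives of the `b_q`,
  -- and the Christoffel term is symmetric in `p`, `q`.
  have hK1 : ∀ p q, K p q = ∑ i, ∑ j, (b p x i * b q x j) •
      (fderiv ℝ (u j) x (stdVec i) + spinConn γ (connForm G b x (stdVec i)) (u j x)) -
      spinorDeriv γ G b s x (christoffelMap G x (b p x) (b q x)) := by
    intro p q
    have e1 : ∑ d, θ p q d • D d x = spinorDeriv γ G b s x (covDeriv G Set.univ (b q) x (b p x)) := by
      rw [covDeriv_frame hb hx, map_sum]
      simp only [map_smul]
      rfl
    have e2 : ∑ j, (fderiv ℝ (b q) x (b p x)) j • u j x =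
        spinorDeriv γ G b s x (fderiv ℝ (b q) x (b p x)) := (spinorDeriv_eq_sum s _).symm
    have e3 : fderiv ℝ (D q) x (b p x) = ∑ j, b q x j • fderiv ℝ (u j) x (b p x) +
        spinorDeriv γ G b s x (fderiv ℝ (b q) x (b p x)) := by
      rw [(hDd q).fderiv, ← e2, ← Finset.sum_add_distrib]
      simp only [sum_apply, add_apply, smul_apply, ContinuousLinearMap.smulRight_apply]
      rfl
    have e4 : spinConn γ (θ p) = ∑ i, b p x i • spinConn γ (connForm G b x (stdVec i)) := by
      have : θ p = ∑ i, b p x i • connForm G b x (stdVec i) := by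
        ext a c
        simp only [hθdef, Finset.sum_apply, Pi.smul_apply, smul_eq_mul]
        exact connForm_eq_sum _ a c
      rw [this, map_sum]
      simp only [map_smul]
    have e5 : ∀ j, fderiv ℝ (u j) x (b p x) = ∑ i, b p x i • fderiv ℝ (u j) x (stdVec i) := by
      intro j
      conv_lhs => rw [← sum_smul_stdVec (b p x)]
      simp only [map_sum, map_smul]
    have e6 : D q x = ∑ j, b q x j • u j x := congrFun (hDe q) x
    have e7 : ∑ j, b q x j • fderiv ℝ (u j) x (b p x) + spinConn γ (θ p) (D q x) =
        ∑ i, ∑ j, (b p x i * b q x j) •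
      (fderiv ℝ (u j) x (stdVec i) + spinConn γ (connForm G b x (stdVec i)) (u j x)) := by
      rw [e4, e6]
      simp only [e5, smul_add, Finset.sum_add_distrib, LinearMap.sum_apply, LinearMap.smul_apply,
        map_sum, map_smul, Finset.smul_sum, smul_smul]
      congr 1 <;>
      · rw [Finset.sum_comm]
        refine Finset.sum_congr rfl fun i _ => Finset.sum_congr rfl fun j _ => ?_
        rw [mul_comm]
    simp only [hK]
    rw [e1, e3, ← e7, covDeriv_univ, map_add]
    abel
  -- Its antisymmetric part is the curvature of the spin connection.
  have hK2 : ∀ p q, K p q - K q p = spinConn γ (frameCurv G b x p q) (s x) := by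
    intro p q
    rw [hK1, hK1, christoffelMap_comm hG hU hx (b q x) (b p x), sub_sub_sub_cancel_right]
    conv_lhs =>
      arg 2
      rw [Finset.sum_comm]
    have e : frameCurv G b x p q = ∑ i, ∑ j, (b p x i * b q x j) • curvForm G b x i j := by
      ext a c
      simp only [frameCurv, Finset.sum_apply, Pi.smul_apply, smul_eq_mul]
    rw [e, map_sum, LinearMap.sum_apply, ← Finset.sum_sub_distrib]
    refine Finset.sum_congr rfl fun i _ => ?_
    rw [map_sum, LinearMap.sum_apply, ← Finset.sum_sub_distrib]
    refine Finset.sum_congr rfl fun j _ => ?_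
    rw [map_smul, LinearMap.smul_apply, ← (spinorDeriv_curvature hγ hG hU hb hx hs j).2 i, smul_sub,
      mul_comm (b q x j)]
  rw [sum_inner_cliffordWedge_curv hγ hsk (R := frameCurv G b x) frameCurv_antisymm
    (frameCurv_bianchi hG hU hb hx) (s x) K hK2, sum_frameCurv_eq_scalarCurvature hG hU hb hx]
  ring

end SpinField

/-! ### Tangential calculus on the boundary -/

section BoundaryFrame

variable {n : ℕ} {G : Eu n → Matrix (Fin n) (Fin n) ℝ} {Ω U : Set (Eu n)} {x : Eu n}

/-- Gram–Schmidt for the metric at a point, obtained from an orthogonal basis of the bilinear form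
restricted to `T`. -/
theorem exists_metricInner_orthonormal (hG : (G x).PosDef) (T : Submodule ℝ (Eu n)) {d : ℕ}
    (hd : Module.finrank ℝ T = d) :
    ∃ e : Fin d → Eu n, (∀ k, e k ∈ T) ∧
      ∀ k l, metricInner G x (e k) (e l) = if k = l then 1 else 0 := by
  subst hd
  let B : LinearMap.BilinForm ℝ T := (metricBilin G x).compl₁₂ T.subtype T.subtype
  have hBa : ∀ u v : T, B u v = metricInner G x u v := fun u v => rfl
  have hB : LinearMap.IsSymm B := ⟨fun u v => by
    simpa [hBa] using metricInner_comm hG (u : Eu n) v⟩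
  have : Invertible (2 : ℝ) := invertibleOfNonzero two_ne_zero
  obtain ⟨e, he⟩ := LinearMap.BilinForm.exists_orthogonal_basis hB
  have hpos : ∀ k, 0 < metricInner G x (e k) (e k) := fun k =>
    metricInner_self_pos hG fun h => e.ne_zero k (by simpa using h)
  refine ⟨fun k => (√(metricInner G x (e k) (e k)))⁻¹ • (e k : Eu n),
    fun k => T.smul_mem _ (e k).2, fun k l => ?_⟩
  rw [metricInner_smul_left, metricInner_smul_right]
  split_ifs with h
  · subst h
    have h1 := Real.mul_self_sqrt (hpos k).le
    have h2 := (Real.sqrt_pos.2 (hpos k)).ne'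
    field_simp
    rw [sq, h1]
  · have h1 : metricInner G x (e k) (e l) = 0 := he h
    rw [h1]; ring

theorem IsGraphChart.finrank_tangentSpace {v : Eu n} {f : Eu n → ℝ} {V : Set (Eu n)}
    (hc : IsGraphChart Ω v f V) (hx : x ∈ V) (hfx : f x = 0) :
    Module.finrank ℝ (tangentSpace (frontier Ω) x) = n - 1 := by
  rw [hc.tangentSpace_eq hx hfx]
  have h := LinearMap.finrank_range_add_finrank_ker (fderiv ℝ f x).toLinearMap
  have h1 : LinearMap.range (fderiv ℝ f x).toLinearMap = ⊤ := by
    refine LinearMap.range_eq_top.2 (LinearMap.surjective ?_)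
    intro h0
    exact hc.fderiv_ne_zero x (by ext ξ; exact congrArg (fun L => L ξ) h0)
  rw [h1, finrank_top, Module.finrank_self, finrank_euclideanSpace, Fintype.card_fin] at h
  omega

variable (hΩ : IsSmoothCompactDomain Ω) (hΩU : Ω ⊆ U) (hG : IsRiemannianMetricOn G U)
  (hx : x ∈ frontier Ω)
include hΩ hΩU hG hx

theorem posDef_of_mem_frontier : (G x).PosDef := hG.2 x (hΩU (hΩ.frontier_subset hx))

/-- The chosen normal has the properties by which it is chosen, because a graph chart supplies one.
-/
theorem isOutwardUnitNormal_outwardNormal :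
    IsOutwardUnitNormal G Ω x (outwardNormal G Ω x) := by
  obtain ⟨v, f, V, hc, hxV⟩ := hΩ.exists_isGraphChart hx
  have hfx := (hc.mem_frontier_iff hxV).1 hx
  have hGx := posDef_of_mem_frontier hΩ hΩU hG hx
  rw [hc.outwardNormal_eq hxV hfx hGx]
  exact hc.isOutwardUnitNormal_gradNormal hxV hfx hGx

/-- The chosen tangent frame is one, because the tangent space of a graph chart has dimension `n -
1`. -/
theorem isTangentFrame_tangentFrame :
    IsTangentFrame G (frontier Ω) x (tangentFrame G (frontier Ω) x) := by
  obtain ⟨v, f, V, hc, hxV⟩ := hΩ.exists_isGraphChart hx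
  have hfx := (hc.mem_frontier_iff hxV).1 hx
  exact Classical.epsilon_spec (exists_metricInner_orthonormal
    (posDef_of_mem_frontier hΩ hΩU hG hx) _ (hc.finrank_tangentSpace hxV hfx))

end BoundaryFrame

section Option

variable {n : ℕ} {G : Eu n → Matrix (Fin n) (Fin n) ℝ} {Ω U : Set (Eu n)} {x : Eu n}

/-- The outward unit normal together with a tangent frame is an orthonormal basis. -/
theorem metricInner_normal_tangent (hΩ : IsSmoothCompactDomain Ω) (hΩU : Ω ⊆ U)
    (hG : IsRiemannianMetricOn G U) (hx : x ∈ frontier Ω) {e : Fin (n - 1) → Eu n}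
    (he : IsTangentFrame G (frontier Ω) x e) (k l : Option (Fin (n - 1))) :
    metricInner G x (k.elim (outwardNormal G Ω x) e) (l.elim (outwardNormal G Ω x) e) =
      if k = l then 1 else 0 := by
  have hν := isOutwardUnitNormal_outwardNormal hΩ hΩU hG hx
  have hGx := posDef_of_mem_frontier hΩ hΩU hG hx
  rcases k with _ | k <;> rcases l with _ | l
  · simpa using hν.1
  · simpa using hν.2.1 _ (he.1 l)
  · rw [metricInner_comm hGx]
    simpa using hν.2.1 _ (he.1 k)
  · simpa using he.2 k l

theorem card_option_fin_sub_one (hn : n ≠ 0) : Fintype.card (Option (Fin (n - 1))) = n := by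
  simp; omega

end Option

section TangentialDerivative

variable {n : ℕ} {Ω : Set (Eu n)} {x : Eu n} {F : Type*} [NormedAddCommGroup F] [NormedSpace ℝ F]

/-- On a hypersurface the derivative is determined on tangent vectors only. -/
theorem fderivWithin_apply_of_mem_tangentSpace {S : Set (Eu n)} {g : Eu n → F}
    {L : Eu n →L[ℝ] F} (hg : HasFDerivWithinAt g L S x) {ξ : Eu n} (hξ : ξ ∈ tangentSpace S x) :
    fderivWithin ℝ g S x ξ = L ξ := by
  have h1 := hg.differentiableWithinAt.hasFDerivWithinAt.unique_on hg
  exact LinearMap.eqOn_span (f := (fderivWithin ℝ g S x).toLinearMap) (g := L.toLinearMap) h1 hξ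

theorem fderivWithin_eq_fderiv_of_mem_tangentSpace {S : Set (Eu n)} {g g' : Eu n → F}
    (hg' : DifferentiableAt ℝ g' x) (h : g =ᶠ[𝓝[S] x] g') (hx : x ∈ S) {ξ : Eu n}
    (hξ : ξ ∈ tangentSpace S x) : fderivWithin ℝ g S x ξ = fderiv ℝ g' x ξ :=
  fderivWithin_apply_of_mem_tangentSpace
    (hg'.hasFDerivAt.hasFDerivWithinAt.congr_of_eventuallyEq h (h.self_of_nhdsWithin hx)) hξ

/-- The projection of a graph chart along `v` onto the boundary. -/
def graphProj (v : Eu n) (f : Eu n → ℝ) (x : Eu n) : Eu n := x - f x • v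

/-- The part of a graph chart that projects into the chart. -/
def graphDomain (v : Eu n) (f : Eu n → ℝ) (V : Set (Eu n)) : Set (Eu n) :=
  V ∩ graphProj v f ⁻¹' V

variable {v : Eu n} {f : Eu n → ℝ} {V : Set (Eu n)}

namespace IsGraphChart

variable (hc : IsGraphChart Ω v f V)
include hc

theorem contDiff_graphProj : ContDiff ℝ 4 (graphProj v f) :=
  contDiff_id.sub (hc.contDiff.smul contDiff_const)

theorem isOpen_graphDomain : IsOpen (graphDomain v f V) :=
  hc.isOpen.inter (hc.isOpen.preimage hc.contDiff_graphProj.continuous)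

theorem graphProj_eq_self (hx : x ∈ V) (hxΩ : x ∈ frontier Ω) : graphProj v f x = x := by
  rw [graphProj, (hc.mem_frontier_iff hx).1 hxΩ, zero_smul, sub_zero]

theorem mem_graphDomain (hx : x ∈ V) (hxΩ : x ∈ frontier Ω) : x ∈ graphDomain v f V :=
  ⟨hx, by rw [Set.mem_preimage, hc.graphProj_eq_self hx hxΩ]; exact hx⟩

theorem graphProj_mem_frontier (hx : x ∈ graphDomain v f V) : graphProj v f x ∈ frontier Ω :=
  (hc.mem_frontier_iff hx.2).2 (hc.apply_proj x)

/-- A smooth function on the boundary extends to a neighbourhood, constantly along `v`. -/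
theorem contDiffOn_comp_graphProj {k : WithTop ℕ∞} (hk : k ≤ 4) {g : Eu n → F}
    (hg : ContDiffOn ℝ k g (frontier Ω)) :
    ContDiffOn ℝ k (fun x => g (graphProj v f x)) (graphDomain v f V) :=
  hg.comp (hc.contDiff_graphProj.of_le hk).contDiffOn fun _ hx => hc.graphProj_mem_frontier hx

theorem eventuallyEq_comp_graphProj (hx : x ∈ V) (g : Eu n → F) :
    g =ᶠ[𝓝[frontier Ω] x] fun x => g (graphProj v f x) := by
  filter_upwards [mem_nhdsWithin_of_mem_nhds (hc.isOpen.mem_nhds hx), self_mem_nhdsWithin]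
    with y hy hyf
  rw [hc.graphProj_eq_self hy hyf]

end IsGraphChart

end TangentialDerivative

section TangentialDivergence

variable {n : ℕ} {G : Eu n → Matrix (Fin n) (Fin n) ℝ} {Ω U : Set (Eu n)} {x : Eu n}
  {W : Eu n → Eu n}

/-- The divergence as the sum of the partial derivatives of the components. -/
theorem divergence_eq_sum_partialDeriv {X : Eu n → Eu n} (hX : DifferentiableAt ℝ X x) :
    divergence X x = ∑ i, partialDeriv i (fun y => X y i) x := by
  have hb : ∀ v : Eu n, ∀ k, (EuclideanSpace.basisFun (Fin n) ℝ).toBasis.repr v k = v k := by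
    intro v k; simp
  rw [divergence, LinearMap.trace_eq_matrix_trace ℝ (EuclideanSpace.basisFun (Fin n) ℝ).toBasis,
    Matrix.trace]
  simp only [Matrix.diag_apply, LinearMap.toMatrix_apply, hb]
  refine Finset.sum_congr rfl fun i _ => ?_
  have h2 := ((PiLp.proj (𝕜 := ℝ) 2 (fun _ : Fin n => ℝ) i).hasFDerivAt (x := X x)).comp x
    hX.hasFDerivAt
  have h3 := congrArg (fun L : Eu n →L[ℝ] ℝ => L (stdVec i)) h2.fderiv
  simp only [OrthonormalBasis.coe_toBasis, EuclideanSpace.basisFun_apply]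
  exact h3.symm

/-- The Leibniz rule for the Riemannian divergence. -/
theorem trace_covDerivMap_smul {φ : Eu n → ℝ} {Y : Eu n → Eu n} (hφ : DifferentiableAt ℝ φ x)
    (hY : DifferentiableAt ℝ Y x) :
    LinearMap.trace ℝ (Eu n) (covDerivMap G (fun y => φ y • Y y) x) =
      φ x * LinearMap.trace ℝ (Eu n) (covDerivMap G Y x) + fderiv ℝ φ x (Y x) := by
  have h : covDerivMap G (fun y => φ y • Y y) x =
      φ x • covDerivMap G Y x + (fderiv ℝ φ x).toLinearMap.smulRight (Y x) := by
    ext1 X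
    rw [covDerivMap_apply, covDeriv_smul hφ hY]
    simp only [LinearMap.add_apply, LinearMap.smul_apply, LinearMap.smulRight_apply,
      covDerivMap_apply]
    exact add_comm _ _
  rw [h, map_add, map_smul, LinearMap.trace_smulRight, smul_eq_mul]
  rfl

/-- The divergence `∇_j (ν^i W^j - ν^j W^i)` of a bivector field. -/
def bivectorDiv (G : Eu n → Matrix (Fin n) (Fin n) ℝ) (ν W : Eu n → Eu n) (y : Eu n) : Eu n :=
  LinearMap.trace ℝ (Eu n) (covDerivMap G W y) • ν y + covDeriv G Set.univ ν y (W y) -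
    (LinearMap.trace ℝ (Eu n) (covDerivMap G ν y) • W y + covDeriv G Set.univ W y (ν y))

/-- Times the volume density, `bivectorDiv` is the coordinate divergence of an antisymmetric array
of functions. The Christoffel symbols drop out by their symmetry. -/
theorem sqrt_det_mul_bivectorDiv (hG : IsRiemannianMetricOn G U) (hU : IsOpen U) (hx : x ∈ U)
    {ν : Eu n → Eu n} (hν : DifferentiableAt ℝ ν x) (hW : DifferentiableAt ℝ W x) (i : Fin n) :
    √(G x).det * bivectorDiv G ν W x i =
      ∑ j, partialDeriv j (fun y => √(G y).det * (ν y i * W y j - ν y j * W y i)) x := by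
  have hcomp : ∀ {Y : Eu n → Eu n}, DifferentiableAt ℝ Y x → ∀ k, HasFDerivAt (fun y => Y y k)
      ((PiLp.proj (𝕜 := ℝ) 2 (fun _ : Fin n => ℝ) k).comp (fderiv ℝ Y x)) x := fun hY k =>
    ((PiLp.proj (𝕜 := ℝ) 2 (fun _ : Fin n => ℝ) k).hasFDerivAt).comp x hY.hasFDerivAt
  have hw := (hasFDerivAt_sqrt_det hG hU hx).1
  -- For each fixed `i` the array `Y^i Z^j` is a vector field in `j`, so the divergence formula for
  -- `Y^i Z` applies.
  have hkey : ∀ {Y Z : Eu n → Eu n}, DifferentiableAt ℝ Y x → DifferentiableAt ℝ Z x →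
      ∑ j, partialDeriv j (fun y => √(G y).det * (Y y i * Z y j)) x =
        √(G x).det * (Y x i * LinearMap.trace ℝ (Eu n) (covDerivMap G Z x) +
          fderiv ℝ Y x (Z x) i) := by
    intro Y Z hY hZ
    have hd : DifferentiableAt ℝ (fun y => Y y i • Z y) x :=
      (hcomp hY i).differentiableAt.smul hZ
    have h1 := divergence_sqrt_det_smul hG hU hx hd
    rw [divergence_eq_sum_partialDeriv (hw.fun_smul hd),
      trace_covDerivMap_smul (hcomp hY i).differentiableAt hZ, (hcomp hY i).fderiv] at h1
    exact h1
  have hsub : ∀ j, partialDeriv j (fun y => √(G y).det * (ν y i * W y j - ν y j * W y i)) x =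
      partialDeriv j (fun y => √(G y).det * (ν y i * W y j)) x -
        partialDeriv j (fun y => √(G y).det * (W y i * ν y j)) x := by
    intro j
    rw [← partialDeriv_sub]
    · congr 1; funext y; ring
    · exact hw.fun_mul ((hcomp hν i).differentiableAt.fun_mul (hcomp hW j).differentiableAt)
    · exact hw.fun_mul ((hcomp hW i).differentiableAt.fun_mul (hcomp hν j).differentiableAt)
  simp only [hsub, Finset.sum_sub_distrib]
  rw [hkey hν hW, hkey hW hν, ← mul_sub]
  congr 1
  simp only [bivectorDiv, covDeriv_univ, christoffelMap_comm hG hU hx (W x) (ν x), PiLp.sub_apply,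
    PiLp.add_apply, PiLp.smul_apply, smul_eq_mul]
  ring

/-- The divergence of a bivector field is divergence free: it is a double divergence `∑ ∂_i ∂_j
a_{ij}` with `a` antisymmetric, and partial derivatives commute. -/
theorem divergence_bivectorDiv (hG : IsRiemannianMetricOn G U) (hU : IsOpen U) (hx : x ∈ U)
    {ν : Eu n → Eu n} (hν : ContDiffOn ℝ 2 ν U) (hW : ContDiffOn ℝ 2 W U)
    (hd : DifferentiableAt ℝ (fun y => √(G y).det • bivectorDiv G ν W y) x) :
    divergence (fun y => √(G y).det • bivectorDiv G ν W y) x = 0 := by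
  set a : Fin n → Fin n → Eu n → ℝ := fun i j y =>
    √(G y).det * (ν y i * W y j - ν y j * W y i) with ha
  have hac : ∀ i j, ContDiffAt ℝ 2 (a i j) x := fun i j => by
    have h1 := contDiffOn_euclidean.1 hν
    have h2 := contDiffOn_euclidean.1 hW
    exact (((contDiffOn_sqrt_det hG).of_le ENat.LEInfty.out).mul
      (((h1 i).mul (h2 j)).sub ((h1 j).mul (h2 i)))).contDiffAt (hU.mem_nhds hx)
  have hanti : ∀ i j, a i j = fun y => -a j i y := fun i j => by
    funext y; simp only [ha]; ring
  have hdd : ∀ i j, DifferentiableAt ℝ (partialDeriv j (a i j)) x := fun i j =>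
    ((((hac i j).fderiv_right (m := 1) (by norm_num)).differentiableAt (by simp)).clm_apply
      (differentiableAt_const _))
  have h1 : ∀ i, partialDeriv i (fun y => (√(G y).det • bivectorDiv G ν W y) i) x =
      ∑ j, partialDeriv i (partialDeriv j (a i j)) x := by
    intro i
    rw [← partialDeriv_sum fun j _ => hdd i j]
    refine partialDeriv_congr ?_ i
    filter_upwards [hU.mem_nhds hx] with y hy
    have hyν := (hν.contDiffAt (hU.mem_nhds hy)).differentiableAt (by simp)
    have hyW := (hW.contDiffAt (hU.mem_nhds hy)).differentiableAt (by simp)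
    rw [PiLp.smul_apply, smul_eq_mul]
    exact sqrt_det_mul_bivectorDiv hG hU hy hyν hyW i
  rw [divergence_eq_sum_partialDeriv hd]
  simp only [h1]
  -- The sum equals its own negative.
  have h2 : ∑ i, ∑ j, partialDeriv i (partialDeriv j (a i j)) x =
      -∑ i, ∑ j, partialDeriv i (partialDeriv j (a i j)) x := by
    conv_lhs => rw [Finset.sum_comm]
    simp only [← Finset.sum_neg_distrib]
    refine Finset.sum_congr rfl fun i _ => Finset.sum_congr rfl fun j _ => ?_
    rw [partialDeriv_comm (hac j i), hanti j i]
    have h3 : partialDeriv j (fun y => -a i j y) = fun y => -partialDeriv j (a i j) y := by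
      funext y
      simp only [partialDeriv]
      rw [fderiv_fun_neg]; rfl
    rw [h3]
    simp only [partialDeriv]
    rw [fderiv_fun_neg]; rfl
  linarith

/-- The divergence of the tangential part of a field along the boundary:
`∑ g(∇_{e_k} W, e_k) - H g(W, ν)`. -/
def boundaryDiv (G : Eu n → Matrix (Fin n) (Fin n) ℝ) (Ω : Set (Eu n)) (W : Eu n → Eu n)
    (x : Eu n) : ℝ :=
  ∑ k, metricInner G x (covDeriv G (frontier Ω) W x (tangentFrame G (frontier Ω) x k))
    (tangentFrame G (frontier Ω) x k) - meanCurvature G Ω x * metricInner G x (W x)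
      (outwardNormal G Ω x)

variable (hΩ : IsSmoothCompactDomain Ω) (hn : n ≠ 0) (hU : IsOpen U) (hΩU : Ω ⊆ U)
  (hG : IsRiemannianMetricOn G U)

include hΩ hΩU hG in
/-- A tangential covariant derivative along the boundary may be computed with any differentiable
extension of the field. -/
theorem covDeriv_frontier_eq (hx : x ∈ frontier Ω) {W' : Eu n → Eu n}
    (hW' : DifferentiableAt ℝ W' x) (h : W =ᶠ[𝓝[frontier Ω] x] W') (k : Fin (n - 1)) :
    covDeriv G (frontier Ω) W x (tangentFrame G (frontier Ω) x k) =
      covDeriv G Set.univ W' x (tangentFrame G (frontier Ω) x k) := by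
  rw [covDeriv_eq, covDeriv_univ, h.self_of_nhdsWithin hx,
    fderivWithin_eq_fderiv_of_mem_tangentSpace hW' h hx
      ((isTangentFrame_tangentFrame hΩ hΩU hG hx).1 k)]

include hΩ hΩU hG hn in
/-- The divergence at a boundary point, split into its normal and tangential parts. -/
theorem trace_covDerivMap_boundary (hx : x ∈ frontier Ω) (W' : Eu n → Eu n) :
    LinearMap.trace ℝ (Eu n) (covDerivMap G W' x) =
      metricInner G x (covDeriv G Set.univ W' x (outwardNormal G Ω x)) (outwardNormal G Ω x) +
      ∑ k, metricInner G x (covDeriv G Set.univ W' x (tangentFrame G (frontier Ω) x k))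
        (tangentFrame G (frontier Ω) x k) := by
  rw [trace_eq_sum_metricInner (card_option_fin_sub_one hn) (metricInner_normal_tangent hΩ hΩU hG hx
    (isTangentFrame_tangentFrame hΩ hΩU hG hx)), Fintype.sum_option]
  simp only [covDerivMap_apply]
  rfl

include hU hΩU hG in
/-- The derivatives of the unit field `gradNormal` are orthogonal to it. -/
theorem metricInner_covDeriv_gradNormal {v : Eu n} {f : Eu n → ℝ} {V : Set (Eu n)}
    (hc : IsGraphChart Ω v f V) (hx : x ∈ U) (X : Eu n) :
    metricInner G x (covDeriv G Set.univ (gradNormal G f) x X) (gradNormal G f x) = 0 := by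
  have hd : DifferentiableAt ℝ (gradNormal G f) x :=
    ((hc.contDiffOn_gradNormal hG).contDiffAt (hU.mem_nhds hx)).differentiableAt (by simp)
  have h := (hasFDerivAt_metricInner hG hU hx hd hd).2 X
  have h0 : (fun y => metricInner G y (gradNormal G f y) (gradNormal G f y)) =ᶠ[𝓝 x]
      fun _ => 1 := by
    filter_upwards [hU.mem_nhds hx] with y hy
      using metricInner_gradNormal_self (hG.2 y hy) (hc.fderiv_ne_zero y)
  rw [h0.fderiv_eq, metricInner_comm (hG.2 x hx) (gradNormal G f x)] at h
  simp only [fderiv_fun_const, Pi.zero_apply, zero_apply] at h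
  linarith

include hΩ hΩU hG in
theorem eventuallyEq_outwardNormal {v : Eu n} {f : Eu n → ℝ} {V : Set (Eu n)}
    (hc : IsGraphChart Ω v f V) (hxV : x ∈ V) :
    outwardNormal G Ω =ᶠ[𝓝[frontier Ω] x] gradNormal G f := by
  filter_upwards [mem_nhdsWithin_of_mem_nhds (hc.isOpen.mem_nhds hxV), self_mem_nhdsWithin]
    with y hy hyf
  exact hc.outwardNormal_eq hy ((hc.mem_frontier_iff hy).1 hyf)
    (posDef_of_mem_frontier hΩ hΩU hG hyf)

include hΩ hn hU hΩU hG in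
/-- The mean curvature is the full divergence of the extension `gradNormal` of the unit normal,
whose normal derivative has no normal component. -/
theorem meanCurvature_eq_trace {v : Eu n} {f : Eu n → ℝ} {V : Set (Eu n)}
    (hc : IsGraphChart Ω v f V) (hxV : x ∈ V) (hx : x ∈ frontier Ω) :
    meanCurvature G Ω x = LinearMap.trace ℝ (Eu n) (covDerivMap G (gradNormal G f) x) := by
  have hxU := hΩU (hΩ.frontier_subset hx)
  have hd : DifferentiableAt ℝ (gradNormal G f) x :=
    ((hc.contDiffOn_gradNormal hG).contDiffAt (hU.mem_nhds hxU)).differentiableAt (by simp)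
  have hev := eventuallyEq_outwardNormal hΩ hΩU hG hc hxV
  rw [trace_covDerivMap_boundary hΩ hn hΩU hG hx, hev.self_of_nhdsWithin hx,
    metricInner_covDeriv_gradNormal hU hΩU hG hc hxU, zero_add, meanCurvature]
  refine Finset.sum_congr rfl fun k _ => ?_
  rw [secondFundamentalForm, covDeriv_frontier_eq hΩ hΩU hG hx hd hev]

include hΩ hn hU hΩU hG in
/-- Along the boundary, the normal component of the divergence of the bivector `ν ∧ W` is the
divergence of the tangential part of `W`. -/
theorem boundaryDiv_eq_metricInner {v : Eu n} {f : Eu n → ℝ} {V : Set (Eu n)}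
    (hc : IsGraphChart Ω v f V) (hxV : x ∈ V) (hx : x ∈ frontier Ω) {W' : Eu n → Eu n}
    (hW' : DifferentiableAt ℝ W' x) (h : W =ᶠ[𝓝[frontier Ω] x] W') :
    boundaryDiv G Ω W x =
      metricInner G x (bivectorDiv G (gradNormal G f) W' x) (outwardNormal G Ω x) := by
  have hxU := hΩU (hΩ.frontier_subset hx)
  have hev := (eventuallyEq_outwardNormal hΩ hΩU hG hc hxV).self_of_nhdsWithin hx
  rw [boundaryDiv, meanCurvature_eq_trace hΩ hn hU hΩU hG hc hxV hx, h.self_of_nhdsWithin hx]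
  simp only [covDeriv_frontier_eq hΩ hΩU hG hx hW' h]
  have h1 := trace_covDerivMap_boundary hΩ hn hΩU hG hx W'
  rw [bivectorDiv, metricInner_sub_left, metricInner_add_left, metricInner_add_left,
    metricInner_smul_left, metricInner_smul_left, ← hev,
    (isOutwardUnitNormal_outwardNormal hΩ hΩU hG hx).1, hev,
    metricInner_covDeriv_gradNormal hU hΩU hG hc hxU, ← hev]
  linarith

theorem contDiffOn_trace_covDerivMap {k m : WithTop ℕ∞} (hG : IsRiemannianMetricOn G U)
    (hU : IsOpen U) (hm : m ≤ ∞) (hk : m + 1 ≤ k) {Y : Eu n → Eu n} (hY : ContDiffOn ℝ k Y U) :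
    ContDiffOn ℝ m (fun y => LinearMap.trace ℝ (Eu n) (covDerivMap G Y y)) U := by
  have hb : ∀ v : Eu n, ∀ k, (EuclideanSpace.basisFun (Fin n) ℝ).toBasis.repr v k = v k := by
    intro v k; simp
  have h : ∀ y, LinearMap.trace ℝ (Eu n) (covDerivMap G Y y) =
      ∑ i, covDeriv G Set.univ Y y (stdVec i) i := by
    intro y
    rw [LinearMap.trace_eq_matrix_trace ℝ (EuclideanSpace.basisFun (Fin n) ℝ).toBasis,
      Matrix.trace]
    simp only [Matrix.diag_apply, LinearMap.toMatrix_apply, hb, covDerivMap_apply]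
    simp only [OrthonormalBasis.coe_toBasis, EuclideanSpace.basisFun_apply]
    rfl
  simp only [h]
  exact ContDiffOn.sum fun i _ => contDiffOn_euclidean.1
    (contDiffOn_covDeriv hG hU hm hk hY contDiffOn_const) i

theorem contDiffOn_bivectorDiv (hG : IsRiemannianMetricOn G U) (hU : IsOpen U) {ν : Eu n → Eu n}
    (hν : ContDiffOn ℝ 2 ν U) (hW : ContDiffOn ℝ 2 W U) :
    ContDiffOn ℝ 1 (bivectorDiv G ν W) U := by
  have h1 : (1 : WithTop ℕ∞) ≤ ∞ := ENat.LEInfty.out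
  have h2 : (1 : WithTop ℕ∞) + 1 ≤ 2 := by norm_num
  have hν1 : ContDiffOn ℝ 1 ν U := hν.of_le (by norm_num)
  have hW1 : ContDiffOn ℝ 1 W U := hW.of_le (by norm_num)
  exact (((contDiffOn_trace_covDerivMap hG hU h1 h2 hW).smul hν1).add
    (contDiffOn_covDeriv hG hU h1 h2 hν hW1)).sub
    (((contDiffOn_trace_covDerivMap hG hU h1 h2 hν).smul hW1).add
    (contDiffOn_covDeriv hG hU h1 h2 hW hν1))

include hΩ hn hU hΩU hG in
theorem continuousOn_meanCurvature : ContinuousOn (meanCurvature G Ω) (frontier Ω) := by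
  refine hΩ.continuousOn_frontier fun v f V x hc hxV hfx => ⟨fun x =>
    LinearMap.trace ℝ (Eu n) (covDerivMap G (gradNormal G f) x), ?_, ?_⟩
  · have hxU := hΩU ((hc.mem_iff x hxV).2 hfx.le)
    exact ((contDiffOn_trace_covDerivMap (m := 1) hG hU ENat.LEInfty.out (by norm_num)
      (hc.contDiffOn_gradNormal hG)).continuousOn.continuousAt
      (hU.mem_nhds hxU)).continuousWithinAt
  · intro y hy hyf _
    exact meanCurvature_eq_trace hΩ hn hU hΩU hG hc hy hyf

include hΩ hΩU hG in
theorem boundaryDiv_sum {ι : Type*} (t : Finset ι) {Wi : ι → Eu n → Eu n} (hx : x ∈ frontier Ω)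
    (hWi : ∀ i ∈ t, DifferentiableWithinAt ℝ (Wi i) (frontier Ω) x)
    (hW : ∀ y ∈ frontier Ω, W y = ∑ i ∈ t, Wi i y) :
    boundaryDiv G Ω W x = ∑ i ∈ t, boundaryDiv G Ω (Wi i) x := by
  have hd : HasFDerivWithinAt W (∑ i ∈ t, fderivWithin ℝ (Wi i) (frontier Ω) x) (frontier Ω) x :=
    (HasFDerivWithinAt.fun_sum fun i hi => (hWi i hi).hasFDerivWithinAt).congr hW (hW x hx)
  simp only [boundaryDiv, covDeriv_eq, Finset.sum_sub_distrib]
  congr 1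
  · rw [Finset.sum_comm]
    refine Finset.sum_congr rfl fun k _ => ?_
    rw [fderivWithin_apply_of_mem_tangentSpace hd
      ((isTangentFrame_tangentFrame hΩ hΩU hG hx).1 k), hW x hx, sum_apply, map_sum,
      ← Finset.sum_add_distrib, metricInner_sum_left]
  · rw [hW x hx, metricInner_sum_left, Finset.mul_sum]

include hΩ hn hU hΩU hG in
/-- The divergence theorem on the closed hypersurface `∂Ω`. Locally `W` is extended to a
neighbourhood of the boundary, with compact support by a partition of unity; then its boundary
divergence is the flux of the divergence free field `bivectorDiv` through `∂Ω`. -/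
theorem surfaceIntegral_boundaryDiv (hW : ContDiffOn ℝ 2 W (frontier Ω)) :
    ContinuousOn (boundaryDiv G Ω W) (frontier Ω) ∧
      surfaceIntegral G (frontier Ω) (boundaryDiv G Ω W) = 0 := by
  classical
  have hex : ∀ x : Eu n, ∃ v f V, x ∈ frontier Ω → IsGraphChart Ω v f V ∧ x ∈ V := fun x => by
    by_cases hx : x ∈ frontier Ω
    · obtain ⟨v, f, V, h⟩ := hΩ.exists_isGraphChart hx
      exact ⟨v, f, V, fun _ => h⟩
    · exact ⟨0, 0, ∅, fun h => absurd h hx⟩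
  choose v f V hV using hex
  obtain ⟨t, φ, hφ, hsum⟩ := exists_smooth_partition hΩ.isCompact_frontier
    (fun x => graphDomain (v x) (f x) (V x))
    fun x hx => ⟨(hV x hx).1.isOpen_graphDomain, (hV x hx).1.mem_graphDomain (hV x hx).2 hx⟩
  -- The extensions: `W` is known on the boundary only, so it is pulled back along the projection of
  -- the chart and then cut off.
  set W' : Eu n → Eu n → Eu n := fun i y => φ i y • W (graphProj (v i) (f i) y) with hW'def
  have hW' : ∀ i ∈ t, ContDiff ℝ 2 (W' i) := fun i hi => by
    obtain ⟨hiK, hφs, -, hφt⟩ := hφ i hi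
    rw [contDiff_iff_contDiffAt]
    intro y
    by_cases hy : y ∈ tsupport (φ i)
    · exact ((hφs.of_le ENat.LEInfty.out).contDiffAt).smul
        (((hV i hiK).1.contDiffOn_comp_graphProj (by norm_num) hW).contDiffAt
          ((hV i hiK).1.isOpen_graphDomain.mem_nhds (hφt hy)))
    · refine contDiffAt_const (c := (0 : Eu n)) |>.congr_of_eventuallyEq ?_
      filter_upwards [notMem_tsupport_iff_eventuallyEq.1 hy] with z hz
      simp only [hW'def, hz, Pi.zero_apply, zero_smul]
  set X : Eu n → Eu n → Eu n := fun i => bivectorDiv G (gradNormal G (f i)) (W' i) with hXdef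
  have hν : ∀ i ∈ t, ContDiffOn ℝ 2 (gradNormal G (f i)) U := fun i hi =>
    ((hV i (hφ i hi).1).1.contDiffOn_gradNormal hG).of_le (by norm_num)
  have hX : ∀ i ∈ t, ContDiffOn ℝ 1 (X i) U := fun i hi =>
    contDiffOn_bivectorDiv hG hU (hν i hi) (hW' i hi).contDiffOn
  have hint : ∀ i ∈ t, surfaceIntegral G (frontier Ω) (fun x =>
      metricInner G x (X i x) (outwardNormal G Ω x)) = 0 := fun i hi => by
    rw [← hΩ.integral_divergence hn hU hΩU hG ((hX i hi).mono hΩU)]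
    refine setIntegral_eq_zero_of_forall_eq_zero fun x hx => ?_
    have hxU := hU.mem_nhds (hΩU hx)
    exact divergence_bivectorDiv hG hU (hΩU hx) (hν i hi) (hW' i hi).contDiffOn
      ((hasFDerivAt_sqrt_det hG hU (hΩU hx)).1.smul
        (((hX i hi).contDiffAt hxU).differentiableAt (by simp)))
  -- The pieces `φ_i W` agree along the boundary with their extensions.
  have hpt : ∀ i ∈ t, ∀ x ∈ frontier Ω, boundaryDiv G Ω (fun y => φ i y • W y) x =
      metricInner G x (X i x) (outwardNormal G Ω x) := by
    intro i hi x hx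
    obtain ⟨hiK, hφs, -, hφt⟩ := hφ i hi
    have hd := ((hW' i hi).differentiable (by simp)) x
    by_cases hxV : x ∈ V i
    · refine boundaryDiv_eq_metricInner hΩ hn hU hΩU hG (hV i hiK).1 hxV hx hd ?_
      filter_upwards [(hV i hiK).1.eventuallyEq_comp_graphProj hxV W] with y hy
      rw [hy]
    -- Off the chart both sides vanish, because the cut-off does.
    · have hxt : x ∉ tsupport (φ i) := fun h => hxV (hφt h).1
      have hφ0 := notMem_tsupport_iff_eventuallyEq.1 hxt
      have hW0 : W' i =ᶠ[𝓝 x] fun _ => 0 := by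
        filter_upwards [hφ0] with z hz
        simp only [hW'def, hz, Pi.zero_apply, zero_smul]
      have hW1 : (fun y => φ i y • W y) =ᶠ[𝓝[frontier Ω] x] W' i := by
        filter_upwards [mem_nhdsWithin_of_mem_nhds hφ0] with z hz
        have hz' : φ i z = 0 := hz
        simp only [hW'def, hz', zero_smul]
      have e0 : W' i x = 0 := hW0.self_of_nhds
      have e1 : covDerivMap G (W' i) x = 0 := by
        rw [covDerivMap, hW0.fderiv_eq, e0]
        simp
      have e2 : ∀ ξ, covDeriv G Set.univ (W' i) x ξ = 0 := fun ξ => by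
        rw [← covDerivMap_apply, e1]; rfl
      have e3 : X i x = 0 := by
        simp only [hXdef, bivectorDiv, e1, e2, e0]
        rw [← covDerivMap_apply]
        simp
      have e4 : φ i x • W x = 0 := by rw [hφ0.self_of_nhds, Pi.zero_apply, zero_smul]
      rw [e3, metricInner_zero_left, boundaryDiv, e4, metricInner_zero_left, mul_zero, sub_zero]
      refine Finset.sum_eq_zero fun k _ => ?_
      rw [covDeriv_frontier_eq hΩ hΩU hG hx hd hW1, e2, metricInner_zero_left]
  have hWsum : ∀ x ∈ frontier Ω, boundaryDiv G Ω W x =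
      ∑ i ∈ t, metricInner G x (X i x) (outwardNormal G Ω x) := by
    intro x hx
    rw [boundaryDiv_sum hΩ hΩU hG t (Wi := fun i y => φ i y • W y) hx
      (fun i hi => (((hφ i hi).2.1.differentiable (by simp)) x).differentiableWithinAt.smul
        ((hW x hx).differentiableWithinAt (by simp)))
      (fun y hy => by rw [← Finset.sum_smul, hsum y hy, one_smul])]
    exact Finset.sum_congr rfl fun i hi => hpt i hi x hx
  have hcont : ∀ i ∈ t, ContinuousOn (fun x => metricInner G x (X i x) (outwardNormal G Ω x))
      (frontier Ω) := fun i hi => by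
    have hsub := hΩ.frontier_subset.trans hΩU
    have h1 := (hX i hi).continuousOn.mono hsub
    have h2 := continuousOn_outwardNormal hΩ hU hΩU hG
    have h3 : ∀ i j, ContinuousOn (fun x => G x i j) (frontier Ω) := fun i j =>
      (hG.1 i j).continuousOn.mono hsub
    simp only [metricInner]
    fun_prop
  refine ⟨(continuousOn_finsetSum _ hcont).congr hWsum, ?_⟩
  have e : surfaceIntegral G (frontier Ω) (boundaryDiv G Ω W) =
      surfaceIntegral G (frontier Ω) (fun x => ∑ i ∈ t, metricInner G x (X i x)
        (outwardNormal G Ω x)) := by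
    refine setIntegral_congr_fun isClosed_frontier.measurableSet fun x hx => ?_
    simp only [hWsum x hx]
  rw [e, surfaceIntegral]
  simp only [Finset.smul_sum]
  rw [integral_finsetSum]
  · exact Finset.sum_eq_zero hint
  · intro i hi
    exact hΩ.integrableOn_frontier hn
      ((continuousOn_surfaceDensity hΩ hU hΩU hG).smul (hcont i hi))

end TangentialDivergence

/-! ### Spinors along the boundary -/

section CliffordAction

variable {n : ℕ} {S : Type*} [NormedAddCommGroup S] [InnerProductSpace ℝ S]
variable {γ τ : Fin n → Module.End ℝ S}

/-- The Clifford action `∑ c_a γ_a` of a vector with components `c_a`. -/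
def cliffordSum (γ : Fin n → Module.End ℝ S) : (Fin n → ℝ) →ₗ[ℝ] Module.End ℝ S where
  toFun c := ∑ a, c a • γ a
  map_add' c d := by simp only [Pi.add_apply, add_smul, Finset.sum_add_distrib]
  map_smul' r c := by
    simp only [Pi.smul_apply, smul_eq_mul, mul_smul, ← Finset.smul_sum, RingHom.id_apply]

theorem cliffordSum_apply (c : Fin n → ℝ) (u : S) : cliffordSum γ c u = ∑ a, c a • γ a u := by
  simp [cliffordSum, LinearMap.sum_apply]

theorem IsSkew.cliffordSum (hs : IsSkew γ) (c : Fin n → ℝ) (u v : S) :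
    inner ℝ (cliffordSum γ c u) v = -inner ℝ u (cliffordSum γ c v) := by
  simp only [cliffordSum_apply, sum_inner, inner_sum, real_inner_smul_left, real_inner_smul_right,
    hs _ u v, mul_neg, Finset.sum_neg_distrib]

theorem IsClifford.cliffordSum_cliffordSum (hγ : IsClifford γ) (c : Fin n → ℝ) (u : S) :
    cliffordSum γ c (cliffordSum γ c u) = -((∑ a, c a ^ 2) • u) := by
  have h1 : cliffordSum γ c (cliffordSum γ c u) = ∑ a, ∑ d, (c a * c d) • γ a (γ d u) := by
    simp only [cliffordSum_apply, map_sum, map_smul, Finset.smul_sum, smul_smul]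
    rw [Finset.sum_comm]
    exact Finset.sum_congr rfl fun a _ => Finset.sum_congr rfl fun d _ => by rw [mul_comm]
  have h2 : cliffordSum γ c (cliffordSum γ c u) = ∑ a, ∑ d, (c a * c d) • γ d (γ a u) := by
    rw [h1, Finset.sum_comm]
    exact Finset.sum_congr rfl fun a _ => Finset.sum_congr rfl fun d _ => by rw [mul_comm]
  have h3 : (2 : ℝ) • cliffordSum γ c (cliffordSum γ c u) = -((2 : ℝ) • (∑ a, c a ^ 2) • u) := by
    rw [two_smul, congrArg₂ (· + ·) h1 h2]
    simp only [← Finset.sum_add_distrib, ← smul_add, hγ.apply, smul_neg, ite_smul, zero_smul,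
      smul_ite, smul_zero, Finset.sum_neg_distrib, Finset.sum_ite_eq, Finset.mem_univ, if_true]
    rw [Finset.sum_smul, Finset.smul_sum]
    congr 1
    exact Finset.sum_congr rfl fun a _ => by module
  have h4 := congrArg (fun w => (1 / 2 : ℝ) • w) h3
  simpa [smul_smul] using h4

theorem inner_cliffordSum_cliffordSum (hγ : IsClifford γ) (hs : IsSkew γ) (c : Fin n → ℝ)
    (u v : S) : inner ℝ (cliffordSum γ c u) (cliffordSum γ c v) = (∑ a, c a ^ 2) * inner ℝ u v := by
  rw [hs.cliffordSum, hγ.cliffordSum_cliffordSum, inner_neg_right, neg_neg, real_inner_smul_right]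

theorem norm_cliffordSum (hγ : IsClifford γ) (hs : IsSkew γ) {c : Fin n → ℝ}
    (hc : ∑ a, c a ^ 2 = 1) (u : S) : ‖cliffordSum γ c u‖ = ‖u‖ := by
  have h := inner_cliffordSum_cliffordSum hγ hs c u u
  rw [hc, one_mul, real_inner_self_eq_norm_sq, real_inner_self_eq_norm_sq] at h
  exact (sq_eq_sq₀ (norm_nonneg _) (norm_nonneg _)).1 h

theorem cliffordSum_comm (hcomm : ∀ a c, Commute (γ a) (τ c)) (c d : Fin n → ℝ) :
    Commute (cliffordSum γ c) (cliffordSum τ d) :=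
  Commute.sum_left _ _ _ fun a _ => Commute.sum_right _ _ _ fun e _ =>
    ((hcomm a e).smul_left _).smul_right _

theorem commute_spinConn (hcomm : ∀ a c, Commute (γ a) (τ c)) (θ : Fin n → Fin n → ℝ)
    (d : Fin n → ℝ) : Commute (spinConn γ θ) (cliffordSum τ d) := by
  rw [spinConn_apply]
  exact (Commute.sum_left _ _ _ fun j _ => Commute.sum_left _ _ _ fun k _ =>
    (Commute.mul_left (Commute.sum_right _ _ _ fun e _ => (hcomm j e).smul_right _)
      (Commute.sum_right _ _ _ fun e _ => (hcomm k e).smul_right _)).smul_left _).smul_left _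

variable {G : Eu n → Matrix (Fin n) (Fin n) ℝ} {U : Set (Eu n)}
  {b : Fin n → Eu n → Eu n} {x : Eu n}

/-- Clifford multiplication by a tangent vector. -/
def cliffordAct (γ : Fin n → Module.End ℝ S) (G : Eu n → Matrix (Fin n) (Fin n) ℝ)
    (b : Fin n → Eu n → Eu n) (x : Eu n) : Eu n →ₗ[ℝ] Module.End ℝ S :=
  cliffordSum γ ∘ₗ LinearMap.pi fun a => (metricBilin G x).flip (b a x)

theorem cliffordAct_eq (ξ : Eu n) :
    cliffordAct γ G b x ξ = cliffordSum γ fun a => metricInner G x ξ (b a x) := rfl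

/-- Parseval in the frame. -/
theorem sum_sq_metricInner_frame (hb : IsOrientedOrthonormalFrame G U b) (hx : x ∈ U) (ξ : Eu n) :
    ∑ a, metricInner G x ξ (b a x) ^ 2 = metricInner G x ξ ξ := by
  rw [metricInner_eq_sum_mul (Fintype.card_fin n) (hb.2.1 x hx)]
  exact Finset.sum_congr rfl fun a _ => sq _

/-- A contraction of a frame against itself does not depend on the frame. -/
theorem sum_frame_eq_sum {ι : Type*} [Fintype ι] [DecidableEq ι] (hι : Fintype.card ι = n)
    (hG : (G x).PosDef) {e : ι → Eu n}
    (he : ∀ k l, metricInner G x (e k) (e l) = if k = l then 1 else 0) (D : Eu n →ₗ[ℝ] S) :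
    ∑ a, γ a (D (b a x)) = ∑ k, cliffordAct γ G b x (e k) (D (e k)) := by
  have h1 : ∀ a, γ a (D (b a x)) = ∑ k, metricInner G x (b a x) (e k) • γ a (D (e k)) := by
    intro a
    conv_lhs => rw [← sum_metricInner_smul hι he (b a x)]
    simp only [map_sum, map_smul]
  simp only [h1, cliffordAct_eq, cliffordSum_apply]
  rw [Finset.sum_comm]
  refine Finset.sum_congr rfl fun k _ => Finset.sum_congr rfl fun a _ => ?_
  rw [metricInner_comm hG]

end CliffordAction

section Pairing

variable {n : ℕ} {S : Type*} [NormedAddCommGroup S] [InnerProductSpace ℝ S] [FiniteDimensional ℝ S]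
variable {γ τ : Fin n → Module.End ℝ S} {G : Eu n → Matrix (Fin n) (Fin n) ℝ} {U : Set (Eu n)}
  {b : Fin n → Eu n → Eu n} {x : Eu n}

/-- The vector field `∑ ⟨γ_a u, v⟩ b_a` associated with two spinor fields. -/
def pairingField (γ : Fin n → Module.End ℝ S) (b : Fin n → Eu n → Eu n) (u v : Eu n → S)
    (y : Eu n) : Eu n :=
  ∑ a, inner ℝ (γ a (u y)) (v y) • b a y

theorem metricInner_pairingField (hG : (G x).PosDef) (u v : Eu n → S) (ξ : Eu n) :
    metricInner G x (pairingField γ b u v x) ξ = inner ℝ (cliffordAct γ G b x ξ (u x)) (v x) := by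
  rw [pairingField, metricInner_sum_left, cliffordAct_eq, cliffordSum_apply, sum_inner]
  refine Finset.sum_congr rfl fun a _ => ?_
  rw [metricInner_smul_left, real_inner_smul_left, metricInner_comm hG, mul_comm]

/-- Clifford multiplication is parallel and the spin connection is metric, so the pairing of two
spinor fields obeys a Leibniz rule. -/
theorem metricInner_covDeriv_pairingField (hγ : IsClifford γ) (hsk : IsSkew γ)
    (hG : IsRiemannianMetricOn G U) (hU : IsOpen U)
    (hb : IsOrientedOrthonormalFrame G U b) (hx : x ∈ U) {u v : Eu n → S}
    (hu : DifferentiableAt ℝ u x) (hv : DifferentiableAt ℝ v x) (X Y : Eu n) :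
    DifferentiableAt ℝ (pairingField γ b u v) x ∧
    metricInner G x (covDeriv G Set.univ (pairingField γ b u v) x X) Y =
      inner ℝ (cliffordAct γ G b x Y (spinorDeriv γ G b u x X)) (v x) +
        inner ℝ (cliffordAct γ G b x Y (u x)) (spinorDeriv γ G b v x X) := by
  have hd : ∀ a, DifferentiableAt ℝ (fun y => inner ℝ (γ a (u y)) (v y)) x := fun a =>
    (differentiableAt_linearMap_apply (γ a) hu).inner ℝ hv
  have hbd := hb.differentiableAt hU hx
  refine ⟨DifferentiableAt.fun_sum fun a _ => (hd a).smul (hbd a), ?_⟩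
  set θ := connForm G b x X with hθdef
  have hθ : ∀ a c, θ a c = -θ c a := connForm_antisymm hG hU hb hx X
  set P : Fin n → ℝ := fun a => inner ℝ (γ a (u x)) (v x) with hP
  have e1 : covDeriv G Set.univ (pairingField γ b u v) x X =
      ∑ a, (fderiv ℝ (fun y => inner ℝ (γ a (u y)) (v y)) x X • b a x +
        P a • ∑ c, θ a c • b c x) := by
    have : pairingField γ b u v = fun y => ∑ a, inner ℝ (γ a (u y)) (v y) • b a y := rfl
    rw [this, covDeriv_sum fun a _ => (hd a).fun_smul (hbd a)]
    refine Finset.sum_congr rfl fun a _ => ?_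
    rw [covDeriv_smul (hd a) (hbd a), covDeriv_frame hb hx]
  -- The connection terms of `u` and `v` combine into the commutator of `spinConn γ θ` with `γ_a`,
  -- which rotates the index `a` by `θ`.
  have e2 : ∀ a, fderiv ℝ (fun y => inner ℝ (γ a (u y)) (v y)) x X =
      inner ℝ (γ a (spinorDeriv γ G b u x X)) (v x) + inner ℝ (γ a (u x)) (spinorDeriv γ G b v x X)
        + ∑ k, θ a k * P k := by
    intro a
    have h1 := congrArg (fun T : Module.End ℝ S => inner ℝ (T (u x)) (v x)) (hγ.commutator hθ a)
    simp only [← spinConn_apply, LinearMap.sub_apply, Module.End.mul_apply, LinearMap.sum_apply,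
      LinearMap.smul_apply, inner_sub_left, sum_inner, real_inner_smul_left] at h1
    rw [inner_spinConn hγ hsk hθ] at h1
    rw [fderiv_inner_apply ℝ (differentiableAt_linearMap_apply (γ a) hu) hv,
      fderiv_linearMap_apply _ hu, spinorDeriv_apply, spinorDeriv_apply, map_add, inner_add_left,
      inner_add_right, ← h1]
    ring
  rw [e1, metricInner_sum_left]
  simp only [metricInner_add_left, metricInner_smul_left, metricInner_sum_left, e2,
    Finset.sum_add_distrib]
  set y : Fin n → ℝ := fun a => metricInner G x (b a x) Y with hy
  have e3 : ∀ w : S, cliffordAct γ G b x Y w = ∑ a, y a • γ a w := by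
    intro w
    rw [cliffordAct_eq, cliffordSum_apply]
    exact Finset.sum_congr rfl fun a _ => by rw [metricInner_comm (hG.2 x hx)]
  rw [e3, e3, sum_inner, sum_inner]
  simp only [real_inner_smul_left, add_mul, Finset.sum_add_distrib]
  -- This rotation is undone by the derivatives of the frame, because `θ` is antisymmetric.
  have e4 : ∑ a, (∑ k, θ a k * P k) * y a + ∑ a, P a * ∑ c, θ a c * y c = 0 := by
    simp only [Finset.sum_mul, Finset.mul_sum]
    conv_lhs => arg 1; rw [Finset.sum_comm]
    rw [← Finset.sum_add_distrib]
    refine Finset.sum_eq_zero fun a _ => ?_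
    rw [← Finset.sum_add_distrib]
    refine Finset.sum_eq_zero fun c _ => ?_
    rw [hθ a c]; ring
  have e5 : ∀ w w' : Fin n → S, ∑ a, inner ℝ (w a) (w' a) * y a = ∑ a, y a * inner ℝ (w a) (w' a) :=
    fun w w' => Finset.sum_congr rfl fun a _ => mul_comm _ _
  rw [e5 (fun a => γ a (spinorDeriv γ G b u x X)) (fun _ => v x),
    e5 (fun a => γ a (u x)) (fun _ => spinorDeriv γ G b v x X)]
  linarith

/-- The Leibniz rule for the commuting Clifford action of a map into `ℝⁿ`. -/
theorem spinorDeriv_cliffordSum (hcomm : ∀ a c, Commute (γ a) (τ c)) {N : Eu n → Eu n}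
    {s : Eu n → S} (hN : DifferentiableAt ℝ N x) (hs : DifferentiableAt ℝ s x) (X : Eu n) :
    DifferentiableAt ℝ (fun y => cliffordSum τ (N y).ofLp (s y)) x ∧
    spinorDeriv γ G b (fun y => cliffordSum τ (N y).ofLp (s y)) x X =
      cliffordSum τ (N x).ofLp (spinorDeriv γ G b s x X) +
        cliffordSum τ (fderiv ℝ N x X).ofLp (s x) := by
  have hNa : ∀ a, HasFDerivAt (fun y => N y a)
      ((PiLp.proj (𝕜 := ℝ) 2 (fun _ : Fin n => ℝ) a).comp (fderiv ℝ N x)) x := fun a =>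
    ((PiLp.proj (𝕜 := ℝ) 2 (fun _ : Fin n => ℝ) a).hasFDerivAt).comp x hN.hasFDerivAt
  have h := HasFDerivAt.fun_sum (u := Finset.univ) fun a _ =>
    (hNa a).fun_smul (differentiableAt_linearMap_apply (τ a) hs).hasFDerivAt
  have he : (fun y => cliffordSum τ (N y).ofLp (s y)) = fun y => ∑ a, N y a • τ a (s y) := by
    funext y; exact cliffordSum_apply _ _
  rw [he]
  refine ⟨h.differentiableAt, ?_⟩
  rw [spinorDeriv_apply, h.fderiv, spinorDeriv_apply, ← cliffordSum_apply, map_add,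
    ← Module.End.mul_apply (spinConn γ _), (commute_spinConn hcomm _ _).eq, Module.End.mul_apply]
  simp only [sum_apply, add_apply, smul_apply, ContinuousLinearMap.smulRight_apply,
    fderiv_linearMap_apply _ hs, Finset.sum_add_distrib]
  rw [cliffordSum_apply _ (fderiv ℝ s x X), cliffordSum_apply _ (s x)]
  simp only [ContinuousLinearMap.comp_apply, PiLp.proj_apply]
  abel

end Pairing

/-! ### The trace norm -/

section SingularValues

/-- The singular value decomposition of a linear map between Euclidean spaces of equal dimension. -/
theorem exists_singular_value_decomposition {E F : Type*} [NormedAddCommGroup E]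
    [InnerProductSpace ℝ E] [FiniteDimensional ℝ E] [NormedAddCommGroup F] [InnerProductSpace ℝ F]
    [FiniteDimensional ℝ F] {d : ℕ} (hE : Module.finrank ℝ E = d) (hF : Module.finrank ℝ F = d)
    (L : E →ₗ[ℝ] F) :
    ∃ (u : OrthonormalBasis (Fin d) ℝ E) (f : OrthonormalBasis (Fin d) ℝ F) (lam : Fin d → ℝ),
      (∀ k, 0 ≤ lam k) ∧ ∀ k, L (u k) = lam k • f k := by
  set u := L.isSymmetric_adjoint_comp_self.eigenvectorBasis hE with hu
  set mu := L.isSymmetric_adjoint_comp_self.eigenvalues hE with hmu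
  have hmu0 : ∀ k, 0 ≤ mu k := L.isPositive_adjoint_comp_self.nonneg_eigenvalues hE
  have hinner : ∀ k l, inner ℝ (L (u k)) (L (u l)) = if k = l then mu k else 0 := by
    intro k l
    have h := L.isSymmetric_adjoint_comp_self.apply_eigenvectorBasis hE l
    rw [← LinearMap.adjoint_inner_right, ← LinearMap.comp_apply, h, inner_smul_right,
      orthonormal_iff_ite.1 u.orthonormal k l]
    split_ifs with hkl
    · subst hkl; simp [hmu]
    · simp
  -- The left singular vectors are the normalised images of the eigenvectors; those with eigenvalue
  -- `0` are completed arbitrarily to an orthonormal basis.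
  set v : Fin d → F := fun k => (√(mu k))⁻¹ • L (u k) with hv
  have hvo : Orthonormal ℝ (({k | mu k ≠ 0} : Set (Fin d)).domRestrict v) := by
    rw [orthonormal_iff_ite]
    rintro ⟨k, hk⟩ ⟨l, hl⟩
    simp only [Set.domRestrict_apply, hv, real_inner_smul_left, real_inner_smul_right, hinner,
      Subtype.mk.injEq]
    split_ifs with hkl
    · subst hkl
      have h1 := Real.mul_self_sqrt (hmu0 k)
      have h2 : √(mu k) ≠ 0 := fun h => hk (by rw [← h1, h, mul_zero])
      field_simp
      rw [sq, h1]
    · ring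
  obtain ⟨f, hf⟩ := hvo.exists_orthonormalBasis_extension_of_card_eq (by simpa using hF)
  refine ⟨u, f, fun k => √(mu k), fun k => Real.sqrt_nonneg _, fun k => ?_⟩
  by_cases hk : mu k = 0
  · have h := hinner k k
    rw [if_pos rfl, hk, inner_self_eq_zero] at h
    simp [h, hk]
  · have h2 : √(mu k) ≠ 0 := (Real.sqrt_pos.2 (lt_of_le_of_ne (hmu0 k) (Ne.symm hk))).ne'
    rw [hf k hk, hv]
    simp only [smul_smul]
    rw [mul_inv_cancel₀ h2, one_smul]

/-- The trace norm is the sum of the singular values: the isometry that carries `f k` to `e k`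
attains it, and no isometry exceeds it by the Cauchy–Schwarz inequality. -/
theorem traceNorm_eq_sum {V W : Type*} [AddCommGroup V] [Module ℝ V] [NormedAddCommGroup W]
    [InnerProductSpace ℝ W] {d : ℕ} (β : V →ₗ[ℝ] V →ₗ[ℝ] ℝ) (hsymm : ∀ u v, β u v = β v u)
    (hpos : ∀ v, 0 ≤ β v v) (e : Module.Basis (Fin d) ℝ V)
    (he : ∀ k l, β (e k) (e l) = if k = l then 1 else 0) (f : OrthonormalBasis (Fin d) ℝ W)
    {lam : Fin d → ℝ} (hlam : ∀ k, 0 ≤ lam k) {L : V →ₗ[ℝ] W} (hL : ∀ k, L (e k) = lam k • f k) :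
    traceNorm (fun u v => β u v) (fun w w' => inner ℝ w w') L = ∑ k, lam k := by
  have hrepr : ∀ v k, e.repr v k = β v (e k) := by
    intro v k
    conv_rhs => rw [← e.sum_repr v, map_sum, LinearMap.sum_apply]
    simp only [map_smul, LinearMap.smul_apply, he, smul_eq_mul, mul_ite, mul_one, mul_zero]
    simp
  have htr : ∀ Q : W →ₗ[ℝ] V, LinearMap.trace ℝ V (Q ∘ₗ L) = ∑ k, lam k * β (Q (f k)) (e k) := by
    intro Q
    rw [LinearMap.trace_eq_matrix_trace ℝ e, Matrix.trace]
    refine Finset.sum_congr rfl fun k _ => ?_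
    rw [Matrix.diag_apply, LinearMap.toMatrix_apply, hrepr, LinearMap.comp_apply, hL, map_smul,
      map_smul, LinearMap.smul_apply, smul_eq_mul]
  refine IsGreatest.csSup_eq ⟨⟨f.toBasis.constr ℝ e, fun w w' => ?_, ?_⟩, ?_⟩
  · have hQ : ∀ w, f.toBasis.constr ℝ e w = ∑ k, inner ℝ (f k) w • e k := by
      intro w
      rw [Module.Basis.constr_apply_fintype]
      simp [f.repr_apply_apply]
    simp only [hQ, map_sum, map_smul, LinearMap.sum_apply, LinearMap.smul_apply, he, smul_eq_mul,
      mul_ite, mul_one, mul_zero, Finset.sum_ite_eq', Finset.mem_univ, if_true]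
    rw [← f.sum_inner_mul_inner w w']
    refine Finset.sum_congr rfl fun k _ => ?_
    rw [real_inner_comm w]
    ring
  · rw [htr]
    refine Finset.sum_congr rfl fun k _ => ?_
    have h : f.toBasis.constr ℝ e (f k) = e k := by
      simpa only [OrthonormalBasis.coe_toBasis] using f.toBasis.constr_basis ℝ e k
    rw [h, he, if_pos rfl, mul_one]
  · rintro _ ⟨Q, hQ, rfl⟩
    rw [htr]
    refine Finset.sum_le_sum fun k _ => ?_
    have h1 : β (Q (f k)) (Q (f k)) = 1 := by
      simp [hQ]
    have h2 : β (e k) (e k) = 1 := by rw [he, if_pos rfl]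
    have h3 := hpos (Q (f k) - e k)
    simp only [map_sub, LinearMap.sub_apply] at h3
    rw [h1, h2, hsymm (e k)] at h3
    nlinarith [hlam k]

end SingularValues

section BoundaryMap

variable {n : ℕ} {G : Eu n → Matrix (Fin n) (Fin n) ℝ} {Ω U : Set (Eu n)} {x : Eu n}
  {N : Eu n → Eu n}
variable (hΩ : IsSmoothCompactDomain Ω) (hn : n ≠ 0) (hU : IsOpen U) (hΩU : Ω ⊆ U)
  (hG : IsRiemannianMetricOn G U)

/-- A `C¹` function on the boundary extends differentiably to a neighbourhood by composition with
the projection of a graph chart. -/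
theorem differentiableAt_comp_graphProj {F : Type*} [NormedAddCommGroup F] [NormedSpace ℝ F]
    {v : Eu n} {f : Eu n → ℝ} {V : Set (Eu n)} (hc : IsGraphChart Ω v f V) (hxV : x ∈ V)
    (hx : x ∈ frontier Ω) {g : Eu n → F} (hg : ContDiffOn ℝ 1 g (frontier Ω)) :
    DifferentiableAt ℝ (fun y => g (graphProj v f y)) x :=
  ((hc.contDiffOn_comp_graphProj (by norm_num) hg).contDiffAt
    (hc.isOpen_graphDomain.mem_nhds (hc.mem_graphDomain hxV hx))).differentiableAt (by simp)

include hΩ in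
/-- The differential of a map into the unit sphere is tangent to the sphere. -/
theorem inner_fderivWithin_sphere (hN : ContDiffOn ℝ 1 N (frontier Ω))
    (hN1 : ∀ y ∈ frontier Ω, ‖N y‖ = 1) (hx : x ∈ frontier Ω) {ξ : Eu n}
    (hξ : ξ ∈ tangentSpace (frontier Ω) x) :
    inner ℝ (fderivWithin ℝ N (frontier Ω) x ξ) (N x) = 0 := by
  obtain ⟨v, f, V, hc, hxV⟩ := hΩ.exists_isGraphChart hx
  have hd := differentiableAt_comp_graphProj hc hxV hx hN
  rw [fderivWithin_eq_fderiv_of_mem_tangentSpace hd (hc.eventuallyEq_comp_graphProj hxV N) hx hξ]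
  have h1 := fderiv_inner_apply ℝ hd hd ξ
  have h0 : (fun y => inner ℝ (N (graphProj v f y)) (N (graphProj v f y))) =ᶠ[𝓝 x]
      fun _ => (1 : ℝ) := by
    filter_upwards [hc.isOpen_graphDomain.mem_nhds (hc.mem_graphDomain hxV hx)] with y hy
    rw [real_inner_self_eq_norm_sq, hN1 _ (hc.graphProj_mem_frontier hy), one_pow]
  rw [h0.fderiv_eq, hc.graphProj_eq_self hxV hx, real_inner_comm] at h1
  simp only [fderiv_fun_const, Pi.zero_apply, zero_apply] at h1
  linarith

/-- The orthogonal projection in the definition of `sphereDifferential` has no effect on vectors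
that the differential already sends into the tangent space of the sphere. -/
theorem sphereDifferential_coe (ξ : tangentSpace (frontier Ω) x)
    (h : inner ℝ (fderivWithin ℝ N (frontier Ω) x ξ) (N x) = 0) :
    (sphereDifferential (frontier Ω) N x ξ : Eu n) = fderivWithin ℝ N (frontier Ω) x ξ := by
  have hmem : fderivWithin ℝ N (frontier Ω) x ξ ∈ ((ℝ ∙ N x)ᗮ : Submodule ℝ (Eu n)) := by
    rw [Submodule.mem_orthogonal_singleton_iff_inner_left]
    exact h
  exact Submodule.starProjection_eq_self_iff.2 hmem

include hΩ hΩU hG in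
/-- Singular vectors and singular values of the differential of a map from the boundary into the
unit sphere. -/
theorem exists_singular_frame (hn : n ≠ 0) (hN : ContDiffOn ℝ 1 N (frontier Ω))
    (hN1 : ∀ y ∈ frontier Ω, ‖N y‖ = 1) (hx : x ∈ frontier Ω) :
    ∃ (e f : Fin (n - 1) → Eu n) (lam : Fin (n - 1) → ℝ), IsTangentFrame G (frontier Ω) x e ∧
      Orthonormal ℝ f ∧ (∀ k, inner ℝ (f k) (N x) = 0) ∧ (∀ k, 0 ≤ lam k) ∧
      (∀ k, fderivWithin ℝ N (frontier Ω) x (e k) = lam k • f k) ∧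
      traceNormDifferential G (frontier Ω) N x = ∑ k, lam k := by
  have hGx := posDef_of_mem_frontier hΩ hΩU hG hx
  obtain ⟨he0, he1⟩ := isTangentFrame_tangentFrame hΩ hΩU hG hx
  set e₀ := tangentFrame G (frontier Ω) x
  let T := tangentSpace (frontier Ω) x
  have hT : Module.finrank ℝ T = n - 1 := by
    obtain ⟨v, f, V, hc, hxV⟩ := hΩ.exists_isGraphChart hx
    exact hc.finrank_tangentSpace hxV ((hc.mem_frontier_iff hxV).1 hx)
  have hNx : N x ≠ 0 := fun h => by simpa [h] using hN1 x hx
  have hW : Module.finrank ℝ ((ℝ ∙ N x)ᗮ : Submodule ℝ (Eu n)) = n - 1 := by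
    have : Fact (Module.finrank ℝ (Eu n) = (n - 1) + 1) := ⟨by simp; omega⟩
    exact Submodule.finrank_orthogonal_span_singleton hNx
  -- An isometry from the standard Euclidean space onto the tangent space with the metric, which
  -- carries no inner product instance of its own.
  let Φ : EuclideanSpace ℝ (Fin (n - 1)) →ₗ[ℝ] T :=
    (Fintype.linearCombination ℝ fun k => (⟨e₀ k, he0 k⟩ : T)) ∘ₗ
      (WithLp.linearEquiv 2 ℝ (Fin (n - 1) → ℝ)).toLinearMap
  have hΦ : ∀ y, (Φ y : Eu n) = ∑ k, y k • e₀ k := by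
    intro y
    simp [Φ, Fintype.linearCombination_apply]
  have hΦg : ∀ y z, metricInner G x (Φ y) (Φ z) = inner ℝ y z := by
    intro y z
    rw [hΦ, hΦ]
    simp [metricInner_sum_left, metricInner_sum_right, metricInner_smul_left,
      metricInner_smul_right, he1, PiLp.inner_apply, mul_comm]
  obtain ⟨u, f, lam, hlam, hL⟩ := exists_singular_value_decomposition (by simp) hW
    (sphereDifferential (frontier Ω) N x ∘ₗ Φ)
  have he : ∀ k l, metricInner G x (Φ (u k)) (Φ (u l)) = if k = l then 1 else 0 := fun k l => by
    rw [hΦg, orthonormal_iff_ite.1 u.orthonormal]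
  refine ⟨fun k => Φ (u k), fun k => f k, lam, ⟨fun k => (Φ (u k)).2, he⟩, ?_, ?_, hlam, ?_, ?_⟩
  · exact f.orthonormal.comp_linearIsometry ((ℝ ∙ N x)ᗮ).subtypeₗᵢ
  · intro k
    exact Submodule.mem_orthogonal_singleton_iff_inner_left.1 (f k).2
  · intro k
    rw [← sphereDifferential_coe (Φ (u k)) (inner_fderivWithin_sphere hΩ hN hN1 hx (Φ (u k)).2)]
    have := hL k
    rw [LinearMap.comp_apply] at this
    rw [this]
    rfl
  · have hli : LinearIndependent ℝ fun k => Φ (u k) := by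
      refine LinearIndependent.of_comp T.subtype ?_
      exact linearIndependent_of_metricInner he
    let B : Module.Basis (Fin (n - 1)) ℝ T := Module.Basis.mk hli (by
      rw [hli.span_eq_top_of_card_eq_finrank' (by simp [hT])])
    have hB : ∀ k, B k = Φ (u k) := fun k => Module.Basis.mk_apply _ _ k
    exact traceNorm_eq_sum ((metricBilin G x).compl₁₂ T.subtype T.subtype)
      (fun u v => metricInner_comm hGx (u : Eu n) v)
      (fun v => metricInner_self_nonneg hGx (v : Eu n)) B
      (fun k l => by rw [hB, hB]; exact he k l) f hlam
      (fun k => by rw [hB]; exact hL k)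

/-- The differential along the boundary, extended to all vectors by the orthogonal projection to the
tangent space. Unlike the differential it can be evaluated on the frame `b`, which depends smoothly
on the point. -/
def tangentialDeriv (G : Eu n → Matrix (Fin n) (Fin n) ℝ) (Ω : Set (Eu n)) (N : Eu n → Eu n)
    (x : Eu n) : Eu n →ₗ[ℝ] Eu n :=
  (fderivWithin ℝ N (frontier Ω) x).toLinearMap ∘ₗ
    (LinearMap.id - ((metricBilin G x).flip (outwardNormal G Ω x)).smulRight (outwardNormal G Ω x))

theorem tangentialDeriv_apply (ξ : Eu n) : tangentialDeriv G Ω N x ξ =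
    fderivWithin ℝ N (frontier Ω) x
      (ξ - metricInner G x ξ (outwardNormal G Ω x) • outwardNormal G Ω x) := rfl

include hΩ hΩU hG in
theorem tangentialDeriv_normal (hx : x ∈ frontier Ω) :
    tangentialDeriv G Ω N x (outwardNormal G Ω x) = 0 := by
  rw [tangentialDeriv_apply, (isOutwardUnitNormal_outwardNormal hΩ hΩU hG hx).1, one_smul, sub_self,
    map_zero]

include hΩ hΩU hG in
theorem tangentialDeriv_of_mem (hx : x ∈ frontier Ω) {ξ : Eu n}
    (hξ : ξ ∈ tangentSpace (frontier Ω) x) :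
    tangentialDeriv G Ω N x ξ = fderivWithin ℝ N (frontier Ω) x ξ := by
  rw [tangentialDeriv_apply, metricInner_comm (posDef_of_mem_frontier hΩ hΩU hG hx),
    (isOutwardUnitNormal_outwardNormal hΩ hΩU hG hx).2.1 ξ hξ, zero_smul, sub_zero]

include hΩ hΩU hG in
theorem sub_normal_mem_tangentSpace (hn : n ≠ 0) (hx : x ∈ frontier Ω) (ξ : Eu n) :
    ξ - metricInner G x ξ (outwardNormal G Ω x) • outwardNormal G Ω x ∈
      tangentSpace (frontier Ω) x := by
  have he := isTangentFrame_tangentFrame hΩ hΩU hG hx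
  have h := sum_metricInner_smul (card_option_fin_sub_one hn)
    (metricInner_normal_tangent hΩ hΩU hG hx he) ξ
  rw [Fintype.sum_option] at h
  simp only [Option.elim] at h
  rw [sub_eq_of_eq_add' h.symm]
  exact Submodule.sum_mem _ fun k _ => Submodule.smul_mem _ _ (he.1 k)

/-- The orthonormal families in `ℝⁿ`. -/
def orthonormalFrames (n : ℕ) : Set (Fin n → Eu n) :=
  {A | ∀ a c, inner ℝ (A a) (A c) = if a = c then (1 : ℝ) else 0}

theorem isCompact_orthonormalFrames : IsCompact (orthonormalFrames n) := by
  refine Metric.isCompact_of_isClosed_isBounded ?_ ?_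
  · simp only [orthonormalFrames, Set.ofPred_forall]
    exact isClosed_iInter fun a => isClosed_iInter fun c =>
      isClosed_eq (by fun_prop) continuous_const
  · refine (Metric.isBounded_closedBall (x := (0 : Fin n → Eu n)) (r := 1)).subset fun A hA => ?_
    rw [mem_closedBall_zero_iff, pi_norm_le_iff_of_nonneg zero_le_one]
    intro a
    have h := hA a a
    rw [if_pos rfl, real_inner_self_eq_norm_sq] at h
    nlinarith [norm_nonneg (A a)]

/-- The maximum of `∑ ⟨C_a, A_a⟩` over the orthonormal frames `A`. -/
def frameSup (C : Fin n → Eu n) : ℝ :=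
  sSup ((fun A : Fin n → Eu n => ∑ a, inner ℝ (C a) (A a)) '' orthonormalFrames n)

theorem continuous_frameSup : Continuous (frameSup (n := n)) :=
  isCompact_orthonormalFrames.continuous_sSup
    (f := fun (C A : Fin n → Eu n) => ∑ a, inner ℝ (C a) (A a)) (by
      unfold Function.HasUncurry.uncurry Function.hasUncurryInduction
      simp only [Function.HasUncurry.uncurry, id]
      fun_prop)

variable {b : Fin n → Eu n → Eu n}

include hΩ hn hΩU hG in
/-- The trace norm as a maximum over a compact set that does not depend on the point. The components
of an orthonormal frame `A` relative to `b` form an isometry of the whole of `ℝⁿ`; the maximum is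
attained at one that maps the normal to `N` and restricts to an isometry of the tangent spaces. -/
theorem traceNormDifferential_eq_frameSup (hN : ContDiffOn ℝ 1 N (frontier Ω))
    (hN1 : ∀ y ∈ frontier Ω, ‖N y‖ = 1) (hx : x ∈ frontier Ω)
    (hb : IsOrientedOrthonormalFrame G U b) :
    traceNormDifferential G (frontier Ω) N x =
      frameSup fun a => tangentialDeriv G Ω N x (b a x) := by
  have hxU := hΩU (hΩ.frontier_subset hx)
  have hGx := hG.2 x hxU
  obtain ⟨e, f, lam, he, hf, hfN, hlam, hL, htr⟩ := exists_singular_frame hΩ hΩU hG hn hN hN1 hx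
  set ν := outwardNormal G Ω x with hν
  have hopt := metricInner_normal_tangent hΩ hΩU hG hx he
  have hcard := card_option_fin_sub_one hn
  have hC : ∀ ξ, tangentialDeriv G Ω N x ξ = ∑ k, (metricInner G x ξ (e k) * lam k) • f k := by
    intro ξ
    have h := sum_metricInner_smul hcard hopt ξ
    rw [Fintype.sum_option] at h
    simp only [Option.elim] at h
    conv_lhs => rw [← h]
    rw [map_add, map_smul, tangentialDeriv_normal hΩ hΩU hG hx, smul_zero, zero_add, map_sum]
    refine Finset.sum_congr rfl fun k _ => ?_
    rw [map_smul, tangentialDeriv_of_mem hΩ hΩU hG hx (he.1 k), hL, smul_smul]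
  -- In terms of the singular frame, the functional weighs the singular values by the matrix entries
  -- of the isometry `A`.
  have hval : ∀ A : Fin n → Eu n, ∑ a, inner ℝ (tangentialDeriv G Ω N x (b a x)) (A a) =
      ∑ k, lam k * ∑ a, metricInner G x (b a x) (e k) * inner ℝ (f k) (A a) := by
    intro A
    simp only [hC, sum_inner, real_inner_smul_left, Finset.mul_sum]
    rw [Finset.sum_comm]
    exact Finset.sum_congr rfl fun k _ => Finset.sum_congr rfl fun a _ => by ring
  have hsq : ∀ k, ∑ a, metricInner G x (b a x) (e k) ^ 2 = 1 := by
    intro k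
    simp only [metricInner_comm hGx (b _ x)]
    rw [sum_sq_metricInner_frame hb hxU, he.2, if_pos rfl]
  rw [htr]
  symm
  refine IsGreatest.csSup_eq ⟨⟨fun a => ∑ k, metricInner G x (b a x) (e k) • f k +
    metricInner G x (b a x) ν • N x, fun a c => ?_, ?_⟩, ?_⟩
  · have h := metricInner_eq_sum_mul hcard hopt (b a x) (b c x)
    rw [hb.2.1 x hxU, Fintype.sum_option] at h
    simp only [Option.elim] at h
    rw [h]
    have hff := orthonormal_iff_ite.1 hf
    have hNf : ∀ k, inner ℝ (N x) (f k) = 0 := fun k => by rw [real_inner_comm, hfN]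
    simp only [inner_add_left, inner_add_right, sum_inner, inner_sum, real_inner_smul_left,
      real_inner_smul_right, hff, hfN, hNf, real_inner_self_eq_norm_sq, hN1 x hx]
    simp only [mul_ite, mul_one, mul_zero, Finset.sum_ite_eq', Finset.mem_univ, if_true, one_pow,
      Finset.sum_const_zero, add_zero, zero_add]
    rw [add_comm]
    congr 1
    · exact mul_comm _ _
    · exact Finset.sum_congr rfl fun k _ => mul_comm _ _
  · simp only
    rw [hval]
    refine Finset.sum_congr rfl fun k _ => ?_
    have hff := orthonormal_iff_ite.1 hf
    have h1 : ∀ a, inner ℝ (f k) (∑ k, metricInner G x (b a x) (e k) • f k +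
        metricInner G x (b a x) ν • N x) = metricInner G x (b a x) (e k) := by
      intro a
      simp [inner_add_right, inner_sum, real_inner_smul_right, hff, hfN]
    simp only [h1, ← sq, hsq, mul_one]
  · rintro _ ⟨A, hA, rfl⟩
    simp only
    rw [hval]
    refine Finset.sum_le_sum fun k _ => ?_
    have hAo : Orthonormal ℝ A := orthonormal_iff_ite.2 hA
    -- Bessel for `A` and Parseval for `b` bound each matrix entry by `1`.
    have h1 : ∑ a, inner ℝ (f k) (A a) ^ 2 ≤ 1 := by
      have h2 := hAo.sum_inner_products_le (s := Finset.univ) (f k)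
      rw [hf.1 k, one_pow] at h2
      refine le_trans (le_of_eq ?_) h2
      refine Finset.sum_congr rfl fun a _ => ?_
      rw [Real.norm_eq_abs, sq_abs, real_inner_comm]
    have h3 : ∑ a, metricInner G x (b a x) (e k) * inner ℝ (f k) (A a) ≤ 1 := by
      have h4 : ∑ a, metricInner G x (b a x) (e k) * inner ℝ (f k) (A a) ≤
          ∑ a, (1 / 2 : ℝ) * (metricInner G x (b a x) (e k) ^ 2 + inner ℝ (f k) (A a) ^ 2) :=
        Finset.sum_le_sum fun a _ => by
          nlinarith [sq_nonneg (metricInner G x (b a x) (e k) - inner ℝ (f k) (A a))]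
      rw [← Finset.mul_sum, Finset.sum_add_distrib, hsq] at h4
      linarith
    nlinarith [hlam k]

include hΩ hn hU hΩU hG in
/-- The trace norm of the differential depends continuously on the boundary point, although the
singular frame need not. -/
theorem continuousOn_traceNormDifferential (hN : ContDiffOn ℝ 1 N (frontier Ω))
    (hN1 : ∀ y ∈ frontier Ω, ‖N y‖ = 1) (hb : IsOrientedOrthonormalFrame G U b) :
    ContinuousOn (traceNormDifferential G (frontier Ω) N) (frontier Ω) := by
  have h : ContinuousOn (fun x => fun a => tangentialDeriv G Ω N x (b a x)) (frontier Ω) := by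
    refine continuousOn_pi.2 fun a => ?_
    refine hΩ.continuousOn_frontier fun v f V x hc hxV hfx =>
      ⟨fun x => fderiv ℝ (fun y => N (graphProj v f y)) x
        (b a x - metricInner G x (b a x) (outwardNormal G Ω x) • outwardNormal G Ω x), ?_, ?_⟩
    · have hx := (hc.mem_frontier_iff hxV).2 hfx
      have hsub := hΩ.frontier_subset.trans hΩU
      have h1 : ContinuousWithinAt (fderiv ℝ (fun y => N (graphProj v f y))) (frontier Ω) x :=
        (((hc.contDiffOn_comp_graphProj (by norm_num) hN).contDiffAt
          (hc.isOpen_graphDomain.mem_nhds (hc.mem_graphDomain hxV hx))).continuousAt_fderiv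
            (by simp)).continuousWithinAt
      have h2 := continuousOn_outwardNormal hΩ hU hΩU hG
      have h3 : ∀ i j, ContinuousOn (fun x => G x i j) (frontier Ω) := fun i j =>
        (hG.1 i j).continuousOn.mono hsub
      have h4 : ContinuousOn (b a) (frontier Ω) := (hb.1 a).continuousOn.mono hsub
      have h5 : ContinuousOn (fun x => b a x - metricInner G x (b a x) (outwardNormal G Ω x) •
          outwardNormal G Ω x) (frontier Ω) := by
        simp only [metricInner]
        fun_prop
      exact h1.clm_apply (h5 x hx)
    · intro y hy hyf _
      rw [tangentialDeriv_apply]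
      exact fderivWithin_eq_fderiv_of_mem_tangentSpace (differentiableAt_comp_graphProj hc hy hyf hN)
        (hc.eventuallyEq_comp_graphProj hy N) hyf (sub_normal_mem_tangentSpace hΩ hΩU hG hn hyf _)
  exact (continuous_frameSup.comp_continuousOn h).congr fun x hx =>
    traceNormDifferential_eq_frameSup hΩ hn hΩU hG hN hN1 hx hb

end BoundaryMap

/-! ### The integral inequality -/

section Inequality

variable {n : ℕ} {S : Type*} [NormedAddCommGroup S] [InnerProductSpace ℝ S] [FiniteDimensional ℝ S]
variable {γ τ : Fin n → Module.End ℝ S} {G : Eu n → Matrix (Fin n) (Fin n) ℝ} {Ω U : Set (Eu n)}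
  {b : Fin n → Eu n → Eu n} {N : Eu n → Eu n} {s : Eu n → S} {x : Eu n}

/-- The spin connection acting on spinor fields defined on `A`: the derivative is taken within `A`,
which gives one-sided derivatives on a domain and tangential ones on its boundary. -/
def spinorDerivOn (γ : Fin n → Module.End ℝ S) (G : Eu n → Matrix (Fin n) (Fin n) ℝ)
    (b : Fin n → Eu n → Eu n) (A : Set (Eu n)) (s : Eu n → S) (x : Eu n) : Eu n →ₗ[ℝ] S :=
  (fderivWithin ℝ s A x).toLinearMap + spinConnMap γ G b x (s x)

theorem spinorDerivOn_apply (A : Set (Eu n)) (X : Eu n) : spinorDerivOn γ G b A s x X =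
    fderivWithin ℝ s A x X + spinConn γ (connForm G b x X) (s x) := rfl

/-- The Dirac operator. -/
def diracOn (γ : Fin n → Module.End ℝ S) (G : Eu n → Matrix (Fin n) (Fin n) ℝ)
    (b : Fin n → Eu n → Eu n) (A : Set (Eu n)) (s : Eu n → S) (x : Eu n) : S :=
  ∑ a, γ a (spinorDerivOn γ G b A s x (b a x))

/-- The boundary Dirac operator. -/
def boundaryDiracOn (γ : Fin n → Module.End ℝ S) (G : Eu n → Matrix (Fin n) (Fin n) ℝ)
    (b : Fin n → Eu n → Eu n) (Ω : Set (Eu n)) (s : Eu n → S) (x : Eu n) : S :=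
  ∑ k, cliffordAct γ G b x (outwardNormal G Ω x)
    (cliffordAct γ G b x (tangentFrame G (frontier Ω) x k)
      (spinorDerivOn γ G b (frontier Ω) s x (tangentFrame G (frontier Ω) x k))) +
    (1 / 2 * meanCurvature G Ω x) • s x

/-- The boundary operator `s ↦ -ν · τ(N) s`. -/
def boundaryChi (γ τ : Fin n → Module.End ℝ S) (G : Eu n → Matrix (Fin n) (Fin n) ℝ)
    (b : Fin n → Eu n → Eu n) (Ω : Set (Eu n)) (N : Eu n → Eu n) (s : Eu n → S) (x : Eu n) : S :=
  -cliffordAct γ G b x (outwardNormal G Ω x) (cliffordSum τ (N x).ofLp (s x))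

theorem sum_sq_ofLp (v : Eu n) : ∑ a, v.ofLp a ^ 2 = ‖v‖ ^ 2 := by
  rw [EuclideanSpace.norm_sq_eq]
  simp

variable (hγ : IsClifford γ) (hsk : IsSkew γ) (hτ : IsClifford τ) (hskτ : IsSkew τ)
  (hcomm : ∀ a c, Commute (γ a) (τ c))
  (hΩ : IsSmoothCompactDomain Ω) (hn : n ≠ 0) (hU : IsOpen U) (hΩU : Ω ⊆ U)
  (hG : IsRiemannianMetricOn G U) (hb : IsOrientedOrthonormalFrame G U b)

include hγ hsk hb in
theorem inner_cliffordAct_cliffordAct (hx : x ∈ U) (ξ : Eu n) (u v : S) :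
    inner ℝ (cliffordAct γ G b x ξ u) (cliffordAct γ G b x ξ v) =
      metricInner G x ξ ξ * inner ℝ u v := by
  rw [cliffordAct_eq, inner_cliffordSum_cliffordSum hγ hsk, sum_sq_metricInner_frame hb hx]

include hγ hb in
theorem cliffordAct_cliffordAct (hx : x ∈ U) (ξ : Eu n) (u : S) :
    cliffordAct γ G b x ξ (cliffordAct γ G b x ξ u) = -(metricInner G x ξ ξ • u) := by
  rw [cliffordAct_eq, hγ.cliffordSum_cliffordSum, sum_sq_metricInner_frame hb hx]

include hΩ hΩU hG in
/-- Tangential derivatives along the boundary can be computed with the extension given by a graph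
chart. -/
theorem spinorDerivOn_frontier (hx : x ∈ frontier Ω) {v : Eu n} {f : Eu n → ℝ} {V : Set (Eu n)}
    (hc : IsGraphChart Ω v f V) (hxV : x ∈ V) (hs : ContDiffOn ℝ 1 s (frontier Ω)) {ξ : Eu n}
    (hξ : ξ ∈ tangentSpace (frontier Ω) x) :
    spinorDerivOn γ G b (frontier Ω) s x ξ =
      spinorDeriv γ G b (fun y => s (graphProj v f y)) x ξ := by
  rw [spinorDerivOn_apply, spinorDeriv_apply, hc.graphProj_eq_self hxV hx,
    fderivWithin_eq_fderiv_of_mem_tangentSpace (differentiableAt_comp_graphProj hc hxV hx hs)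
      (hc.eventuallyEq_comp_graphProj hxV s) hx hξ]

include hΩ in
/-- In tangent directions, the derivative along the boundary agrees with the one-sided derivative
from the domain. -/
theorem spinorDerivOn_frontier_eq (hx : x ∈ frontier Ω) (hs : ContDiffOn ℝ 1 s Ω) {ξ : Eu n}
    (hξ : ξ ∈ tangentSpace (frontier Ω) x) :
    spinorDerivOn γ G b (frontier Ω) s x ξ = spinorDerivOn γ G b Ω s x ξ := by
  have hd := (hs.differentiableOn (by simp) x (hΩ.frontier_subset hx)).hasFDerivWithinAt
  rw [spinorDerivOn_apply, spinorDerivOn_apply,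
    fderivWithin_apply_of_mem_tangentSpace (hd.mono hΩ.frontier_subset) hξ]

include hγ hsk hΩ hn hΩU hG hb in
/-- The boundary Dirac operator in terms of the Dirac operator and the normal derivative: adding the
normal direction to the sum over tangent vectors costs `ν · ν · ∇_ν s = -∇_ν s`. -/
theorem boundaryDiracOn_eq (hx : x ∈ frontier Ω) (hs : ContDiffOn ℝ 1 s Ω) :
    boundaryDiracOn γ G b Ω s x = cliffordAct γ G b x (outwardNormal G Ω x) (diracOn γ G b Ω s x) +
      spinorDerivOn γ G b Ω s x (outwardNormal G Ω x) + (1 / 2 * meanCurvature G Ω x) • s x := by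
  have hxU := hΩU (hΩ.frontier_subset hx)
  have he := isTangentFrame_tangentFrame hΩ hΩU hG hx
  rw [boundaryDiracOn, diracOn, sum_frame_eq_sum (card_option_fin_sub_one hn) (hG.2 x hxU)
    (metricInner_normal_tangent hΩ hΩU hG hx he), Fintype.sum_option]
  simp only [Option.elim]
  rw [map_add, cliffordAct_cliffordAct hγ hb hxU, (isOutwardUnitNormal_outwardNormal hΩ hΩU hG hx).1,
    one_smul, neg_add_cancel_comm, map_sum]
  congr 1
  exact Finset.sum_congr rfl fun k _ => by
    rw [spinorDerivOn_frontier_eq hΩ hx hs (he.1 k)]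

include hγ hsk hskτ hcomm hΩ hn hU hΩU hG hb in
/-- The pairing of the boundary Dirac operator with `χ` is a divergence plus a term of order zero in
the spinor. The two normal vectors cancel, so that `⟨D^Σ s, χ s⟩` involves only `⟨e_k · ∇_k s, τ(N)
s⟩` and the mean curvature. The form `⟨ξ · u, τ(N) v⟩` is symmetric in `u`, `v`, so up to sign twice
this is the divergence of the field dual to `ξ ↦ ⟨ξ · s, τ(N) s⟩` without the term in which `N` is
differentiated. -/
theorem two_mul_inner_boundaryDiracOn_boundaryChi (hs : ContDiffOn ℝ 1 s (frontier Ω))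
    (hN : ContDiffOn ℝ 1 N (frontier Ω)) (hx : x ∈ frontier Ω) :
    2 * inner ℝ (boundaryDiracOn γ G b Ω s x) (boundaryChi γ τ G b Ω N s x) =
      -boundaryDiv G Ω (pairingField γ b s fun y => cliffordSum τ (N y).ofLp (s y)) x +
      ∑ k, inner ℝ (cliffordAct γ G b x (tangentFrame G (frontier Ω) x k) (s x))
        (cliffordSum τ (fderivWithin ℝ N (frontier Ω) x (tangentFrame G (frontier Ω) x k)).ofLp
          (s x)) := by
  have hxU := hΩU (hΩ.frontier_subset hx)
  have he := isTangentFrame_tangentFrame hΩ hΩU hG hx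
  obtain ⟨v, f, V, hc, hxV⟩ := hΩ.exists_isGraphChart hx
  have hsd := differentiableAt_comp_graphProj hc hxV hx hs
  have hNd := differentiableAt_comp_graphProj hc hxV hx hN
  set e := tangentFrame G (frontier Ω) x with hedef
  set ν := outwardNormal G Ω x with hν
  set s' : Eu n → S := fun y => s (graphProj v f y) with hs'
  set N' : Eu n → Eu n := fun y => N (graphProj v f y) with hN'
  set t' : Eu n → S := fun y => cliffordSum τ (N' y).ofLp (s' y) with ht'
  have htd := fun X => spinorDeriv_cliffordSum (G := G) (b := b) hcomm hNd hsd X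
  have hsx : s' x = s x := by simp only [hs', hc.graphProj_eq_self hxV hx]
  have hNx : N' x = N x := by simp only [hN', hc.graphProj_eq_self hxV hx]
  have hP := fun X Y => metricInner_covDeriv_pairingField hγ hsk hG hU hb hxU hsd (htd 0).1 X Y
  have hPev : pairingField γ b s (fun y => cliffordSum τ (N y).ofLp (s y)) =ᶠ[𝓝[frontier Ω] x]
      pairingField γ b s' t' := by
    filter_upwards [hc.eventuallyEq_comp_graphProj hxV s, hc.eventuallyEq_comp_graphProj hxV N]
      with y h1 h2
    simp only [pairingField, ht', hs', hN', ← h1, ← h2]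
  have hD : ∀ k, spinorDerivOn γ G b (frontier Ω) s x (e k) = spinorDeriv γ G b s' x (e k) :=
    fun k => spinorDerivOn_frontier hΩ hΩU hG hx hc hxV hs (he.1 k)
  have hterm : ∀ k, metricInner G x (covDeriv G (frontier Ω)
      (pairingField γ b s fun y => cliffordSum τ (N y).ofLp (s y)) x (e k)) (e k) =
      2 * inner ℝ (cliffordAct γ G b x (e k) (spinorDerivOn γ G b (frontier Ω) s x (e k)))
        (cliffordSum τ (N x).ofLp (s x)) +
      inner ℝ (cliffordAct γ G b x (e k) (s x))
        (cliffordSum τ (fderivWithin ℝ N (frontier Ω) x (e k)).ofLp (s x)) := by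
    intro k
    rw [covDeriv_frontier_eq hΩ hΩU hG hx (hP 0 0).1 hPev, (hP _ _).2, (htd _).2, hD,
      fderivWithin_eq_fderiv_of_mem_tangentSpace hNd (hc.eventuallyEq_comp_graphProj hxV N) hx
        (he.1 k), inner_add_right]
    simp only [hsx, hNx]
    -- Symmetry: `e_k ·` and `τ(N)` are skew and commute, so their product is symmetric.
    have h1 : inner ℝ (cliffordAct γ G b x (e k) (s x))
        (cliffordSum τ (N x).ofLp (spinorDeriv γ G b s' x (e k))) =
        inner ℝ (cliffordAct γ G b x (e k) (spinorDeriv γ G b s' x (e k)))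
          (cliffordSum τ (N x).ofLp (s x)) := by
      have h2 : cliffordSum τ (N x).ofLp (cliffordAct γ G b x (e k) (s x)) =
          cliffordAct γ G b x (e k) (cliffordSum τ (N x).ofLp (s x)) := by
        rw [cliffordAct_eq, ← Module.End.mul_apply, ← Module.End.mul_apply,
          (cliffordSum_comm hcomm _ _).eq]
      have h3 := hskτ.cliffordSum (N x).ofLp (cliffordAct γ G b x (e k) (s x))
        (spinorDeriv γ G b s' x (e k))
      rw [h2, cliffordAct_eq, hsk.cliffordSum, ← cliffordAct_eq] at h3
      rw [real_inner_comm (cliffordSum τ (N x).ofLp (s x))]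
      linarith
    rw [h1]
    ring
  have hνν : metricInner G x ν ν = 1 := (isOutwardUnitNormal_outwardNormal hΩ hΩU hG hx).1
  rw [boundaryDiv, metricInner_pairingField (hG.2 x hxU)]
  simp only [← hedef, hterm, Finset.sum_add_distrib, ← Finset.mul_sum]
  rw [boundaryDiracOn, boundaryChi, inner_neg_right, inner_add_left, ← map_sum,
    inner_cliffordAct_cliffordAct hγ hsk hb hxU, hνν, one_mul, sum_inner, real_inner_smul_left]
  -- This identifies the mean curvature terms of the Dirac operator and of the boundary divergence.
  have h5 : inner ℝ (s x) (cliffordAct γ G b x ν (cliffordSum τ (N x).ofLp (s x))) =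
      -inner ℝ (cliffordAct γ G b x ν (s x)) (cliffordSum τ (N x).ofLp (s x)) := by
    rw [cliffordAct_eq, hsk.cliffordSum, neg_neg]
  rw [h5]
  ring

include hγ hsk hτ hskτ hΩ hn hΩU hG hb in
/-- The term of order zero is bounded by the trace norm: in a singular frame, each singular value
multiplies the pairing of two spinors of norm `|s|`. -/
theorem sum_inner_le_traceNormDifferential (hN : ContDiffOn ℝ 1 N (frontier Ω))
    (hN1 : ∀ y ∈ frontier Ω, ‖N y‖ = 1) (hx : x ∈ frontier Ω) (u : S) :
    ∑ k, inner ℝ (cliffordAct γ G b x (tangentFrame G (frontier Ω) x k) u)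
        (cliffordSum τ (fderivWithin ℝ N (frontier Ω) x (tangentFrame G (frontier Ω) x k)).ofLp u) ≤
      traceNormDifferential G (frontier Ω) N x * ‖u‖ ^ 2 := by
  have hxU := hΩU (hΩ.frontier_subset hx)
  obtain ⟨e, f, lam, he, hf, hfN, hlam, hL, htr⟩ := exists_singular_frame hΩ hΩU hG hn hN hN1 hx
  let D : Eu n →ₗ[ℝ] S := LinearMap.applyₗ u ∘ₗ cliffordSum τ ∘ₗ
    (WithLp.linearEquiv 2 ℝ (Fin n → ℝ)).toLinearMap ∘ₗ tangentialDeriv G Ω N x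
  have hD : ∀ ξ, D ξ = cliffordSum τ (tangentialDeriv G Ω N x ξ).ofLp u := fun ξ => rfl
  -- the sum does not depend on the tangent frame
  have hframe : ∀ {e : Fin (n - 1) → Eu n}, IsTangentFrame G (frontier Ω) x e →
      ∑ k, inner ℝ (cliffordAct γ G b x (e k) u)
        (cliffordSum τ (fderivWithin ℝ N (frontier Ω) x (e k)).ofLp u) =
      -inner ℝ u (∑ a, γ a (D (b a x))) := by
    intro e he
    rw [sum_frame_eq_sum (card_option_fin_sub_one hn) (hG.2 x hxU)
      (metricInner_normal_tangent hΩ hΩU hG hx he), Fintype.sum_option]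
    simp only [Option.elim]
    rw [hD (outwardNormal G Ω x), tangentialDeriv_normal hΩ hΩU hG hx, WithLp.ofLp_zero, map_zero,
      LinearMap.zero_apply, map_zero, zero_add, inner_sum, ← Finset.sum_neg_distrib]
    refine Finset.sum_congr rfl fun k _ => ?_
    rw [hD, tangentialDeriv_of_mem hΩ hΩU hG hx (he.1 k), cliffordAct_eq, hsk.cliffordSum]
  rw [hframe (isTangentFrame_tangentFrame hΩ hΩU hG hx), ← hframe he, htr, Finset.sum_mul]
  refine Finset.sum_le_sum fun k _ => ?_
  rw [hL, WithLp.ofLp_smul, map_smul, LinearMap.smul_apply, real_inner_smul_right]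
  refine mul_le_mul_of_nonneg_left ?_ (hlam k)
  refine (real_inner_le_norm _ _).trans (le_of_eq ?_)
  rw [cliffordAct_eq, norm_cliffordSum hγ hsk, norm_cliffordSum hτ hskτ, sq]
  · rw [sum_sq_ofLp, hf.1 k, one_pow]
  · rw [sum_sq_metricInner_frame hb hxU, he.2, if_pos rfl]

theorem connForm_contDiffOn (hG : IsRiemannianMetricOn G U) (hU : IsOpen U)
    (hb : IsOrientedOrthonormalFrame G U b) {m : WithTop ℕ∞} (hm : m ≤ ∞) {X : Eu n → Eu n}
    (hX : ContDiffOn ℝ m X U) (a c : Fin n) :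
    ContDiffOn ℝ m (fun y => connForm G b y (X y) a c) U := by
  have h : (fun y => connForm G b y (X y) a c) =
      fun y => ∑ i, X y i * connForm G b y (stdVec i) a c := by
    funext y; exact connForm_eq_sum _ a c
  rw [h]
  exact ContDiffOn.sum fun i _ => (contDiffOn_euclidean.1 hX i).mul
    ((contDiffOn_connForm hG hU hb i a c).of_le hm)

include hΩ hU hΩU hG hb in
theorem contDiffOn_spinorDerivOn (hs : ContDiffOn ℝ ∞ s Ω) (c : Fin n) :
    ContDiffOn ℝ ∞ (fun y => spinorDerivOn γ G b Ω s y (b c y)) Ω := by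
  have h : (fun y => spinorDerivOn γ G b Ω s y (b c y)) = fun y => fderivWithin ℝ s Ω y (b c y) +
      (1 / 4 : ℝ) • ∑ j, ∑ k, connForm G b y (b c y) j k • (γ j * γ k) (s y) := by
    funext y
    rw [spinorDerivOn_apply, spinConn_apply_apply]
    rfl
  rw [h]
  refine ((hs.fderivWithin hΩ.uniqueDiffOn (by simp)).clm_apply ((hb.1 c).mono hΩU)).add ?_
  refine ContDiffOn.const_smul _ (ContDiffOn.sum fun j _ => ContDiffOn.sum fun k _ => ?_)
  exact ((connForm_contDiffOn hG hU hb le_rfl (hb.1 c) j k).mono hΩU).smul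
    (contDiffOn_linearMap_apply _ hs)

include hΩ hU hΩU hG hb in
theorem contDiffOn_diracOn (hs : ContDiffOn ℝ ∞ s Ω) :
    ContDiffOn ℝ ∞ (diracOn γ G b Ω s) Ω :=
  ContDiffOn.sum fun a _ => contDiffOn_linearMap_apply _
    (contDiffOn_spinorDerivOn hΩ hU hΩU hG hb hs a)

/-- The field `lichnerowiczField`, with one-sided derivatives at the boundary. -/
def lichnerowiczFieldOn (γ : Fin n → Module.End ℝ S) (G : Eu n → Matrix (Fin n) (Fin n) ℝ)
    (b : Fin n → Eu n → Eu n) (A : Set (Eu n)) (s : Eu n → S) (y : Eu n) : Eu n :=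
  ∑ a, (∑ c, inner ℝ (cliffordWedge γ a c (spinorDerivOn γ G b A s y (b c y))) (s y)) • b a y

include hΩ hU hΩU hG hb in
theorem contDiffOn_lichnerowiczFieldOn (hs : ContDiffOn ℝ ∞ s Ω) :
    ContDiffOn ℝ ∞ (lichnerowiczFieldOn γ G b Ω s) Ω :=
  ContDiffOn.sum fun a _ => (ContDiffOn.sum fun c _ => ContDiffOn.inner ℝ
    (contDiffOn_linearMap_apply _ (contDiffOn_spinorDerivOn hΩ hU hΩU hG hb hs c)) hs).smul
      ((hb.1 a).mono hΩU)

include hγ hsk hΩ hn hΩU hG hb in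
/-- The flux density of the Lichnerowicz field is `⟨ν · D s + ∇_ν s, s⟩`, which the boundary Dirac
operator expresses through the mean curvature. -/
theorem metricInner_lichnerowiczFieldOn (hx : x ∈ frontier Ω) (hs : ContDiffOn ℝ 1 s Ω) :
    metricInner G x (lichnerowiczFieldOn γ G b Ω s x) (outwardNormal G Ω x) =
      inner ℝ (boundaryDiracOn γ G b Ω s x) (s x) - 1 / 2 * meanCurvature G Ω x * ‖s x‖ ^ 2 := by
  have hxU := hΩU (hΩ.frontier_subset hx)
  set ν := outwardNormal G Ω x with hν
  set D := spinorDerivOn γ G b Ω s x with hD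
  rw [boundaryDiracOn_eq hγ hsk hΩ hn hΩU hG hb hx hs, inner_add_left, real_inner_smul_left,
    real_inner_self_eq_norm_sq, add_sub_cancel_right, ← hν]
  have h1 : D ν = ∑ a, metricInner G x ν (b a x) • D (b a x) := by
    conv_lhs => rw [← sum_metricInner_smul (Fintype.card_fin n) (hb.2.1 x hxU) ν]
    simp only [map_sum, map_smul]
  have h2 : ∀ a, ∑ c, inner ℝ (cliffordWedge γ a c (D (b c x))) (s x) =
      inner ℝ (γ a (diracOn γ G b Ω s x) + D (b a x)) (s x) := by
    intro a
    rw [← sum_inner]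
    congr 1
    simp only [cliffordWedge_apply, Finset.sum_add_distrib, ite_smul, one_smul, zero_smul,
      Finset.sum_ite_eq, Finset.mem_univ, if_true]
    rw [diracOn, map_sum]
  rw [lichnerowiczFieldOn, metricInner_sum_left, ← hD]
  simp only [h2, metricInner_smul_left]
  rw [h1, cliffordAct_eq, cliffordSum_apply, ← Finset.sum_add_distrib, sum_inner]
  refine Finset.sum_congr rfl fun a _ => ?_
  rw [← smul_add, real_inner_smul_left, metricInner_comm (hG.2 x hxU), mul_comm]

theorem spinorDerivOn_eq_spinorDeriv (hx : x ∈ interior Ω) :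
    spinorDerivOn γ G b Ω s x = spinorDeriv γ G b s x := by
  rw [spinorDerivOn, spinorDeriv, fderivWithin_of_mem_nhds (mem_interior_iff_mem_nhds.1 hx)]

include hγ hsk hΩ hn hU hΩU hG hb in
/-- The integrated Lichnerowicz formula. In the interior the one-sided derivatives are ordinary
ones, and the boundary of `Ω` is a null set. -/
theorem volIntegral_lichnerowicz (hs : ContDiffOn ℝ ∞ s Ω) :
    volIntegral G Ω (fun x => ∑ a, ‖spinorDerivOn γ G b Ω s x (b a x)‖ ^ 2 -
        ‖diracOn γ G b Ω s x‖ ^ 2 + 1 / 4 * scalarCurvature G x * ‖s x‖ ^ 2) =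
      surfaceIntegral G (frontier Ω) fun x => inner ℝ (boundaryDiracOn γ G b Ω s x) (s x) -
        1 / 2 * meanCurvature G Ω x * ‖s x‖ ^ 2 := by
  have hs1 : ContDiffOn ℝ 1 s Ω := hs.of_le ENat.LEInfty.out
  have hX := (contDiffOn_lichnerowiczFieldOn (γ := γ) hΩ hU hΩU hG hb hs).of_le
    (m := 1) ENat.LEInfty.out
  have h1 : surfaceIntegral G (frontier Ω) (fun x => inner ℝ (boundaryDiracOn γ G b Ω s x) (s x) -
      1 / 2 * meanCurvature G Ω x * ‖s x‖ ^ 2) = surfaceIntegral G (frontier Ω) fun x =>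
      metricInner G x (lichnerowiczFieldOn γ G b Ω s x) (outwardNormal G Ω x) := by
    refine setIntegral_congr_fun isClosed_frontier.measurableSet fun x hx => ?_
    simp only [metricInner_lichnerowiczFieldOn hγ hsk hΩ hn hΩU hG hb hx hs1]
  rw [h1, ← hΩ.integral_divergence hn hU hΩU hG hX, volIntegral, hΩ.setIntegral_eq_interior,
    hΩ.setIntegral_eq_interior]
  refine setIntegral_congr_fun isOpen_interior.measurableSet fun x hx => ?_
  have hxΩ := interior_subset hx
  have hev : (fun y => √(G y).det • lichnerowiczFieldOn γ G b Ω s y) =ᶠ[𝓝 x]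
      fun y => √(G y).det • lichnerowiczField γ G b s y := by
    filter_upwards [isOpen_interior.mem_nhds hx] with y hy
    simp only [lichnerowiczFieldOn, lichnerowiczField, spinorDerivOn_eq_spinorDeriv hy]
  have h2 := divergence_lichnerowiczField hγ hsk hG hU hb (hΩU hxΩ)
    ((hs.contDiffAt (mem_interior_iff_mem_nhds.1 hx)).of_le (m := 2) ENat.LEInfty.out)
  simp only [diracOn, spinorDerivOn_eq_spinorDeriv hx]
  rw [divergence, hev.fderiv_eq]
  exact (mul_comm _ _).trans h2.symm

include hΩ hU hΩU hG hb in
theorem continuousOn_cliffordAct_normal {u : Eu n → S} (hu : ContinuousOn u (frontier Ω)) :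
    ContinuousOn (fun x => cliffordAct γ G b x (outwardNormal G Ω x) (u x)) (frontier Ω) := by
  have hsub := hΩ.frontier_subset.trans hΩU
  have h2 := continuousOn_outwardNormal hΩ hU hΩU hG
  have h3 : ∀ i j, ContinuousOn (fun x => G x i j) (frontier Ω) := fun i j =>
    (hG.1 i j).continuousOn.mono hsub
  have h4 : ∀ a, ContinuousOn (b a) (frontier Ω) := fun a => (hb.1 a).continuousOn.mono hsub
  simp only [cliffordAct_eq, cliffordSum_apply]
  refine continuousOn_finsetSum _ fun a _ => ContinuousOn.smul ?_ ?_
  · have h4a := h4 a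
    simp only [metricInner]
    fun_prop
  · exact (LinearMap.continuous_of_finiteDimensional (γ a)).comp_continuousOn hu

include hγ hsk hΩ hn hU hΩU hG hb in
theorem continuousOn_boundaryDiracOn (hs : ContDiffOn ℝ ∞ s Ω) :
    ContinuousOn (boundaryDiracOn γ G b Ω s) (frontier Ω) := by
  have hs1 : ContDiffOn ℝ 1 s Ω := hs.of_le ENat.LEInfty.out
  have hsub := hΩ.frontier_subset
  have h1 := continuousOn_cliffordAct_normal (γ := γ) hΩ hU hΩU hG hb
    ((contDiffOn_diracOn (γ := γ) hΩ hU hΩU hG hb hs).continuousOn.mono hsub)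
  have h2 : ContinuousOn (fun x => spinorDerivOn γ G b Ω s x (outwardNormal G Ω x)) (frontier Ω) := by
    have h3 : Set.EqOn (fun x => spinorDerivOn γ G b Ω s x (outwardNormal G Ω x)) (fun x =>
        ∑ a, metricInner G x (outwardNormal G Ω x) (b a x) • spinorDerivOn γ G b Ω s x (b a x))
        (frontier Ω) := by
      intro x hx
      have hxU := hΩU (hΩ.frontier_subset hx)
      simp only
      conv_lhs => rw [← sum_metricInner_smul (Fintype.card_fin n) (hb.2.1 x hxU)
        (outwardNormal G Ω x)]
      simp only [map_sum, map_smul]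
    refine ContinuousOn.congr ?_ h3
    have h2 := continuousOn_outwardNormal hΩ hU hΩU hG
    have h3 : ∀ i j, ContinuousOn (fun x => G x i j) (frontier Ω) := fun i j =>
      (hG.1 i j).continuousOn.mono (hsub.trans hΩU)
    refine continuousOn_finsetSum _ fun a _ => ContinuousOn.smul ?_
      ((contDiffOn_spinorDerivOn hΩ hU hΩU hG hb hs a).continuousOn.mono hsub)
    have h4 : ContinuousOn (b a) (frontier Ω) := (hb.1 a).continuousOn.mono (hsub.trans hΩU)
    simp only [metricInner]
    fun_prop
  have h5 := continuousOn_meanCurvature hΩ hn hU hΩU hG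
  refine ContinuousOn.congr ((h1.add h2).add (ContinuousOn.smul
    ((continuousOn_const (c := (1 / 2 : ℝ))).mul h5) (hs.continuousOn.mono hsub))) fun x hx => ?_
  exact boundaryDiracOn_eq hγ hsk hΩ hn hΩU hG hb hx hs1

theorem continuousOn_cliffordSum {A : Set (Eu n)} {u : Eu n → S} (hN : ContinuousOn N A)
    (hu : ContinuousOn u A) : ContinuousOn (fun x => cliffordSum τ (N x).ofLp (u x)) A := by
  simp only [cliffordSum_apply]
  refine continuousOn_finsetSum _ fun a _ => ContinuousOn.smul (by fun_prop) ?_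
  exact (LinearMap.continuous_of_finiteDimensional (τ a)).comp_continuousOn hu

include hγ hsk hτ hskτ hcomm hΩ hn hU hΩU hG hb in
/-- The integral inequality for a representation with two commuting Clifford actions. -/
theorem volIntegral_le_surfaceIntegral (hs : ContDiffOn ℝ ∞ s Ω)
    (hN : ContDiffOn ℝ ∞ N (frontier Ω)) (hN1 : ∀ y ∈ frontier Ω, ‖N y‖ = 1) :
    volIntegral G Ω (fun x => ∑ a, ‖spinorDerivOn γ G b Ω s x (b a x)‖ ^ 2 -
        ‖diracOn γ G b Ω s x‖ ^ 2 + 1 / 4 * scalarCurvature G x * ‖s x‖ ^ 2) ≤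
      surfaceIntegral G (frontier Ω) (fun x =>
        inner ℝ (boundaryDiracOn γ G b Ω s x) (s x - boundaryChi γ τ G b Ω N s x)) -
      1 / 2 * surfaceIntegral G (frontier Ω) fun x =>
        (meanCurvature G Ω x - traceNormDifferential G (frontier Ω) N x) * ‖s x‖ ^ 2 := by
  have hsub := hΩ.frontier_subset
  have hsF : ContDiffOn ℝ ∞ s (frontier Ω) := hs.mono hsub
  have hN' : ContDiffOn ℝ 1 N (frontier Ω) := hN.of_le ENat.LEInfty.out
  set P := pairingField γ b s fun y => cliffordSum τ (N y).ofLp (s y) with hP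
  have hPs : ContDiffOn ℝ 2 P (frontier Ω) := by
    have h1 : ContDiffOn ℝ ∞ (fun y => cliffordSum τ (N y).ofLp (s y)) (frontier Ω) := by
      simp only [cliffordSum_apply]
      exact ContDiffOn.sum fun a _ => (contDiffOn_euclidean.1 hN a).smul
        (contDiffOn_linearMap_apply _ hsF)
    have h2 : ContDiffOn ℝ ∞ P (frontier Ω) := ContDiffOn.sum fun a _ => (ContDiffOn.inner ℝ
      (contDiffOn_linearMap_apply _ hsF) h1).smul ((hb.1 a).mono (hsub.trans hΩU))
    exact h2.of_le ENat.LEInfty.out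
  obtain ⟨hBc, hB0⟩ := surfaceIntegral_boundaryDiv hΩ hn hU hΩU hG hPs
  have hcs : ContinuousOn s (frontier Ω) := hsF.continuousOn
  have hcD := continuousOn_boundaryDiracOn hγ hsk hΩ hn hU hΩU hG hb hs
  have hcH := continuousOn_meanCurvature hΩ hn hU hΩU hG
  have hcT := continuousOn_traceNormDifferential hΩ hn hU hΩU hG hN' hN1 hb
  have hcχ : ContinuousOn (boundaryChi γ τ G b Ω N s) (frontier Ω) :=
    (continuousOn_cliffordAct_normal hΩ hU hΩU hG hb
      (continuousOn_cliffordSum hN'.continuousOn hcs)).neg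
  have hcρ := continuousOn_surfaceDensity hΩ hU hΩU hG
  have hint : ∀ {g : Eu n → ℝ}, ContinuousOn g (frontier Ω) →
      IntegrableOn (fun x => surfaceDensity G (frontier Ω) x • g x) (frontier Ω) (μHE[n - 1]) :=
    fun hg => hΩ.integrableOn_frontier hn (hcρ.smul hg)
  have hc1 : ContinuousOn (fun x => inner ℝ (boundaryDiracOn γ G b Ω s x) (s x) -
      1 / 2 * meanCurvature G Ω x * ‖s x‖ ^ 2) (frontier Ω) :=
    (hcD.inner hcs).sub ((continuousOn_const.mul hcH).mul (hcs.norm.pow 2))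
  have hc2 : ContinuousOn (fun x =>
      inner ℝ (boundaryDiracOn γ G b Ω s x) (s x - boundaryChi γ τ G b Ω N s x)) (frontier Ω) :=
    hcD.inner (hcs.sub hcχ)
  have hc3 : ContinuousOn (fun x =>
      (meanCurvature G Ω x - traceNormDifferential G (frontier Ω) N x) * ‖s x‖ ^ 2)
      (frontier Ω) := (hcH.sub hcT).mul (hcs.norm.pow 2)
  rw [volIntegral_lichnerowicz hγ hsk hΩ hn hU hΩU hG hb hs]
  -- Pointwise, the inequality holds up to half the boundary divergence of the pairing field, which
  -- integrates to zero.
  have hle : surfaceIntegral G (frontier Ω) (fun x => inner ℝ (boundaryDiracOn γ G b Ω s x) (s x) -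
      1 / 2 * meanCurvature G Ω x * ‖s x‖ ^ 2) ≤ surfaceIntegral G (frontier Ω) (fun x =>
      (inner ℝ (boundaryDiracOn γ G b Ω s x) (s x - boundaryChi γ τ G b Ω N s x) -
      1 / 2 * ((meanCurvature G Ω x - traceNormDifferential G (frontier Ω) N x) * ‖s x‖ ^ 2)) -
      1 / 2 * boundaryDiv G Ω P x) := by
    refine setIntegral_mono_on (hint hc1) (hint ((hc2.sub (continuousOn_const.mul hc3)).sub
      (continuousOn_const.mul hBc))) isClosed_frontier.measurableSet fun x hx => ?_
    refine smul_le_smul_of_nonneg_left ?_ (Real.sqrt_nonneg _)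
    have h1 := two_mul_inner_boundaryDiracOn_boundaryChi (τ := τ) hγ hsk hskτ hcomm hΩ hn hU hΩU hG
      hb (hsF.of_le (m := 1) ENat.LEInfty.out) hN' hx
    have h2 := sum_inner_le_traceNormDifferential hγ hsk hτ hskτ hΩ hn hΩU hG hb hN' hN1 hx (s x)
    beta_reduce
    rw [inner_sub_right]
    rw [← hP] at h1
    linarith
  refine hle.trans (le_of_eq ?_)
  simp only [surfaceIntegral, smul_sub] at hB0 ⊢
  rw [integral_sub, integral_sub]
  · have h3 : ∀ g : Eu n → ℝ, ∫ x in frontier Ω, surfaceDensity G (frontier Ω) x • (1 / 2 * g x)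
        ∂(μHE[n - 1] : Measure (Eu n)) =
        1 / 2 * ∫ x in frontier Ω, surfaceDensity G (frontier Ω) x • g x ∂μHE[n - 1] := by
      intro g
      rw [← integral_const_mul]
      refine integral_congr_ae (Eventually.of_forall fun x => ?_)
      simp only [smul_eq_mul]
      ring
    rw [h3, h3, hB0]
    ring
  · exact hint hc2
  · exact hint (continuousOn_const.mul hc3)
  · have := (hint hc2).sub (hint (continuousOn_const.mul hc3) (g := fun x => 1 / 2 *
      ((meanCurvature G Ω x - traceNormDifferential G (frontier Ω) N x) * ‖s x‖ ^ 2)))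
    exact this
  · exact hint (continuousOn_const.mul hBc)

end Inequality

/-! ### Tuples of spinors -/

section SpinRep

variable {n m : ℕ} {Δ : Type*} [NormedAddCommGroup Δ] [InnerProductSpace ℂ Δ]

/-- The Clifford relations of the generators, from the polar form of the quadratic form. -/
theorem SpinRep.gen_mul_gen (ρ : SpinRep n Δ) (a c : Fin n) :
    ρ.gen a * ρ.gen c + ρ.gen c * ρ.gen a = -((if a = c then (2 : ℂ) else 0) • 1) := by
  have h : QuadraticMap.polar (cliffordForm n) (Pi.single a 1) (Pi.single c 1) =
      -(if a = c then (2 : ℂ) else 0) := by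
    simp only [QuadraticMap.polar, cliffordForm, QuadraticMap.weightedSumSquares_apply,
      Pi.add_apply, smul_eq_mul, ← Finset.sum_sub_distrib]
    have h1 : ∀ i, (-1 : ℂ) * (((Pi.single a 1 : Fin n → ℂ) i + (Pi.single c 1 : Fin n → ℂ) i) *
        ((Pi.single a 1 : Fin n → ℂ) i + (Pi.single c 1 : Fin n → ℂ) i)) -
        -1 * ((Pi.single a 1 : Fin n → ℂ) i * (Pi.single a 1 : Fin n → ℂ) i) -
        -1 * ((Pi.single c 1 : Fin n → ℂ) i * (Pi.single c 1 : Fin n → ℂ) i) =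
        -(Pi.single a (2 * (Pi.single c 1 : Fin n → ℂ) a) : Fin n → ℂ) i := by
      intro i
      rcases eq_or_ne i a with rfl | hi
      · simp only [Pi.single_eq_same]
        ring
      · simp only [Pi.single_eq_of_ne hi]
        ring
    simp only [h1, Finset.sum_neg_distrib, Finset.sum_pi_single', Finset.mem_univ, if_true]
    rw [Pi.single_apply]
    split_ifs <;> simp
  rw [SpinRep.gen, SpinRep.gen, ← map_mul ρ.toAlgHom, ← map_mul ρ.toAlgHom, ← map_add,
    CliffordAlgebra.ι_mul_ι_add_swap, h, AlgHom.commutes, Algebra.algebraMap_eq_smul_one, neg_smul]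

theorem SpinRep.gen_gen_apply (ρ : SpinRep n Δ) (a c : Fin n) (u : Δ) :
    ρ.gen a (ρ.gen c u) + ρ.gen c (ρ.gen a u) = -((if a = c then (2 : ℂ) else 0) • u) := by
  have h := congrArg (fun T : Module.End ℂ Δ => T u) (ρ.gen_mul_gen a c)
  simpa only [LinearMap.add_apply, Module.End.mul_apply, LinearMap.neg_apply, LinearMap.smul_apply,
    Module.End.one_apply] using h

variable (ρ : SpinRep n Δ) (sHat : OrthonormalBasis (Fin m) ℂ Δ)

theorem conj_omega (a : Fin n) (α β : Fin m) :
    starRingEnd ℂ (omega ρ sHat a β α) = -omega ρ sHat a α β := by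
  rw [omega, omega, herm, herm, inner_conj_symm]
  exact ρ.skewAdjoint a _ _

/-- The matrices `ω_a` represent the opposite of the Clifford algebra. -/
theorem sum_omega_mul_omega (a c : Fin n) (α δ : Fin m) :
    ∑ β, omega ρ sHat a α β * omega ρ sHat c β δ =
      inner ℂ (sHat δ) (ρ.gen c (ρ.gen a (sHat α))) := by
  conv_rhs => rw [← sHat.sum_repr' (ρ.gen a (sHat α))]
  simp only [map_sum, map_smul, inner_sum, inner_smul_right]
  rfl

/-- Tuples of spinors as a real inner product space, with the real part of the Hermitian inner
product. -/
instance tupleInnerProductSpace {ι : Type*} [Fintype ι] :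
    InnerProductSpace ℝ (PiLp 2 fun _ : ι => Δ) :=
  letI : InnerProductSpace ℝ Δ := InnerProductSpace.complexToReal
  PiLp.innerProductSpace _

/-- An endomorphism of the spinor space acting on each member of a tuple, as a real linear map. -/
def tupleEnd (ι : Type*) [Fintype ι] (T : Module.End ℂ Δ) :
    Module.End ℝ (PiLp 2 fun _ : ι => Δ) where
  toFun u := WithLp.toLp 2 fun α => T (u α)
  map_add' u v := by
    ext α
    simp
  map_smul' r u := by
    ext α
    simp

/-- A complex matrix acting on tuples of spinors, as a real linear map. It commutes with every
`tupleEnd`. -/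
def tupleMatrix {ι : Type*} [Fintype ι] (M : ι → ι → ℂ) :
    Module.End ℝ (PiLp 2 fun _ : ι => Δ) where
  toFun u := WithLp.toLp 2 fun α => ∑ β, M α β • u β
  map_add' u v := by
    ext α
    simp [Finset.sum_add_distrib]
  map_smul' r u := by
    ext α
    simp [Finset.smul_sum, smul_comm r]

theorem tupleEnd_apply {ι : Type*} [Fintype ι] (T : Module.End ℂ Δ) (u : PiLp 2 fun _ : ι => Δ)
    (α : ι) : tupleEnd ι T u α = T (u α) := rfl

theorem tupleMatrix_apply {ι : Type*} [Fintype ι] (M : ι → ι → ℂ) (u : PiLp 2 fun _ : ι => Δ)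
    (α : ι) : tupleMatrix M u α = ∑ β, M α β • u β := rfl

theorem commute_tupleEnd_tupleMatrix {ι : Type*} [Fintype ι] (T : Module.End ℂ Δ)
    (M : ι → ι → ℂ) : Commute (tupleEnd ι T) (tupleMatrix M) := by
  refine LinearMap.ext fun u => ?_
  ext α
  simp only [Module.End.mul_apply, tupleEnd_apply, tupleMatrix_apply, map_sum, map_smul]

theorem real_inner_tuple {ι : Type*} [Fintype ι] (u v : PiLp 2 fun _ : ι => Δ) :
    inner ℝ u v = ∑ α, (inner ℂ (u α) (v α)).re := by
  rfl

theorem isClifford_tupleEnd : IsClifford fun a => tupleEnd (Fin m) (ρ.gen a) := by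
  intro a c
  refine LinearMap.ext fun u => ?_
  ext α
  have h := ρ.gen_gen_apply a c (u α)
  simp only [LinearMap.add_apply, Module.End.mul_apply, LinearMap.neg_apply, LinearMap.smul_apply,
    Module.End.one_apply, PiLp.add_apply, PiLp.neg_apply, PiLp.smul_apply, tupleEnd_apply, h]
  split_ifs
  · rw [← Complex.coe_smul]
    norm_num
  · simp

theorem isSkew_tupleEnd : IsSkew fun a => tupleEnd (Fin m) (ρ.gen a) := by
  intro a u v
  simp only [real_inner_tuple, tupleEnd_apply, ← Finset.sum_neg_distrib, ← Complex.neg_re]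
  exact Finset.sum_congr rfl fun α _ => congrArg Complex.re (ρ.skewAdjoint a _ _)

/-- The matrices `ω_a` satisfy the Clifford relations, which do not distinguish the Clifford algebra
from its opposite. -/
theorem isClifford_tupleMatrix :
    IsClifford fun a => tupleMatrix (Δ := Δ) (omega ρ sHat a) := by
  intro a c
  have h : ∀ (a c : Fin n) (u : PiLp 2 fun _ : Fin m => Δ) (α : Fin m),
      tupleMatrix (omega ρ sHat a) (tupleMatrix (omega ρ sHat c) u) α =
        ∑ δ, inner ℂ (sHat δ) (ρ.gen c (ρ.gen a (sHat α))) • u δ := by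
    intro a c u α
    simp only [tupleMatrix_apply, Finset.smul_sum, smul_smul, ← sum_omega_mul_omega ρ sHat,
      Finset.sum_smul]
    exact Finset.sum_comm
  refine LinearMap.ext fun u => ?_
  ext α
  simp only [LinearMap.add_apply, Module.End.mul_apply, LinearMap.neg_apply, LinearMap.smul_apply,
    Module.End.one_apply, PiLp.add_apply, PiLp.neg_apply, PiLp.smul_apply, h,
    ← Finset.sum_add_distrib, ← add_smul, ← inner_add_right]
  simp only [add_comm (ρ.gen c _), ρ.gen_gen_apply, inner_neg_right, inner_smul_right,
    orthonormal_iff_ite.1 sHat.orthonormal]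
  split_ifs
  · rw [← Complex.coe_smul]
    simp
  · simp

/-- The matrices `ω_a` are skew-Hermitian because the generators are skew-adjoint. -/
theorem isSkew_tupleMatrix : IsSkew fun a => tupleMatrix (Δ := Δ) (omega ρ sHat a) := by
  intro a u v
  simp only [real_inner_tuple, tupleMatrix_apply, sum_inner, inner_sum, inner_smul_left,
    inner_smul_right, conj_omega, Complex.re_sum, ← Finset.sum_neg_distrib]
  rw [Finset.sum_comm]
  refine Finset.sum_congr rfl fun β _ => Finset.sum_congr rfl fun α _ => ?_
  rw [← Complex.neg_re, neg_mul]

end SpinRep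

section Components

variable {n m : ℕ} {Δ : Type*} [NormedAddCommGroup Δ] [InnerProductSpace ℂ Δ]
  [FiniteDimensional ℝ Δ]
  {ρ : SpinRep n Δ} {G : Eu n → Matrix (Fin n) (Fin n) ℝ} {b : Fin n → Eu n → Eu n}
  {A Ω U : Set (Eu n)} {s : Fin m → Eu n → Δ} {x : Eu n}

/-- A tuple of spinor fields as a field of tuples. -/
def tupleField (s : Fin m → Eu n → Δ) (x : Eu n) : PiLp 2 fun _ : Fin m => Δ :=
  WithLp.toLp 2 fun α => s α x

theorem contDiffOn_tupleField {k : WithTop ℕ∞} (hs : ∀ α, ContDiffOn ℝ k (s α) A) :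
    ContDiffOn ℝ k (tupleField s) A :=
  (contDiffOn_piLp 2).2 hs

/-- The spin connection acts componentwise. The hypothesis on `fderivWithin` is automatic where
derivatives within `A` are unique; on a hypersurface it holds for tangent `X`. -/
theorem spinorDerivOn_tupleField_apply {X : Eu n} {α : Fin m}
    (h : fderivWithin ℝ (s α) A x X = fderivWithin ℝ (tupleField s) A x X α) :
    spinorDerivOn (fun a => tupleEnd (Fin m) (ρ.gen a)) G b A (tupleField s) x X α =
      spinDeriv ρ G b A (s α) x X := by
  rw [spinorDerivOn_apply, spinDeriv, spinConn_apply_apply, h]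
  simp only [PiLp.add_apply, PiLp.smul_apply, WithLp.ofLp_sum, Finset.sum_apply, tupleEnd_apply,
    Complex.coe_smul]
  rw [← Complex.coe_smul]
  push_cast
  rfl

theorem hasFDerivWithinAt_tupleField_apply (hd : DifferentiableWithinAt ℝ (tupleField s) A x)
    (α : Fin m) : HasFDerivWithinAt (s α)
      ((PiLp.proj 2 (fun _ : Fin m => Δ) α).comp (fderivWithin ℝ (tupleField s) A x)) A x :=
  (PiLp.proj (𝕜 := ℝ) 2 (fun _ : Fin m => Δ) α).hasFDerivAt.comp_hasFDerivWithinAt x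
    hd.hasFDerivWithinAt

theorem cliffordAct_tupleEnd_apply (ξ : Eu n) (u : PiLp 2 fun _ : Fin m => Δ) (α : Fin m) :
    cliffordAct (fun a => tupleEnd (Fin m) (ρ.gen a)) G b x ξ u α =
      cliffordMul ρ G b x ξ (u α) := by
  rw [cliffordAct_eq, cliffordSum_apply, cliffordMul]
  simp only [PiLp.smul_apply, WithLp.ofLp_sum, Finset.sum_apply, tupleEnd_apply, Complex.coe_smul]

theorem cliffordMul_frame (hb : IsOrientedOrthonormalFrame G U b) (hx : x ∈ U) (a : Fin n)
    (u : Δ) : cliffordMul ρ G b x (b a x) u = ρ.gen a u := by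
  simp [cliffordMul, hb.2.1 x hx]

theorem diracOn_tupleField_apply (hb : IsOrientedOrthonormalFrame G U b) (hxU : x ∈ U)
    (hA : UniqueDiffWithinAt ℝ A x) (hd : DifferentiableWithinAt ℝ (tupleField s) A x)
    (α : Fin m) :
    diracOn (fun a => tupleEnd (Fin m) (ρ.gen a)) G b A (tupleField s) x α =
      dirac ρ G b A (s α) x := by
  have h := fun X => congrArg (fun L => L X)
    ((hasFDerivWithinAt_tupleField_apply hd α).fderivWithin hA)
  simp only [diracOn, dirac, WithLp.ofLp_sum, Finset.sum_apply, tupleEnd_apply,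
    cliffordMul_frame hb hxU]
  exact Finset.sum_congr rfl fun a _ => by rw [spinorDerivOn_tupleField_apply (h _)]

theorem sum_norm_spinorDerivOn_tupleField (hA : UniqueDiffWithinAt ℝ A x)
    (hd : DifferentiableWithinAt ℝ (tupleField s) A x) :
    ∑ a, ‖spinorDerivOn (fun a => tupleEnd (Fin m) (ρ.gen a)) G b A (tupleField s) x (b a x)‖ ^ 2 =
      ∑ α, gradNormSq ρ G b A (s α) x := by
  have h := fun α X => congrArg (fun L => L X)
    ((hasFDerivWithinAt_tupleField_apply hd α).fderivWithin hA)
  simp only [PiLp.norm_sq_eq_of_L2, gradNormSq]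
  rw [Finset.sum_comm]
  exact Finset.sum_congr rfl fun α _ => Finset.sum_congr rfl fun a _ => by
    rw [spinorDerivOn_tupleField_apply (h _ _)]

theorem boundaryDiracOn_tupleField_apply (hΩ : IsSmoothCompactDomain Ω) (hΩU : Ω ⊆ U)
    (hG : IsRiemannianMetricOn G U) (hx : x ∈ frontier Ω)
    (hd : DifferentiableWithinAt ℝ (tupleField s) (frontier Ω) x) (α : Fin m) :
    boundaryDiracOn (fun a => tupleEnd (Fin m) (ρ.gen a)) G b Ω (tupleField s) x α =
      boundaryDirac ρ G b Ω (s α) x := by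
  have he := (isTangentFrame_tangentFrame hΩ hΩU hG hx).1
  simp only [boundaryDiracOn, boundaryDirac, PiLp.add_apply, PiLp.smul_apply, WithLp.ofLp_sum,
    Finset.sum_apply, cliffordAct_tupleEnd_apply, Complex.coe_smul]
  congr 1
  refine Finset.sum_congr rfl fun k _ => ?_
  rw [spinorDerivOn_tupleField_apply]
  exact fderivWithin_apply_of_mem_tangentSpace (hasFDerivWithinAt_tupleField_apply hd α) (he k)

theorem boundaryChi_tupleField_apply (sHat : OrthonormalBasis (Fin m) ℂ Δ) (N : Eu n → Eu n)
    (α : Fin m) :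
    boundaryChi (fun a => tupleEnd (Fin m) (ρ.gen a)) (fun a => tupleMatrix (omega ρ sHat a))
      G b Ω N (tupleField s) x α = chi ρ G b sHat Ω N s α x := by
  have hN : ∀ a, inner ℝ (N x) (stdVec a) = (N x).ofLp a := fun a => by
    simp [stdVec, EuclideanSpace.inner_single_right]
  simp only [boundaryChi, chi, PiLp.neg_apply, cliffordAct_tupleEnd_apply, cliffordSum_apply,
    PiLp.smul_apply, WithLp.ofLp_sum, Finset.sum_apply, tupleMatrix_apply, hN]
  congr 1
  simp only [cliffordMul, map_sum, Finset.smul_sum, ← Complex.coe_smul, map_smul, smul_smul]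
  rw [Finset.sum_comm]
  refine Finset.sum_congr rfl fun a _ => ?_
  rw [Finset.sum_comm]
  refine Finset.sum_congr rfl fun β _ => Finset.sum_congr rfl fun c _ => ?_
  congr 1
  ring

end Components

/-! ### Integrability -/

section Integrability

variable {n : ℕ} {G : Eu n → Matrix (Fin n) (Fin n) ℝ} {Ω U : Set (Eu n)}

theorem contDiffOn_scalarCurvature (hG : IsRiemannianMetricOn G U) (hU : IsOpen U) :
    ContDiffOn ℝ ∞ (scalarCurvature G) U := by
  have hΓ := contDiffOn_christoffel hG hU
  refine ContDiffOn.sum fun j _ => ContDiffOn.sum fun k _ =>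
    (contDiffOn_inv_apply hG.1 (fun x hx => (hG.2 x hx).det_pos.ne') j k).mul ?_
  refine ContDiffOn.sum fun i _ => ?_
  refine ((contDiffOn_partialDeriv hU (hΓ _ _ _) i).sub
    (contDiffOn_partialDeriv hU (hΓ _ _ _) j)).add ?_
  exact ContDiffOn.sum fun l _ => ((hΓ _ _ _).mul (hΓ _ _ _)).sub ((hΓ _ _ _).mul (hΓ _ _ _))

theorem IsSmoothCompactDomain.integrableOn_mul_sqrt_det (hΩ : IsSmoothCompactDomain Ω)
    (hΩU : Ω ⊆ U) (hG : IsRiemannianMetricOn G U) {f : Eu n → ℝ} (hf : ContinuousOn f Ω) :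
    IntegrableOn (fun x => f x * √(G x).det) Ω :=
  (hf.mul ((contDiffOn_sqrt_det hG).continuousOn.mono hΩU)).integrableOn_compact hΩ.1

theorem volIntegral_sub_add (hΩ : IsSmoothCompactDomain Ω) (hΩU : Ω ⊆ U)
    (hG : IsRiemannianMetricOn G U) {f g h : Eu n → ℝ} (hf : ContinuousOn f Ω)
    (hg : ContinuousOn g Ω) (hh : ContinuousOn h Ω) (c : ℝ) :
    volIntegral G Ω (fun x => f x - g x + c * h x) =
      -volIntegral G Ω g + volIntegral G Ω f + c * volIntegral G Ω h := by
  have hf' := hΩ.integrableOn_mul_sqrt_det hΩU hG hf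
  have hg' := hΩ.integrableOn_mul_sqrt_det hΩU hG hg
  have hh' := hΩ.integrableOn_mul_sqrt_det hΩU hG hh
  simp only [volIntegral, add_mul, sub_mul, mul_assoc]
  have h1 := integral_add (hf'.sub hg') (hh'.const_mul c)
  simp only [Pi.sub_apply] at h1
  rw [h1, integral_sub hf' hg', integral_const_mul]
  ring

theorem volIntegral_congr (hΩ : IsSmoothCompactDomain Ω) {f g : Eu n → ℝ} (h : Set.EqOn f g Ω) :
    volIntegral G Ω f = volIntegral G Ω g :=
  setIntegral_congr_fun hΩ.1.isClosed.measurableSet fun x hx => by simp only [h hx]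

theorem surfaceIntegral_congr {F : Type*} [NormedAddCommGroup F] [NormedSpace ℝ F]
    {f g : Eu n → F} (h : Set.EqOn f g (frontier Ω)) :
    surfaceIntegral G (frontier Ω) f = surfaceIntegral G (frontier Ω) g :=
  setIntegral_congr_fun isClosed_frontier.measurableSet fun x hx => by simp only [h hx]

/-- Half the sum of the integrals of a function and of its conjugate is the integral of the real
part. -/
theorem half_surfaceIntegral_add_conj (hΩ : IsSmoothCompactDomain Ω) (hn : n ≠ 0) (hU : IsOpen U)
    (hΩU : Ω ⊆ U) (hG : IsRiemannianMetricOn G U) {f : Eu n → ℂ}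
    (hf : ContinuousOn f (frontier Ω)) :
    (1 / 2 : ℂ) * surfaceIntegral G (frontier Ω) f +
      (1 / 2 : ℂ) * surfaceIntegral G (frontier Ω) (fun x => starRingEnd ℂ (f x)) =
      (surfaceIntegral G (frontier Ω) fun x => (f x).re : ℝ) := by
  have hi : IntegrableOn (fun x => surfaceDensity G (frontier Ω) x • f x) (frontier Ω)
      (μHE[n - 1]) :=
    hΩ.integrableOn_frontier hn ((continuousOn_surfaceDensity hΩ hU hΩU hG).smul hf)
  have h1 : surfaceIntegral G (frontier Ω) (fun x => starRingEnd ℂ (f x)) =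
      starRingEnd ℂ (surfaceIntegral G (frontier Ω) f) := by
    rw [surfaceIntegral, surfaceIntegral, ← integral_conj]
    simp
  have h2 : surfaceIntegral G (frontier Ω) (fun x => (f x).re) =
      (surfaceIntegral G (frontier Ω) f).re := by
    rw [surfaceIntegral, surfaceIntegral]
    refine Eq.trans ?_ (integral_re hi)
    simp
  rw [h1, h2, ← mul_add, Complex.add_conj]
  push_cast
  ring

end Integrability

end SpinDomain

end

theorem proposition2 (n : ℕ) (hn : 3 ≤ n) (hodd : Odd n)
    {Δ : Type*} [NormedAddCommGroup Δ] [InnerProductSpace ℂ Δ]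
    (ρ : SpinRep n Δ) (sHat : OrthonormalBasis (Fin (2 ^ (n / 2))) ℂ Δ)
    (Ω U : Set (Eu n)) (hΩ : IsSmoothCompactDomain Ω) (hU : IsOpen U) (hΩU : Ω ⊆ U)
    (G : Eu n → Matrix (Fin n) (Fin n) ℝ) (hG : IsRiemannianMetricOn G U)
    (b : Fin n → Eu n → Eu n) (hb : IsOrientedOrthonormalFrame G U b)
    (N : Eu n → Eu n) (hN : ContDiffOn ℝ ∞ N (frontier Ω)) (hN1 : ∀ x ∈ frontier Ω, ‖N x‖ = 1)
    (s : Fin (2 ^ (n / 2)) → Eu n → Δ) (hs : ∀ α, ContDiffOn ℝ ∞ (s α) Ω) :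
    ((-volIntegral G Ω (fun x => ∑ α, ‖dirac ρ G b Ω (s α) x‖ ^ 2)
        + volIntegral G Ω (fun x => ∑ α, gradNormSq ρ G b Ω (s α) x)
        + 1 / 4 * volIntegral G Ω (fun x => ∑ α, scalarCurvature G x * ‖s α x‖ ^ 2) : ℝ) : ℂ)
      ≤ (1 / 2 : ℂ) * surfaceIntegral G (frontier Ω) (fun x =>
            ∑ α, herm (boundaryDirac ρ G b Ω (s α) x) (s α x - chi ρ G b sHat Ω N s α x))
        + (1 / 2 : ℂ) * surfaceIntegral G (frontier Ω) (fun x =>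
            ∑ α, herm (s α x - chi ρ G b sHat Ω N s α x) (boundaryDirac ρ G b Ω (s α) x))
        - ((1 / 2 * surfaceIntegral G (frontier Ω) (fun x =>
            (meanCurvature G Ω x - traceNormDifferential G (frontier Ω) N x)
              * ∑ α, ‖s α x‖ ^ 2) : ℝ) : ℂ) := by
  have hn0 : n ≠ 0 := by omega
  have : FiniteDimensional ℂ Δ := sHat.toBasis.finiteDimensional_of_finite
  have : FiniteDimensional ℝ Δ := FiniteDimensional.complexToReal Δ
  set γ : Fin n → Module.End ℝ (PiLp 2 fun _ : Fin (2 ^ (n / 2)) => Δ) := fun a =>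
    tupleEnd _ (ρ.gen a) with hγ
  set τ : Fin n → Module.End ℝ (PiLp 2 fun _ : Fin (2 ^ (n / 2)) => Δ) := fun a =>
    tupleMatrix (omega ρ sHat a) with hτ
  set t := tupleField s with ht
  have hts : ContDiffOn ℝ ∞ t Ω := contDiffOn_tupleField hs
  have hsub := hΩ.frontier_subset
  have hd : ∀ x ∈ Ω, DifferentiableWithinAt ℝ t Ω x := hts.differentiableOn (by simp)
  have hnorm : ∀ x, ‖t x‖ ^ 2 = ∑ α, ‖s α x‖ ^ 2 := fun x => PiLp.norm_sq_eq_of_L2 _ _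
  have key := volIntegral_le_surfaceIntegral (isClifford_tupleEnd ρ) (isSkew_tupleEnd ρ)
    (isClifford_tupleMatrix ρ sHat) (isSkew_tupleMatrix ρ sHat)
    (fun a c => commute_tupleEnd_tupleMatrix (ρ.gen a) (omega ρ sHat c)) hΩ hn0 hU hΩU hG hb
    hts hN hN1
  rw [← hγ, ← hτ] at key
  have hvol : volIntegral G Ω (fun x => ∑ a, ‖spinorDerivOn γ G b Ω t x (b a x)‖ ^ 2 -
        ‖diracOn γ G b Ω t x‖ ^ 2 + 1 / 4 * scalarCurvature G x * ‖t x‖ ^ 2) =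
      -volIntegral G Ω (fun x => ∑ α, ‖dirac ρ G b Ω (s α) x‖ ^ 2)
        + volIntegral G Ω (fun x => ∑ α, gradNormSq ρ G b Ω (s α) x)
        + 1 / 4 * volIntegral G Ω (fun x => ∑ α, scalarCurvature G x * ‖s α x‖ ^ 2) := by
    have h1 : ContinuousOn (fun x => ∑ a, ‖spinorDerivOn γ G b Ω t x (b a x)‖ ^ 2) Ω :=
      continuousOn_finsetSum _ fun a _ =>
        ((contDiffOn_spinorDerivOn hΩ hU hΩU hG hb hts a).continuousOn.norm).pow 2
    have h2 : ContinuousOn (fun x => ‖diracOn γ G b Ω t x‖ ^ 2) Ω :=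
      ((contDiffOn_diracOn hΩ hU hΩU hG hb hts).continuousOn.norm).pow 2
    have h3 : ContinuousOn (fun x => scalarCurvature G x * ‖t x‖ ^ 2) Ω :=
      ((contDiffOn_scalarCurvature hG hU).continuousOn.mono hΩU).mul
        (hts.continuousOn.norm.pow 2)
    simp only [mul_assoc]
    rw [volIntegral_sub_add hΩ hΩU hG h1 h2 h3]
    congr 2
    · rw [neg_inj]
      refine volIntegral_congr hΩ fun x hx => ?_
      simp only [PiLp.norm_sq_eq_of_L2]
      exact Finset.sum_congr rfl fun α _ => by
        rw [diracOn_tupleField_apply hb (hΩU hx) (hΩ.uniqueDiffOn x hx) (hd x hx)]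
    · exact volIntegral_congr hΩ fun x hx =>
        sum_norm_spinorDerivOn_tupleField (hΩ.uniqueDiffOn x hx) (hd x hx)
    · simp only [hnorm, Finset.mul_sum]
  have hD : ∀ x ∈ frontier Ω, ∀ α, boundaryDiracOn γ G b Ω t x α =
      boundaryDirac ρ G b Ω (s α) x := fun x hx α =>
    boundaryDiracOn_tupleField_apply hΩ hΩU hG hx ((hd x (hsub hx)).mono hsub) α
  have hχ : ∀ x α, boundaryChi γ τ G b Ω N t x α = chi ρ G b sHat Ω N s α x := fun x α =>
    boundaryChi_tupleField_apply sHat N α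
  have hcD := continuousOn_boundaryDiracOn (isClifford_tupleEnd ρ) (isSkew_tupleEnd ρ) hΩ hn0 hU
    hΩU hG hb hts
  have hcχ : ContinuousOn (boundaryChi γ τ G b Ω N t) (frontier Ω) :=
    (continuousOn_cliffordAct_normal hΩ hU hΩU hG hb
      (continuousOn_cliffordSum hN.continuousOn (hts.continuousOn.mono hsub))).neg
  have hcont : ContinuousOn (fun x => ∑ α, herm (boundaryDirac ρ G b Ω (s α) x)
      (s α x - chi ρ G b sHat Ω N s α x)) (frontier Ω) := by
    refine continuousOn_finsetSum _ fun α _ => ?_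
    have h1 : ContinuousOn (fun x => boundaryDirac ρ G b Ω (s α) x) (frontier Ω) :=
      ((PiLp.continuous_apply 2 _ α).comp_continuousOn hcD).congr fun x hx => (hD x hx α).symm
    have h2 : ContinuousOn (fun x => chi ρ G b sHat Ω N s α x) (frontier Ω) :=
      ((PiLp.continuous_apply 2 _ α).comp_continuousOn hcχ).congr fun x _ => (hχ x α).symm
    exact (((hs α).continuousOn.mono hsub).sub h2).inner h1
  have hre : surfaceIntegral G (frontier Ω) (fun x =>
        inner ℝ (boundaryDiracOn γ G b Ω t x) (t x - boundaryChi γ τ G b Ω N t x)) =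
      surfaceIntegral G (frontier Ω) (fun x => (∑ α, herm (boundaryDirac ρ G b Ω (s α) x)
        (s α x - chi ρ G b sHat Ω N s α x)).re) := by
    refine surfaceIntegral_congr fun x hx => ?_
    simp only [real_inner_tuple, Complex.re_sum, PiLp.sub_apply, hχ, hD x hx]
    refine Finset.sum_congr rfl fun α _ => ?_
    rw [herm, ← inner_conj_symm, Complex.conj_re]
    rfl
  have hconj : (fun x => ∑ α, herm (s α x - chi ρ G b sHat Ω N s α x)
      (boundaryDirac ρ G b Ω (s α) x)) = fun x => starRingEnd ℂ (∑ α,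
      herm (boundaryDirac ρ G b Ω (s α) x) (s α x - chi ρ G b sHat Ω N s α x)) := by
    funext x
    rw [map_sum]
    exact Finset.sum_congr rfl fun α _ => (inner_conj_symm _ _).symm
  rw [hvol, hre] at key
  simp only [hnorm] at key
  rw [hconj, half_surfaceIntegral_add_conj hΩ hn0 hU hΩU hG hcont, ← Complex.ofReal_sub]
  exact Complex.real_le_real.2 key
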